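/- Let $k$ be an algebraically closed field of characteristic zero, let $G$ be a finite nilpotent group, and let $J\in kG\otimes kG$ be a twist, that is, an invertible element with $$(\Delta\otimes \mathrm{id})(J)(J\otimes 1)=(\mathrm{id}\otimes\Delta)(J)(1\otimes J),\qquad (\varepsilon\otimes \mathrm{id})(J)=(\mathrm{id}\otimes\varepsilon)(J)=1 .$$ Let $A=(kG)^J$ be the twisted Hopf algebra: $A=kG$ as an algebra, with the same counit, with comultiplication $\Delta^J(h)=J^{-1}\Delta(h)J$ and antipode $S^J(h)=v^{-1}S(h)v$, where $v=m(S\otimes \mathrm{id})(J)$. A Hopf subalgebra $K$ of a finite dimensional Hopf algebra $H$ is normal if it is stable under the left adjoint action $x\mapsto \sum h_1xS(h_2)$, $h\in H$; write $K^+=K\cap\ker\varepsilon$. A lower normal series for $H$ is a strictly decreasing chain of Hopf subalgebras $H=H_0\supset H_1\supset\cdots\supset H_n=k$ with $H_{i+1}$ normal in $H_i$ for all $i$; its factors are the quotients $H_i/H_iH_{i+1}^+$. An upper normal series for $H$ consists of Hopf algebras $H_{(0)}=H, H_{(1)},\dots,H_{(n)}=k$ and normal Hopf subalgebras $H_i$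 of $H_{(i-1)}$ with $H_{(i)}=H_{(i-1)}/H_{(i-1)}H_i^+$ for $1\le i\le n$, and $H_n=H_{(n-1)}$; its factors are the Hopf subalgebras $H_i$. (For $H=k$ the series of length $n=0$ is allowed in both cases.) $H$ is semisolvable if it has a lower or an upper normal series each of whose factors is commutative or cocommutative. Then: 1. $A$ has an upper normal series each of whose factors is isomorphic as a Hopf algebra to $k\mathbb Z_p$ for some prime $p$ dividing $\dim A$ (the prime may vary with the factor); 2. $A$ has a lower normal series whose factors are all cocommutative. In particular, $A$ is semisolvable. -/

import Mathlib

open TensorProduct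

noncomputable section

universe u v w

section TwistDef

variable {k : Type u} {H : Type v} [Field k] [Ring H] [HopfAlgebra k H]

/-- `J` is a twist in the Hopf algebra `H`: an invertible `J ∈ H ⊗ H` such that
`(Δ ⊗ id)(J) (J ⊗ 1) = (id ⊗ Δ)(J) (1 ⊗ J)` (compared in `H ⊗ (H ⊗ H)` through the associator)
and `(ε ⊗ id)(J) = (id ⊗ ε)(J) = 1`. -/
structure IsHopfTwist (J : (H ⊗[k] H)ˣ) : Prop where
  cocycle :
    Algebra.TensorProduct.assoc k k k H H H
      (Algebra.TensorProduct.map (Bialgebra.comulAlgHom k H) (AlgHom.id k H) (J : H ⊗[k] H)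
        * ((J : H ⊗[k] H) ⊗ₜ[k] (1 : H)))
    = Algebra.TensorProduct.map (AlgHom.id k H) (Bialgebra.comulAlgHom k H) (J : H ⊗[k] H)
        * ((1 : H) ⊗ₜ[k] (J : H ⊗[k] H))
  counit_left :
    Algebra.TensorProduct.lid k H
      (Algebra.TensorProduct.map (Bialgebra.counitAlgHom k H) (AlgHom.id k H) (J : H ⊗[k] H)) = 1
  counit_right :
    Algebra.TensorProduct.rid k k H
      (Algebra.TensorProduct.map (AlgHom.id k H) (Bialgebra.counitAlgHom k H) (J : H ⊗[k] H)) = 1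

variable (k H) in
/-- Twists in `H`, bundled. -/
structure HopfTwist where
  /-- the underlying invertible element of `H ⊗ H` -/
  elt : (H ⊗[k] H)ˣ
  isTwist : IsHopfTwist elt

namespace HopfTwist

variable (J : HopfTwist k H)

/-- The twisted comultiplication `Δ^J(h) = J⁻¹ Δ(h) J`. -/
def comulHom : H →ₐ[k] H ⊗[k] H :=
  AlgHom.ofLinearMap
    (LinearMap.mulLeft k (↑J.elt⁻¹ : H ⊗[k] H) ∘ₗ LinearMap.mulRight k (↑J.elt : H ⊗[k] H)
      ∘ₗ (Bialgebra.comulAlgHom k H).toLinearMap)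
    (by simp)
    (by intro x y; simp [mul_assoc])

theorem comulHom_apply (h : H) :
    J.comulHom h = ↑J.elt⁻¹ * Coalgebra.comul (R := k) h * ↑J.elt := by
  simp [comulHom, mul_assoc]

/-- The element `v = m (S ⊗ id)(J)`. -/
def v : H :=
  LinearMap.mul' k H
    (TensorProduct.map (HopfAlgebra.antipode k) LinearMap.id (↑J.elt : H ⊗[k] H))

/-- The element `m (id ⊗ S)(J⁻¹)`, which is the inverse of `v` (see `v_mul_vInv`, `vInv_mul_v`). -/
def vInv : H :=
  LinearMap.mul' k H
    (TensorProduct.map LinearMap.id (HopfAlgebra.antipode k) (↑J.elt⁻¹ : H ⊗[k] H))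

/-- The twisted antipode `S^J(h) = v⁻¹ S(h) v`. -/
def antipodeHom : H →ₗ[k] H :=
  LinearMap.mulLeft k J.vInv ∘ₗ LinearMap.mulRight k J.v ∘ₗ HopfAlgebra.antipode k

theorem antipodeHom_apply (h : H) :
    J.antipodeHom h = J.vInv * HopfAlgebra.antipode k h * J.v := by
  simp [antipodeHom, mul_assoc]

theorem map_comulHom_id (x : H ⊗[k] H) :
    Algebra.TensorProduct.map J.comulHom (AlgHom.id k H) x =
      ((↑J.elt⁻¹ : H ⊗[k] H) ⊗ₜ[k] (1 : H)) *
        Algebra.TensorProduct.map (Bialgebra.comulAlgHom k H) (AlgHom.id k H) x *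
        ((↑J.elt : H ⊗[k] H) ⊗ₜ[k] (1 : H)) := by
  induction x with
  | zero => simp
  | tmul a b => simp [comulHom_apply]
  | add a b ha hb => simp only [map_add, ha, hb, mul_add, add_mul]

theorem map_id_comulHom (x : H ⊗[k] H) :
    Algebra.TensorProduct.map (AlgHom.id k H) J.comulHom x =
      ((1 : H) ⊗ₜ[k] (↑J.elt⁻¹ : H ⊗[k] H)) *
        Algebra.TensorProduct.map (AlgHom.id k H) (Bialgebra.comulAlgHom k H) x *
        ((1 : H) ⊗ₜ[k] (↑J.elt : H ⊗[k] H)) := by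
  induction x with
  | zero => simp
  | tmul a b => simp [comulHom_apply]
  | add a b ha hb => simp only [map_add, ha, hb, mul_add, add_mul]

variable (k H) in
/-- `Δ ⊗ id`, with values in `H ⊗ (H ⊗ H)`. -/
def dLeft : H ⊗[k] H →ₐ[k] H ⊗[k] (H ⊗[k] H) :=
  (Algebra.TensorProduct.assoc k k k H H H).toAlgHom.comp
    (Algebra.TensorProduct.map (Bialgebra.comulAlgHom k H) (AlgHom.id k H))

variable (k H) in
/-- `id ⊗ Δ`. -/
def dRight : H ⊗[k] H →ₐ[k] H ⊗[k] (H ⊗[k] H) :=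
  Algebra.TensorProduct.map (AlgHom.id k H) (Bialgebra.comulAlgHom k H)

variable (k H) in
/-- `x ↦ x ⊗ 1`, with values in `H ⊗ (H ⊗ H)`. -/
def i12 : H ⊗[k] H →ₐ[k] H ⊗[k] (H ⊗[k] H) :=
  (Algebra.TensorProduct.assoc k k k H H H).toAlgHom.comp
    Algebra.TensorProduct.includeLeft

variable (k H) in
/-- `x ↦ 1 ⊗ x`. -/
def i23 : H ⊗[k] H →ₐ[k] H ⊗[k] (H ⊗[k] H) :=
  Algebra.TensorProduct.includeRight

theorem cocycle_units :
    Units.map (dLeft k H : H ⊗[k] H →* H ⊗[k] (H ⊗[k] H)) J.elt * Units.map (i12 k H : H ⊗[k] H →* H ⊗[k] (H ⊗[k] H)) J.elt =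
    Units.map (dRight k H : H ⊗[k] H →* H ⊗[k] (H ⊗[k] H)) J.elt * Units.map (i23 k H : H ⊗[k] H →* H ⊗[k] (H ⊗[k] H)) J.elt := by
  ext
  have := J.isTwist.cocycle
  rw [map_mul] at this
  exact this

theorem dLeft_comul (h : H) :
    dLeft k H (Coalgebra.comul (R := k) h) = dRight k H (Coalgebra.comul (R := k) h) :=
  Coalgebra.coassoc_apply h

theorem coassoc_aux (h : H) :
    Algebra.TensorProduct.assoc k k k H H H
      (Algebra.TensorProduct.map J.comulHom (AlgHom.id k H) (J.comulHom h)) =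
    Algebra.TensorProduct.map (AlgHom.id k H) J.comulHom (J.comulHom h) := by
  have e := J.cocycle_units
  have e1 := congrArg Units.val e
  have e2 := congrArg (fun u : (H ⊗[k] (H ⊗[k] H))ˣ => (↑u⁻¹ : H ⊗[k] (H ⊗[k] H))) e
  simp only [Units.val_mul, mul_inv_rev, ← map_inv, Units.coe_map, MonoidHom.coe_coe] at e1 e2
  rw [map_comulHom_id, map_id_comulHom, comulHom_apply, map_mul, map_mul]
  change i12 k H _ * dLeft k H _ * i12 k H _ = i23 k H _ * dRight k H _ * i23 k H _
  rw [map_mul, map_mul, map_mul, map_mul, dLeft_comul]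
  calc _ = (i12 k H ↑J.elt⁻¹ * dLeft k H ↑J.elt⁻¹) * dRight k H (Coalgebra.comul (R := k) h)
          * (dLeft k H ↑J.elt * i12 k H ↑J.elt) := by simp only [mul_assoc]
    _ = _ := by rw [e1, e2]; simp only [mul_assoc]

theorem counit_left_aux (h : H) :
    Algebra.TensorProduct.map (Bialgebra.counitAlgHom k H) (AlgHom.id k H) (J.comulHom h) =
      (1 : k) ⊗ₜ[k] h := by
  have e0 : Algebra.TensorProduct.map (Bialgebra.counitAlgHom k H) (AlgHom.id k H)
      (↑J.elt : H ⊗[k] H) = 1 := by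
    apply (Algebra.TensorProduct.lid k H).injective
    rw [J.isTwist.counit_left, map_one]
  have e1 : Algebra.TensorProduct.map (Bialgebra.counitAlgHom k H) (AlgHom.id k H)
      (↑J.elt⁻¹ : H ⊗[k] H) = 1 := by
    have := congrArg (Algebra.TensorProduct.map (Bialgebra.counitAlgHom k H) (AlgHom.id k H))
      (Units.inv_mul J.elt)
    rwa [map_mul, e0, mul_one, map_one] at this
  rw [comulHom_apply, map_mul, map_mul, e0, e1, one_mul, mul_one]
  exact Coalgebra.rTensor_counit_comul h

theorem counit_right_aux (h : H) :
    Algebra.TensorProduct.map (AlgHom.id k H) (Bialgebra.counitAlgHom k H) (J.comulHom h) =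
      h ⊗ₜ[k] (1 : k) := by
  have e0 : Algebra.TensorProduct.map (AlgHom.id k H) (Bialgebra.counitAlgHom k H)
      (↑J.elt : H ⊗[k] H) = 1 := by
    apply (Algebra.TensorProduct.rid k k H).injective
    rw [J.isTwist.counit_right, map_one]
  have e1 : Algebra.TensorProduct.map (AlgHom.id k H) (Bialgebra.counitAlgHom k H)
      (↑J.elt⁻¹ : H ⊗[k] H) = 1 := by
    have := congrArg (Algebra.TensorProduct.map (AlgHom.id k H) (Bialgebra.counitAlgHom k H))
      (Units.inv_mul J.elt)
    rwa [map_mul, e0, mul_one, map_one] at this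
  rw [comulHom_apply, map_mul, map_mul, e0, e1, one_mul, mul_one]
  exact Coalgebra.lTensor_counit_comul h

open HopfAlgebra in
theorem mul_antipode_mul (X Y : H ⊗[k] H) :
    LinearMap.mul' k H (TensorProduct.map (antipode k) LinearMap.id (X * Y)) =
      LinearMap.mul' k H (TensorProduct.map (antipode k)
        (LinearMap.mulLeft k (LinearMap.mul' k H
          (TensorProduct.map (antipode k) LinearMap.id X))) Y) := by
  induction Y with
  | zero => simp
  | add a b ha hb => simp only [map_add, ha, hb, mul_add]
  | tmul c d =>
    induction X with
    | zero => simp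
    | add a b ha hb => simp_all [add_mul, mul_add]
    | tmul a b => simp [antipode_mul_antidistrib, mul_assoc]

open HopfAlgebra in
theorem mul_antipode_mul' (X Y : H ⊗[k] H) :
    LinearMap.mul' k H (TensorProduct.map LinearMap.id (antipode k) (Y * X)) =
      LinearMap.mul' k H (TensorProduct.map
        (LinearMap.mulRight k (LinearMap.mul' k H
          (TensorProduct.map LinearMap.id (antipode k) X))) (antipode k) Y) := by
  induction Y with
  | zero => simp
  | add a b ha hb => simp only [map_add, ha, hb, add_mul]
  | tmul c d =>
    induction X with
    | zero => simp
    | add a b ha hb => simp_all [add_mul, mul_add]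
    | tmul a b => simp [antipode_mul_antidistrib, mul_assoc]

open HopfAlgebra in
theorem antipode_left_aux (h : H) :
    LinearMap.mul' k H (TensorProduct.map J.antipodeHom LinearMap.id (J.comulHom h)) =
      J.vInv * (algebraMap k H (Coalgebra.counit h)) * J.v := by
  have h0 : LinearMap.mul' k H (TensorProduct.map (antipode k) (LinearMap.mulLeft k J.v)
      (↑J.elt⁻¹ : H ⊗[k] H)) = 1 := by
    have := mul_antipode_mul (k := k) (↑J.elt : H ⊗[k] H) (↑J.elt⁻¹ : H ⊗[k] H)
    rw [Units.mul_inv] at this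
    rw [v, ← this]
    simp [Algebra.TensorProduct.one_def]
  have h1 : ∀ (F : H ⊗[k] H) (a b c d : H),
      LinearMap.mul' k H (TensorProduct.map J.antipodeHom LinearMap.id
        (F * (a ⊗ₜ[k] b) * (c ⊗ₜ[k] d))) =
      J.vInv * antipode k c * antipode k a * LinearMap.mul' k H (TensorProduct.map (antipode k)
        (LinearMap.mulLeft k J.v) F) * b * d := by
    intro F a b c d
    induction F with
    | zero => simp
    | add x y hx hy => simp only [map_add, add_mul, hx, hy, mul_add]
    | tmul x y => simp [antipodeHom_apply, antipode_mul_antidistrib, mul_assoc]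
  have h2 : ∀ (X : H ⊗[k] H) (c d : H),
      LinearMap.mul' k H (TensorProduct.map J.antipodeHom LinearMap.id
        (↑J.elt⁻¹ * X * (c ⊗ₜ[k] d))) =
      J.vInv * antipode k c * LinearMap.mul' k H (TensorProduct.map (antipode k)
        LinearMap.id X) * d := by
    intro X c d
    induction X with
    | zero => simp
    | add x y hx hy => simp only [map_add, add_mul, hx, hy, mul_add]
    | tmul x y => rw [h1, h0]; simp [mul_assoc]
  have h3 : ∀ (K : H ⊗[k] H),
      LinearMap.mul' k H (TensorProduct.map J.antipodeHom LinearMap.id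
        (↑J.elt⁻¹ * Coalgebra.comul (R := k) h * K)) =
      J.vInv * (algebraMap k H (Coalgebra.counit h)) *
        LinearMap.mul' k H (TensorProduct.map (antipode k) LinearMap.id K) := by
    intro K
    induction K with
    | zero => simp
    | add x y hx hy => simp only [map_add, hx, hy, mul_add]
    | tmul c d =>
      have e := mul_antipode_rTensor_comul_apply (R := k) h
      rw [LinearMap.rTensor] at e
      rw [h2, e]
      simp only [TensorProduct.map_tmul, LinearMap.mul'_apply, LinearMap.id_apply]
      rw [mul_assoc J.vInv, ← Algebra.commutes (Coalgebra.counit h) (antipode k c)]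
      simp only [mul_assoc]
  rw [comulHom_apply, h3]
  rfl

open HopfAlgebra in
theorem antipode_right_aux (h : H) :
    LinearMap.mul' k H (TensorProduct.map LinearMap.id J.antipodeHom (J.comulHom h)) =
      J.vInv * (algebraMap k H (Coalgebra.counit h)) * J.v := by
  have h0 : LinearMap.mul' k H (TensorProduct.map (LinearMap.mulRight k J.vInv) (antipode k)
      (↑J.elt : H ⊗[k] H)) = 1 := by
    have := mul_antipode_mul' (k := k) (↑J.elt⁻¹ : H ⊗[k] H) (↑J.elt : H ⊗[k] H)
    rw [Units.mul_inv] at this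
    rw [vInv, ← this]
    simp [Algebra.TensorProduct.one_def]
  have h1 : ∀ (K : H ⊗[k] H) (a b c d : H),
      LinearMap.mul' k H (TensorProduct.map LinearMap.id J.antipodeHom
        ((c ⊗ₜ[k] d) * (a ⊗ₜ[k] b) * K)) =
      c * a * LinearMap.mul' k H (TensorProduct.map (LinearMap.mulRight k J.vInv) (antipode k) K)
        * antipode k b * antipode k d * J.v := by
    intro K a b c d
    induction K with
    | zero => simp
    | add x y hx hy => simp only [map_add, add_mul, hx, hy, mul_add]
    | tmul x y => simp [antipodeHom_apply, antipode_mul_antidistrib, mul_assoc]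
  have h2 : ∀ (X : H ⊗[k] H) (c d : H),
      LinearMap.mul' k H (TensorProduct.map LinearMap.id J.antipodeHom
        ((c ⊗ₜ[k] d) * X * ↑J.elt)) =
      c * LinearMap.mul' k H (TensorProduct.map LinearMap.id (antipode k) X)
        * antipode k d * J.v := by
    intro X c d
    induction X with
    | zero => simp
    | add x y hx hy => simp only [map_add, add_mul, hx, hy, mul_add]
    | tmul x y => rw [h1, h0]; simp [mul_assoc]
  have h3 : ∀ (F : H ⊗[k] H),
      LinearMap.mul' k H (TensorProduct.map LinearMap.id J.antipodeHom
        (F * Coalgebra.comul (R := k) h * ↑J.elt)) =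
      LinearMap.mul' k H (TensorProduct.map LinearMap.id (antipode k) F) *
        (algebraMap k H (Coalgebra.counit h)) * J.v := by
    intro F
    induction F with
    | zero => simp
    | add x y hx hy => simp only [map_add, hx, hy, add_mul]
    | tmul c d =>
      have e := mul_antipode_lTensor_comul_apply (R := k) h
      rw [LinearMap.lTensor] at e
      rw [h2, e]
      simp only [TensorProduct.map_tmul, LinearMap.mul'_apply, LinearMap.id_apply]
      rw [mul_assoc c, Algebra.commutes (Coalgebra.counit h) (antipode k d)]
      simp only [mul_assoc]
  rw [comulHom_apply, h3]
  rfl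

variable (k H) in
/-- `a ⊗ b ⊗ c ↦ S(a) b S(c)`. -/
def psi : H ⊗[k] (H ⊗[k] H) →ₗ[k] H :=
  LinearMap.mul' k H ∘ₗ TensorProduct.map (HopfAlgebra.antipode k)
    (LinearMap.mul' k H ∘ₗ TensorProduct.map LinearMap.id (HopfAlgebra.antipode k))

variable (k H) in
/-- `a ⊗ b ⊗ c ↦ a S(b) c`. -/
def phi : H ⊗[k] (H ⊗[k] H) →ₗ[k] H :=
  LinearMap.mul' k H ∘ₗ TensorProduct.map LinearMap.id
    (LinearMap.mul' k H ∘ₗ TensorProduct.map (HopfAlgebra.antipode k) LinearMap.id)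

variable (k H) in
/-- `ε ⊗ id`, with values in `H`. -/
def epsL : H ⊗[k] H →ₐ[k] H :=
  (Algebra.TensorProduct.lid k H).toAlgHom.comp
    (Algebra.TensorProduct.map (Bialgebra.counitAlgHom k H) (AlgHom.id k H))

variable (k H) in
/-- `id ⊗ ε`, with values in `H`. -/
def epsR : H ⊗[k] H →ₐ[k] H :=
  (Algebra.TensorProduct.rid k k H).toAlgHom.comp
    (Algebra.TensorProduct.map (AlgHom.id k H) (Bialgebra.counitAlgHom k H))

theorem epsL_elt : epsL k H (↑J.elt : H ⊗[k] H) = 1 := J.isTwist.counit_left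
theorem epsR_elt : epsR k H (↑J.elt : H ⊗[k] H) = 1 := J.isTwist.counit_right

theorem epsL_inv : epsL k H (↑J.elt⁻¹ : H ⊗[k] H) = 1 := by
  have := congrArg (epsL k H) (Units.inv_mul J.elt)
  rwa [map_mul, epsL_elt, mul_one, map_one] at this

theorem epsR_inv : epsR k H (↑J.elt⁻¹ : H ⊗[k] H) = 1 := by
  have := congrArg (epsR k H) (Units.inv_mul J.elt)
  rwa [map_mul, epsR_elt, mul_one, map_one] at this

open HopfAlgebra in
theorem psi_i (X Y : H ⊗[k] H) : psi k H (i12 k H X * i23 k H Y) =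
    LinearMap.mul' k H (TensorProduct.map (antipode k) LinearMap.id X) *
    LinearMap.mul' k H (TensorProduct.map LinearMap.id (antipode k) Y) := by
  induction X with
  | zero => simp
  | add x y hx hy => simp only [map_add, add_mul, hx, hy]
  | tmul a b =>
    induction Y with
    | zero => simp
    | add x y hx hy => simp only [map_add, mul_add, hx, hy]
    | tmul c d => simp [psi, i12, i23, mul_assoc]

open HopfAlgebra in
theorem phi_i (X Y : H ⊗[k] H) : phi k H (i23 k H Y * i12 k H X) =
    LinearMap.mul' k H (TensorProduct.map LinearMap.id (antipode k) X) *
    LinearMap.mul' k H (TensorProduct.map (antipode k) LinearMap.id Y) := by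
  induction X with
  | zero => simp
  | add x y hx hy => simp only [map_add, add_mul, mul_add, hx, hy]
  | tmul a b =>
    induction Y with
    | zero => simp
    | add x y hx hy => simp only [map_add, mul_add, add_mul, hx, hy]
    | tmul c d =>
      simp [phi, i12, i23, mul_assoc, antipode_mul_antidistrib]

open HopfAlgebra in
theorem psi_d (X Y : H ⊗[k] H) : psi k H (dLeft k H X * dRight k H Y) =
    antipode k (epsR k H Y) * antipode k (epsL k H X) := by
  induction X with
  | zero => simp
  | add x y hx hy => simp only [map_add, add_mul, mul_add, hx, hy]
  | tmul a b =>
    induction Y with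
    | zero => simp
    | add x y hx hy => simp only [map_add, mul_add, add_mul, hx, hy]
    | tmul c d =>
      have key : ∀ U V : H ⊗[k] H,
          psi k H (Algebra.TensorProduct.assoc k k k H H H (U ⊗ₜ[k] b) * (c ⊗ₜ[k] V)) =
          antipode k c * LinearMap.mul' k H ((antipode k).rTensor H U) *
            LinearMap.mul' k H ((antipode k).lTensor H V) * antipode k b := by
        intro U V
        induction U with
        | zero => simp
        | add x y hx hy => simp only [map_add, add_mul, mul_add, hx, hy, add_tmul]
        | tmul u u' =>
          induction V with
          | zero => simp
          | add x y hx hy => simp only [map_add, add_mul, mul_add, hx, hy, tmul_add]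
          | tmul w w' => simp [psi, mul_assoc, antipode_mul_antidistrib]
      have := key (Coalgebra.comul a) (Coalgebra.comul d)
      rw [mul_antipode_rTensor_comul_apply, mul_antipode_lTensor_comul_apply] at this
      simp only [epsL, epsR, dLeft, dRight]
      simpa [Algebra.algebraMap_eq_smul_one, smul_smul, mul_comm] using this

open HopfAlgebra in
theorem phi_d (X Y : H ⊗[k] H) : phi k H (dRight k H X * dLeft k H Y) =
    epsR k H X * epsL k H Y := by
  induction X with
  | zero => simp
  | add x y hx hy => simp only [map_add, add_mul, hx, hy]
  | tmul a b =>
    induction Y with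
    | zero => simp
    | add x y hx hy => simp only [map_add, mul_add, hx, hy]
    | tmul c d =>
      have key : ∀ U V : H ⊗[k] H,
          phi k H ((a ⊗ₜ[k] U) * Algebra.TensorProduct.assoc k k k H H H (V ⊗ₜ[k] d)) =
          a * LinearMap.mul' k H ((antipode k).lTensor H V) *
            LinearMap.mul' k H ((antipode k).rTensor H U) * d := by
        intro U V
        induction U with
        | zero => simp
        | add x y hx hy => simp only [map_add, add_mul, mul_add, hx, hy, tmul_add]
        | tmul u u' =>
          induction V with
          | zero => simp
          | add x y hx hy => simp only [map_add, add_mul, mul_add, hx, hy, add_tmul]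
          | tmul w w' => simp [phi, mul_assoc, antipode_mul_antidistrib]
      have := key (Coalgebra.comul b) (Coalgebra.comul c)
      rw [mul_antipode_rTensor_comul_apply, mul_antipode_lTensor_comul_apply] at this
      simp only [epsL, epsR, dLeft, dRight]
      simpa [Algebra.algebraMap_eq_smul_one, smul_smul, mul_comm] using this

theorem v_mul_vInv : J.v * J.vInv = 1 := by
  have e : ∀ {M : Type v} [Group M] {a b c d : M}, a * b = c * d → b * d⁻¹ = a⁻¹ * c := by
    intro M _ a b c d h
    rw [mul_inv_eq_iff_eq_mul, mul_assoc, eq_inv_mul_iff_mul_eq, h]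
  have e := congrArg Units.val (e J.cocycle_units)
  simp only [Units.val_mul, ← map_inv, Units.coe_map, MonoidHom.coe_coe] at e
  have e' := congrArg (psi k H) e
  rw [psi_i, psi_d, epsR_elt, epsL_inv, HopfAlgebra.antipode_one, mul_one] at e'
  exact e'

theorem vInv_mul_v : J.vInv * J.v = 1 := by
  have e : ∀ {M : Type v} [Group M] {a b c d : M}, a * b = c * d → d * b⁻¹ = c⁻¹ * a := by
    intro M _ a b c d h
    rw [mul_inv_eq_iff_eq_mul, mul_assoc, eq_inv_mul_iff_mul_eq, h]
  have e := congrArg Units.val (e J.cocycle_units)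
  simp only [Units.val_mul, ← map_inv, Units.coe_map, MonoidHom.coe_coe] at e
  have e' := congrArg (phi k H) e
  rw [phi_i, phi_d, epsL_elt, epsR_inv, mul_one] at e'
  exact e'

/-- The twisted Hopf algebra `H^J`: the algebra `H` with comultiplication `J⁻¹ Δ J`, the same
counit and antipode `v⁻¹ S v`, as a type synonym of `H`. -/
def Twisted (_J : HopfTwist k H) : Type v := H

instance : Ring J.Twisted := inferInstanceAs (Ring H)

/-- The Hopf algebra structure of `H^J`, on the carrier `H`. -/
@[reducible] def hopfAlgebra : HopfAlgebra k H :=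
  { Bialgebra.ofAlgHom J.comulHom (Bialgebra.counitAlgHom k H)
      (AlgHom.ext J.coassoc_aux)
      (AlgHom.ext J.counit_left_aux)
      (AlgHom.ext J.counit_right_aux) with
    antipode := J.antipodeHom
    mul_antipode_rTensor_comul := LinearMap.ext fun h => by
      refine (J.antipode_left_aux h).trans ?_
      rw [← Algebra.commutes, mul_assoc, vInv_mul_v, mul_one]
      rfl
    mul_antipode_lTensor_comul := LinearMap.ext fun h => by
      refine (J.antipode_right_aux h).trans ?_
      rw [← Algebra.commutes, mul_assoc, vInv_mul_v, mul_one]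
      rfl }

instance : HopfAlgebra k J.Twisted := J.hopfAlgebra

end HopfTwist
end TwistDef

section HopfSub

/-- A Hopf subalgebra of `A`: a subalgebra `K` with `Δ(K) ⊆ K ⊗ K` (the image of `K ⊗ K` in
`A ⊗ A`) and `S(K) ⊆ K`. -/
structure HopfSubalgebra (k : Type u) (A : Type v) [Field k] [Ring A] [HopfAlgebra k A]
    extends Subalgebra k A where
  comul_mem : ∀ x ∈ toSubalgebra, Coalgebra.comul (R := k) x ∈
    LinearMap.range (TensorProduct.map toSubalgebra.val.toLinearMap toSubalgebra.val.toLinearMap)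
  antipode_mem : ∀ x ∈ toSubalgebra, HopfAlgebra.antipode k x ∈ toSubalgebra

variable {k : Type u} {A : Type v} [Field k] [Ring A] [HopfAlgebra k A]

namespace HopfSubalgebra

variable (K : HopfSubalgebra k A)

/-- The inclusion `K ⊗ K → A ⊗ A`. -/
def incl₂ : K.toSubalgebra ⊗[k] K.toSubalgebra →ₐ[k] A ⊗[k] A :=
  Algebra.TensorProduct.map K.toSubalgebra.val K.toSubalgebra.val

theorem incl₂_injective : Function.Injective K.incl₂ :=
  TensorProduct.map_injective_of_flat_flat K.toSubalgebra.val.toLinearMap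
    K.toSubalgebra.val.toLinearMap Subtype.val_injective Subtype.val_injective

/-- The inclusion `K ⊗ (K ⊗ K) → A ⊗ (A ⊗ A)`. -/
def incl₃ : K.toSubalgebra ⊗[k] (K.toSubalgebra ⊗[k] K.toSubalgebra) →ₐ[k] A ⊗[k] (A ⊗[k] A) :=
  Algebra.TensorProduct.map K.toSubalgebra.val K.incl₂

theorem incl₃_injective : Function.Injective K.incl₃ :=
  TensorProduct.map_injective_of_flat_flat K.toSubalgebra.val.toLinearMap
    K.incl₂.toLinearMap Subtype.val_injective K.incl₂_injective

/-- The comultiplication of `A` restricted to `K`. -/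
def comulHom : K.toSubalgebra →ₐ[k] K.toSubalgebra ⊗[k] K.toSubalgebra :=
  (AlgEquiv.ofInjective K.incl₂ K.incl₂_injective).symm.toAlgHom.comp
    (((Bialgebra.comulAlgHom k A).comp K.toSubalgebra.val).codRestrict K.incl₂.range
      (fun x => K.comul_mem x x.2))

/-- `comulHom` is the restriction of the comultiplication of `A`. -/
theorem incl₂_comulHom (x : K.toSubalgebra) :
    K.incl₂ (K.comulHom x) = Coalgebra.comul (R := k) (x : A) := by
  have := AlgEquiv.apply_symm_apply (AlgEquiv.ofInjective K.incl₂ K.incl₂_injective)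
    ((((Bialgebra.comulAlgHom k A).comp K.toSubalgebra.val).codRestrict K.incl₂.range
      (fun x => K.comul_mem x x.2)) x)
  exact congrArg Subtype.val this

/-- The counit of `A` restricted to `K`. -/
def counitHom : K.toSubalgebra →ₐ[k] k :=
  (Bialgebra.counitAlgHom k A).comp K.toSubalgebra.val

/-- The antipode of `A` restricted to `K`. -/
def antipodeHom : K.toSubalgebra →ₗ[k] K.toSubalgebra where
  toFun x := ⟨HopfAlgebra.antipode k (x : A), K.antipode_mem x x.2⟩
  map_add' x y := Subtype.ext (map_add (HopfAlgebra.antipode k) (x : A) (y : A))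
  map_smul' c x := Subtype.ext (map_smul (HopfAlgebra.antipode k) c (x : A))

theorem coassoc_aux (x : K.toSubalgebra) :
    Algebra.TensorProduct.assoc k k k K.toSubalgebra K.toSubalgebra K.toSubalgebra
      (Algebra.TensorProduct.map K.comulHom (AlgHom.id k K.toSubalgebra) (K.comulHom x)) =
    Algebra.TensorProduct.map (AlgHom.id k K.toSubalgebra) K.comulHom (K.comulHom x) := by
  have h1 : ∀ U : K.toSubalgebra ⊗[k] K.toSubalgebra, K.incl₃
      (Algebra.TensorProduct.assoc k k k K.toSubalgebra K.toSubalgebra K.toSubalgebra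
        (Algebra.TensorProduct.map K.comulHom (AlgHom.id k K.toSubalgebra) U)) =
      Algebra.TensorProduct.assoc k k k A A A (Algebra.TensorProduct.map
        (Bialgebra.comulAlgHom k A) (AlgHom.id k A) (K.incl₂ U)) := by
    intro U
    induction U with
    | zero => simp
    | add a b ha hb => simp only [map_add, ha, hb]
    | tmul a b =>
      have h2 : ∀ V : K.toSubalgebra ⊗[k] K.toSubalgebra, K.incl₃
          (Algebra.TensorProduct.assoc k k k K.toSubalgebra K.toSubalgebra K.toSubalgebra
            (V ⊗ₜ[k] b)) =
          Algebra.TensorProduct.assoc k k k A A A (K.incl₂ V ⊗ₜ[k] (b : A)) := by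
        intro V
        induction V with
        | zero => simp
        | add a b ha hb => simp only [map_add, add_tmul, ha, hb]
        | tmul c d => simp [incl₃, incl₂]
      have := h2 (K.comulHom a)
      rw [incl₂_comulHom] at this
      simpa [incl₂] using this
  have h3 : ∀ U : K.toSubalgebra ⊗[k] K.toSubalgebra, K.incl₃
      (Algebra.TensorProduct.map (AlgHom.id k K.toSubalgebra) K.comulHom U) =
      Algebra.TensorProduct.map (AlgHom.id k A) (Bialgebra.comulAlgHom k A) (K.incl₂ U) := by
    intro U
    induction U with
    | zero => simp
    | add a b ha hb => simp only [map_add, ha, hb]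
    | tmul a b => simp [incl₃, incl₂_comulHom]; simp [incl₂]
  apply K.incl₃_injective
  rw [h1, h3, incl₂_comulHom]
  exact Coalgebra.coassoc_apply (x : A)

theorem counit_left_aux (x : K.toSubalgebra) :
    Algebra.TensorProduct.map K.counitHom (AlgHom.id k K.toSubalgebra) (K.comulHom x) =
      (1 : k) ⊗ₜ[k] x := by
  have h1 : ∀ U : K.toSubalgebra ⊗[k] K.toSubalgebra,
      ((Algebra.TensorProduct.lid k K.toSubalgebra
        (Algebra.TensorProduct.map K.counitHom (AlgHom.id k K.toSubalgebra) U) :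
          K.toSubalgebra) : A) =
      Algebra.TensorProduct.lid k A (Algebra.TensorProduct.map
        (Bialgebra.counitAlgHom k A) (AlgHom.id k A) (K.incl₂ U)) := by
    intro U
    induction U with
    | zero => simp
    | add a b ha hb => simp only [map_add, Subalgebra.coe_add, ha, hb]
    | tmul a b => simp [incl₂, counitHom]
  apply (Algebra.TensorProduct.lid k K.toSubalgebra).injective
  apply Subtype.ext
  rw [h1, incl₂_comulHom]
  have := Coalgebra.rTensor_counit_comul (R := k) (x : A)
  exact (congrArg (Algebra.TensorProduct.lid k A) this).trans (by simp)

theorem counit_right_aux (x : K.toSubalgebra) :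
    Algebra.TensorProduct.map (AlgHom.id k K.toSubalgebra) K.counitHom (K.comulHom x) =
      x ⊗ₜ[k] (1 : k) := by
  have h1 : ∀ U : K.toSubalgebra ⊗[k] K.toSubalgebra,
      ((Algebra.TensorProduct.rid k k K.toSubalgebra
        (Algebra.TensorProduct.map (AlgHom.id k K.toSubalgebra) K.counitHom U) :
          K.toSubalgebra) : A) =
      Algebra.TensorProduct.rid k k A (Algebra.TensorProduct.map
        (AlgHom.id k A) (Bialgebra.counitAlgHom k A) (K.incl₂ U)) := by
    intro U
    induction U with
    | zero => simp
    | add a b ha hb => simp only [map_add, Subalgebra.coe_add, ha, hb]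
    | tmul a b => simp [incl₂, counitHom]
  apply (Algebra.TensorProduct.rid k k K.toSubalgebra).injective
  apply Subtype.ext
  rw [h1, incl₂_comulHom]
  have := Coalgebra.lTensor_counit_comul (R := k) (x : A)
  exact (congrArg (Algebra.TensorProduct.rid k k A) this).trans (by simp)

theorem antipode_left_aux (x : K.toSubalgebra) :
    LinearMap.mul' k K.toSubalgebra (TensorProduct.map K.antipodeHom LinearMap.id
      (K.comulHom x)) = algebraMap k K.toSubalgebra (K.counitHom x) := by
  have h1 : ∀ U : K.toSubalgebra ⊗[k] K.toSubalgebra,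
      ((LinearMap.mul' k K.toSubalgebra (TensorProduct.map K.antipodeHom LinearMap.id U) :
        K.toSubalgebra) : A) =
      LinearMap.mul' k A ((HopfAlgebra.antipode k).rTensor A (K.incl₂ U)) := by
    intro U
    induction U with
    | zero => simp
    | add a b ha hb => simp only [map_add, Subalgebra.coe_add, ha, hb]
    | tmul a b => simp [incl₂, antipodeHom]
  apply Subtype.ext
  rw [h1, incl₂_comulHom, HopfAlgebra.mul_antipode_rTensor_comul_apply]
  rfl

theorem antipode_right_aux (x : K.toSubalgebra) :
    LinearMap.mul' k K.toSubalgebra (TensorProduct.map LinearMap.id K.antipodeHom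
      (K.comulHom x)) = algebraMap k K.toSubalgebra (K.counitHom x) := by
  have h1 : ∀ U : K.toSubalgebra ⊗[k] K.toSubalgebra,
      ((LinearMap.mul' k K.toSubalgebra (TensorProduct.map LinearMap.id K.antipodeHom U) :
        K.toSubalgebra) : A) =
      LinearMap.mul' k A ((HopfAlgebra.antipode k).lTensor A (K.incl₂ U)) := by
    intro U
    induction U with
    | zero => simp
    | add a b ha hb => simp only [map_add, Subalgebra.coe_add, ha, hb]
    | tmul a b => simp [incl₂, antipodeHom]
  apply Subtype.ext
  rw [h1, incl₂_comulHom, HopfAlgebra.mul_antipode_lTensor_comul_apply]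
  rfl

/-- A Hopf subalgebra is a Hopf algebra, with the operations of `A` restricted to it. -/
instance instHopfAlgebra : HopfAlgebra k K.toSubalgebra :=
  { Bialgebra.ofAlgHom K.comulHom K.counitHom
      (AlgHom.ext K.coassoc_aux)
      (AlgHom.ext K.counit_left_aux)
      (AlgHom.ext K.counit_right_aux) with
    antipode := K.antipodeHom
    mul_antipode_rTensor_comul := LinearMap.ext K.antipode_left_aux
    mul_antipode_lTensor_comul := LinearMap.ext K.antipode_right_aux }

/-- `K` is normal in `A`: stable under the left adjoint action `x ↦ ∑ h₁ x S(h₂)` of `A`. -/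
def IsNormal : Prop :=
  ∀ h : A, ∀ x ∈ K.toSubalgebra,
    LinearMap.mul' k A (TensorProduct.map (LinearMap.mulRight k x) (HopfAlgebra.antipode k)
      (Coalgebra.comul (R := k) h)) ∈ K.toSubalgebra

/-- The left ideal `A K⁺` of `A`, where `K⁺ = K ∩ ker ε`. -/
def augIdeal : Ideal A :=
  Ideal.span {x : A | x ∈ K.toSubalgebra ∧ Coalgebra.counit (R := k) x = 0}

/-- `π : A → B` presents the Hopf algebra `B` as the quotient `A / A K⁺`: it is a surjective map of
Hopf algebras (a bialgebra map automatically commutes with antipodes) with kernel `A K⁺`. -/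
structure IsQuotientBy {B : Type w} [Ring B] [HopfAlgebra k B] (π : A →ₐc[k] B) : Prop where
  surjective : Function.Surjective π
  ker_eq : RingHom.ker π = K.augIdeal

end HopfSubalgebra

end HopfSub

section Series

/-- A property of Hopf algebras over `k`. -/
abbrev HopfProperty (k : Type u) [Field k] : Type (max u (v + 1)) :=
  ∀ (B : Type v) [Ring B] [HopfAlgebra k B], Prop

/-- The Hopf algebra `A` is the trivial one, `A = k`. -/
def IsTrivialHopf (k : Type u) (A : Type v) [Field k] [Ring A] [HopfAlgebra k A] : Prop :=
  Function.Bijective (algebraMap k A)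

/-- `HasUpperNormalSeries P A`: the Hopf algebra `A` has an upper normal series all of whose
factors satisfy `P`. Such a series is a sequence of Hopf algebras
`H₍₀₎ = A, H₍₁₎, …, H₍ₙ₎ = k` and normal Hopf subalgebras `Hᵢ ⊆ H₍ᵢ₋₁₎` with
`H₍ᵢ₎ = H₍ᵢ₋₁₎ / H₍ᵢ₋₁₎ Hᵢ⁺`, where `Hₙ = H₍ₙ₋₁₎`; its factors are the `Hᵢ`. The trivial Hopf
algebra has the series of length zero. -/
inductive HasUpperNormalSeries {k : Type u} [Field k] (P : HopfProperty.{u, v} k) :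
    ∀ (A : Type v) [Ring A] [HopfAlgebra k A], Prop
  | nil (A : Type v) [Ring A] [HopfAlgebra k A] (hA : IsTrivialHopf k A) :
      HasUpperNormalSeries P A
  | step (A : Type v) [Ring A] [HopfAlgebra k A] (K : HopfSubalgebra k A) (hK : K.IsNormal)
      (hP : P K.toSubalgebra) (B : Type v) [Ring B] [HopfAlgebra k B] (π : A →ₐc[k] B)
      (hπ : K.IsQuotientBy π) (hlast : IsTrivialHopf k B → K.toSubalgebra = ⊤)
      (hB : HasUpperNormalSeries P B) : HasUpperNormalSeries P A

/-- `HasLowerNormalSeries P A`: the Hopf algebra `A` has a lower normal series all of whose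
factors satisfy `P`. Such a series is a strictly decreasing chain of Hopf subalgebras
`A = H₀ ⊃ H₁ ⊃ ⋯ ⊃ Hₙ = k` with `Hᵢ₊₁` normal in `Hᵢ`; its factors are the quotients
`Hᵢ / Hᵢ Hᵢ₊₁⁺`. -/
inductive HasLowerNormalSeries {k : Type u} [Field k] (P : HopfProperty.{u, v} k) :
    ∀ (A : Type v) [Ring A] [HopfAlgebra k A], Prop
  | nil (A : Type v) [Ring A] [HopfAlgebra k A] (hA : IsTrivialHopf k A) :
      HasLowerNormalSeries P A
  | step (A : Type v) [Ring A] [HopfAlgebra k A] (K : HopfSubalgebra k A) (hK : K.IsNormal)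
      (hne : K.toSubalgebra ≠ ⊤) (B : Type v) [Ring B] [HopfAlgebra k B] (π : A →ₐc[k] B)
      (hπ : K.IsQuotientBy π) (hP : P B)
      (hB : HasLowerNormalSeries P K.toSubalgebra) : HasLowerNormalSeries P A

/-- `B` is isomorphic, as a Hopf algebra, to the group algebra `k ℤ_p` of the cyclic group of order
`p`, for some prime `p` dividing `d`. -/
def IsPrimeCyclicGroupAlgebra (k : Type u) [Field k] (d : ℕ) : HopfProperty.{u, v} k :=
  fun B _ _ => ∃ p : ℕ, p.Prime ∧ p ∣ d ∧
    Nonempty (B ≃ₐc[k] MonoidAlgebra k (Multiplicative (ZMod p)))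

/-- `B` is cocommutative. -/
def IsCocommHopf (k : Type u) [Field k] : HopfProperty.{u, v} k :=
  fun B _ _ => Coalgebra.IsCocomm k B

/-- `B` is commutative or cocommutative. -/
def IsCommOrCocommHopf (k : Type u) [Field k] : HopfProperty.{u, v} k :=
  fun B _ _ => (∀ x y : B, x * y = y * x) ∨ Coalgebra.IsCocomm k B

/-- `A` is semisolvable: it has an upper or a lower normal series all of whose factors are
commutative or cocommutative. -/
def IsSemisolvableHopf (k : Type u) [Field k] (A : Type v) [Ring A] [HopfAlgebra k A] : Prop :=
  HasLowerNormalSeries (IsCommOrCocommHopf.{u, v} k) A ∨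
    HasUpperNormalSeries (IsCommOrCocommHopf.{u, v} k) A

end Series

end

/-! The upper series rests on central group elements. If z ∈ G is central, then z ⊗ z commutes with
J, so z stays group-like in A. For Z central of prime order, k[Z] is therefore a central, hence
normal, Hopf subalgebra of A. The quotient by it is the twist of k[G/Z] by the image of J, and
induction on |G| finishes the argument.

The lower series comes from the triangular structure. As kG is cocommutative, t = J₂₁⁻¹J conjugates
Δ^J into its opposite, and permuted copies of the cocycle identity make t a bicharacter
(`HopfTwist.isBichar`). The left legs of s = t⁻¹ form a Hopf subalgebra T, and s, t ∈ T ⊗ A. A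
descending step K ⊇ L is encoded by `CocommStep`: L is a sub-bialgebra stable under x ↦ S(h₁)xh₂ for
h ∈ K, and it contains every S(a₁)g(a₂)a₃ with a ∈ K. Since a₁S(a₂)g(a₃)a₄ = g(a₁)a₂, the two kinds
of slices g(a₁)a₂ and a₁g(a₂) agree modulo L⁺, so the factor is cocommutative.

From T down to k: push the right leg of s along π : A → A', where A' is the twist of k[G/Z]. The
left legs shrink. The adjoint action and the coadjoint coefficients are legs of s against
functionals a ↦ f(φ(a₁)S(a₂)) with φ(az) = φ(a)z. There z cancels against S(z), so the functional
descends to A' (`IsBichar.cocommStep`). Once the group is exhausted only scalars remain.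

From A down to T: by induction there is a chain from A' to π(T). It is pulled back by L ↦ {a : π(a₁)
⊗ a₂ ∈ L ⊗ A}. This preimage is visibly stable only under slicing on one side. The braiding has its
left legs in T, which π sends into L, and it exchanges Δ with Δᵒᵖ, so stability on the other side
follows. The preimage of π(T) lies in T·k[Z], on which Z has no adjoint effect, and this gives the
last step to T (`BraidedBy.chainOver`). -/

noncomputable section

universe u v w

/-! ### Convolution of linear maps, and slices of tensors by functionals -/

section Convolution

variable {k : Type u} [Field k]
variable {A : Type*} [AddCommGroup A] [Module k A] [Coalgebra k A]
variable {C : Type*} [Ring C] [Algebra k C]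

/-- The convolution product `a ↦ φ(a₁) ψ(a₂)`. -/
def conv (φ ψ : A →ₗ[k] C) : A →ₗ[k] C :=
  LinearMap.mul' k C ∘ₗ TensorProduct.map φ ψ ∘ₗ Coalgebra.comul

variable (k A C) in
/-- The unit of the convolution product. -/
def convUnit : A →ₗ[k] C := Algebra.linearMap k C ∘ₗ Coalgebra.counit

theorem conv_apply (φ ψ : A →ₗ[k] C) (a : A) :
    conv φ ψ a = LinearMap.mul' k C (TensorProduct.map φ ψ (Coalgebra.comul a)) := rfl

/-- Identifies `conv` with the product of the ring `WithConv`, from which associativity and the unit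
laws are inherited. -/
theorem conv_eq (φ ψ : A →ₗ[k] C) :
    conv φ ψ = (WithConv.toConv φ * WithConv.toConv ψ).ofConv := rfl

theorem conv_assoc (φ ψ χ : A →ₗ[k] C) : conv (conv φ ψ) χ = conv φ (conv ψ χ) := by
  simp only [conv_eq, WithConv.toConv_ofConv, mul_assoc]

theorem convUnit_eq : convUnit k A C = (1 : WithConv (A →ₗ[k] C)).ofConv := rfl

@[simp] theorem conv_convUnit (φ : A →ₗ[k] C) : conv φ (convUnit k A C) = φ := by
  simp only [conv_eq, convUnit_eq, WithConv.toConv_ofConv, mul_one, WithConv.ofConv_toConv]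

@[simp] theorem convUnit_conv (φ : A →ₗ[k] C) : conv (convUnit k A C) φ = φ := by
  simp only [conv_eq, convUnit_eq, WithConv.toConv_ofConv, one_mul, WithConv.ofConv_toConv]

theorem comp_conv {D : Type*} [Ring D] [Algebra k D] (g : C →ₐ[k] D) (φ ψ : A →ₗ[k] C) :
    g.toLinearMap ∘ₗ conv φ ψ = conv (g.toLinearMap ∘ₗ φ) (g.toLinearMap ∘ₗ ψ) := by
  ext a
  simp only [conv, LinearMap.comp_apply, TensorProduct.map_comp]
  generalize (Coalgebra.comul a : A ⊗[k] A) = X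
  induction X with
  | zero => simp
  | add x y hx hy => simp only [map_add, hx, hy]
  | tmul x y => simp

theorem conv_comp {D : Type*} [AddCommGroup D] [Module k D] [Coalgebra k D] (g : D →ₗc[k] A)
    (φ ψ : A →ₗ[k] C) :
    conv φ ψ ∘ₗ g.toLinearMap = conv (φ ∘ₗ g.toLinearMap) (ψ ∘ₗ g.toLinearMap) := by
  ext a
  simp only [conv, LinearMap.comp_apply, TensorProduct.map_comp]
  congr 2
  exact (LinearMap.congr_fun g.map_comp_comul a).symm

theorem mulLeft_comp_conv (c : C) (φ ψ : A →ₗ[k] C) :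
    LinearMap.mulLeft k c ∘ₗ conv φ ψ = conv (LinearMap.mulLeft k c ∘ₗ φ) ψ := by
  ext a
  simp only [conv, LinearMap.comp_apply]
  generalize (Coalgebra.comul a : A ⊗[k] A) = X
  induction X with
  | zero => simp
  | add x y hx hy => simp only [map_add, hx, hy]
  | tmul x y => simp [mul_assoc]

theorem mulRight_comp_conv (c : C) (φ ψ : A →ₗ[k] C) :
    LinearMap.mulRight k c ∘ₗ conv φ ψ = conv φ (LinearMap.mulRight k c ∘ₗ ψ) := by
  ext a
  simp only [conv, LinearMap.comp_apply]
  generalize (Coalgebra.comul a : A ⊗[k] A) = X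
  induction X with
  | zero => simp
  | add x y hx hy => simp only [map_add, hx, hy]
  | tmul x y => simp [mul_assoc]

/-- `a ↦ g(a₁) a₂`. -/
def lhit (g : A →ₗ[k] k) : A →ₗ[k] A :=
  (TensorProduct.lid k A).toLinearMap ∘ₗ g.rTensor A ∘ₗ Coalgebra.comul

/-- `a ↦ a₁ g(a₂)`. -/
def rhit (g : A →ₗ[k] k) : A →ₗ[k] A :=
  (TensorProduct.rid k A).toLinearMap ∘ₗ g.lTensor A ∘ₗ Coalgebra.comul

theorem conv_linearMap_left (g : A →ₗ[k] k) (φ : A →ₗ[k] C) :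
    conv (Algebra.linearMap k C ∘ₗ g) φ = φ ∘ₗ lhit g := by
  ext a
  simp only [conv, lhit, LinearMap.comp_apply]
  generalize (Coalgebra.comul a : A ⊗[k] A) = X
  induction X with
  | zero => simp
  | add x y hx hy => simp only [map_add, hx, hy]
  | tmul x y => simp [Algebra.smul_def]

theorem conv_linearMap_right (g : A →ₗ[k] k) (φ : A →ₗ[k] C) :
    conv φ (Algebra.linearMap k C ∘ₗ g) = φ ∘ₗ rhit g := by
  ext a
  simp only [conv, rhit, LinearMap.comp_apply]
  generalize (Coalgebra.comul a : A ⊗[k] A) = X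
  induction X with
  | zero => simp
  | add x y hx hy => simp only [map_add, hx, hy]
  | tmul x y => simp [Algebra.smul_def, Algebra.commutes]

theorem counit_lhit (g : A →ₗ[k] k) (a : A) : Coalgebra.counit (R := k) (lhit g a) = g a := by
  have h1 := LinearMap.congr_fun
    (conv_linearMap_left g (Coalgebra.counit (R := k) (A := A))) a
  have h2 := conv_convUnit (k := k) (A := A) (C := k) g
  have h3 : convUnit k A k = Coalgebra.counit := by ext; simp [convUnit]
  have h4 : (Algebra.linearMap k k) ∘ₗ g = g := by ext; simp
  rw [h4, ← h3, h2, h3] at h1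
  exact h1.symm

theorem TensorProduct.eq_of_forall_rTensor {M N : Type*} [AddCommGroup M] [Module k M]
    [AddCommGroup N] [Module k N] {x y : M ⊗[k] N}
    (h : ∀ f : M →ₗ[k] k, TensorProduct.lid k N (f.rTensor N x) =
      TensorProduct.lid k N (f.rTensor N y)) : x = y := by
  let b := Module.Free.chooseBasis k M
  apply (TensorProduct.equivFinsuppOfBasisLeft (N := N) b).injective
  ext i
  have key : ∀ z : M ⊗[k] N, TensorProduct.equivFinsuppOfBasisLeft b z i =
      TensorProduct.lid k N ((b.coord i).rTensor N z) := by
    intro z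
    induction z with
    | zero => simp
    | add x y hx hy => simp only [map_add, Finsupp.add_apply, hx, hy]
    | tmul x y => simp
  rw [key, key, h]

theorem TensorProduct.eq_of_forall_lTensor {M N : Type*} [AddCommGroup M] [Module k M]
    [AddCommGroup N] [Module k N] {x y : M ⊗[k] N}
    (h : ∀ f : N →ₗ[k] k, TensorProduct.rid k M (f.lTensor M x) =
      TensorProduct.rid k M (f.lTensor M y)) : x = y := by
  apply (TensorProduct.comm k M N).injective
  apply TensorProduct.eq_of_forall_rTensor
  intro f
  have key : ∀ z : M ⊗[k] N, TensorProduct.lid k M (f.rTensor M (TensorProduct.comm k M N z)) =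
      TensorProduct.rid k M (f.lTensor M z) := by
    intro z
    induction z with
    | zero => simp
    | add x y hx hy => simp only [map_add, hx, hy]
    | tmul x y => simp
  rw [key, key, h]

/-- Take linear retractions p of M onto P and q of N onto Q. A tensor is determined by its slices,
so x is fixed by p ⊗ id and by id ⊗ q, and (p ⊗ q)(x) is the required preimage. -/
theorem TensorProduct.mem_range_map_of_forall {M N : Type*} [AddCommGroup M] [Module k M]
    [AddCommGroup N] [Module k N] {P : Submodule k M} {Q : Submodule k N} {x : M ⊗[k] N}
    (hP : ∀ f : N →ₗ[k] k, TensorProduct.rid k M (f.lTensor M x) ∈ P)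
    (hQ : ∀ f : M →ₗ[k] k, TensorProduct.lid k N (f.rTensor N x) ∈ Q) :
    x ∈ LinearMap.range (TensorProduct.map P.subtype Q.subtype) := by
  obtain ⟨p, hp⟩ := P.subtype.exists_leftInverse_of_injective (LinearMap.ker_eq_bot.2 P.injective_subtype)
  obtain ⟨q, hq⟩ := Q.subtype.exists_leftInverse_of_injective (LinearMap.ker_eq_bot.2 Q.injective_subtype)
  have hp' : ∀ m ∈ P, P.subtype (p m) = m := fun m hm =>
    congrArg Subtype.val (LinearMap.congr_fun hp ⟨m, hm⟩)
  have hq' : ∀ m ∈ Q, Q.subtype (q m) = m := fun m hm =>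
    congrArg Subtype.val (LinearMap.congr_fun hq ⟨m, hm⟩)
  have h1 : (P.subtype ∘ₗ p).rTensor N x = x := by
    apply TensorProduct.eq_of_forall_lTensor
    intro f
    rw [← hp' _ (hP f)]
    generalize x = z
    induction z with
    | zero => simp
    | add x y hx hy => simp only [map_add, hx, hy]
    | tmul x y => simp
  have h2 : (Q.subtype ∘ₗ q).lTensor M x = x := by
    apply TensorProduct.eq_of_forall_rTensor
    intro f
    rw [← hq' _ (hQ f)]
    generalize x = z
    induction z with
    | zero => simp
    | add x y hx hy => simp only [map_add, hx, hy]
    | tmul x y => simp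
  refine ⟨TensorProduct.map p q x, ?_⟩
  conv_rhs => rw [← h2, ← h1]
  generalize x = z
  induction z with
  | zero => simp
  | add x y hx hy => simp only [map_add, hx, hy]
  | tmul x y => simp

end Convolution

/-! ### Sub-bialgebras and convolution identities for the antipode -/

section Subcoalgebra

variable {k : Type u} [Field k]
variable {A : Type*} [Ring A] [HopfAlgebra k A]
variable {C : Type*} [Ring C] [Algebra k C]

/-- A subalgebra `K` with `Δ(K) ⊆ K ⊗ K`. -/
def Subalgebra.IsSubcoalgebra (K : Subalgebra k A) : Prop :=
  ∀ x ∈ K, Coalgebra.comul (R := k) x ∈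
    LinearMap.range (TensorProduct.map K.val.toLinearMap K.val.toLinearMap)

/-- The condition Δ(K) ⊆ K ⊗ K is tested one functional at a time; all sub-bialgebras constructed
below are recognised in this way. -/
theorem Subalgebra.IsSubcoalgebra.of_hit {K : Subalgebra k A}
    (hl : ∀ g : A →ₗ[k] k, ∀ x ∈ K, lhit g x ∈ K) (hr : ∀ g : A →ₗ[k] k, ∀ x ∈ K, rhit g x ∈ K) :
    K.IsSubcoalgebra := fun x hx =>
  TensorProduct.mem_range_map_of_forall (P := Subalgebra.toSubmodule K)
    (Q := Subalgebra.toSubmodule K) (fun f => hr f x hx) (fun f => hl f x hx)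

theorem Subalgebra.IsSubcoalgebra.conv_mem {K : Subalgebra k A} (hK : K.IsSubcoalgebra)
    {P : Subalgebra k C} {φ ψ : A →ₗ[k] C} (hφ : ∀ x ∈ K, φ x ∈ P) (hψ : ∀ x ∈ K, ψ x ∈ P)
    {x : A} (hx : x ∈ K) : conv φ ψ x ∈ P := by
  obtain ⟨z, hz⟩ := hK x hx
  rw [conv_apply, ← hz]
  generalize z = z
  induction z with
  | zero => simp
  | add x y hx hy => simpa only [map_add] using P.add_mem hx hy
  | tmul x y => simpa using P.mul_mem (hφ _ x.2) (hψ _ y.2)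

theorem Subalgebra.IsSubcoalgebra.lhit_mem {K : Subalgebra k A} (hK : K.IsSubcoalgebra)
    (g : A →ₗ[k] k) {x : A} (hx : x ∈ K) : lhit g x ∈ K := by
  have := hK.conv_mem (P := K) (φ := Algebra.linearMap k A ∘ₗ g) (ψ := LinearMap.id)
    (fun x _ => K.algebraMap_mem _) (fun x hx => hx) hx
  rwa [conv_linearMap_left] at this

theorem Subalgebra.IsSubcoalgebra.rhit_mem {K : Subalgebra k A} (hK : K.IsSubcoalgebra)
    (g : A →ₗ[k] k) {x : A} (hx : x ∈ K) : rhit g x ∈ K := by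
  have := hK.conv_mem (P := K) (ψ := Algebra.linearMap k A ∘ₗ g) (φ := LinearMap.id)
    (fun x hx => hx) (fun x _ => K.algebraMap_mem _) hx
  rwa [conv_linearMap_right] at this

variable (k A) in
/-- `a ↦ a ⊗ 1`, as a linear map. -/
abbrev inl (B : Type*) [Ring B] [Algebra k B] : A →ₗ[k] A ⊗[k] B :=
  (Algebra.TensorProduct.includeLeft : A →ₐ[k] A ⊗[k] B).toLinearMap

variable (k A) in
/-- `a ↦ 1 ⊗ a`, as a linear map. -/
abbrev inr (B : Type*) [Ring B] [Algebra k B] : A →ₗ[k] B ⊗[k] A :=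
  (Algebra.TensorProduct.includeRight : A →ₐ[k] B ⊗[k] A).toLinearMap

local notation "S" => HopfAlgebra.antipode k (A := A)

@[simp] theorem conv_antipode_id : conv (C := A) S LinearMap.id = convUnit k A A :=
  congrArg WithConv.ofConv LinearMap.antipode_mul_id

@[simp] theorem conv_id_antipode : conv (C := A) LinearMap.id S = convUnit k A A :=
  congrArg WithConv.ofConv LinearMap.id_mul_antipode

theorem comp_convUnit {D : Type*} [Ring D] [Algebra k D] (g : C →ₐ[k] D) :
    g.toLinearMap ∘ₗ convUnit k A C = convUnit k A D := by
  ext a; simp [convUnit]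

theorem conv_algHom_comp_antipode (g : A →ₐ[k] C) :
    conv g.toLinearMap (g.toLinearMap ∘ₗ S) = convUnit k A C := by
  have := comp_conv g LinearMap.id S
  rw [conv_id_antipode, comp_convUnit] at this
  exact this.symm

theorem conv_comp_antipode_algHom (g : A →ₐ[k] C) :
    conv (g.toLinearMap ∘ₗ S) g.toLinearMap = convUnit k A C := by
  have := comp_conv g S LinearMap.id
  rw [conv_antipode_id, comp_convUnit] at this
  exact this.symm

theorem comul_eq_conv : (Coalgebra.comul : A →ₗ[k] A ⊗[k] A) = conv (inl k A A) (inr k A A) := by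
  ext a
  simp only [conv, LinearMap.comp_apply]
  generalize (Coalgebra.comul a : A ⊗[k] A) = X
  induction X with
  | zero => simp
  | add x y hx hy => simp only [map_add]; rw [← hx, ← hy]
  | tmul x y => simp

/-- Both sides are convolution inverses of Δ. For the left side, apply the algebra map Δ to id * S.
For the right side, write Δ as the convolution of the two inclusions and cancel from the inside out.
-/
theorem comul_comp_antipode : (Coalgebra.comul : A →ₗ[k] A ⊗[k] A) ∘ₗ S =
    conv (inr k A A ∘ₗ S) (inl k A A ∘ₗ S) := by
  have h1 : conv (conv (inr k A A ∘ₗ S) (inl k A A ∘ₗ S)) Coalgebra.comul =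
      convUnit k A (A ⊗[k] A) := by
    rw [comul_eq_conv, conv_assoc, ← conv_assoc (inl k A A ∘ₗ S), conv_comp_antipode_algHom,
      convUnit_conv, conv_comp_antipode_algHom]
  have h2 := conv_algHom_comp_antipode (Bialgebra.comulAlgHom k A)
  have h3 := conv_assoc (conv (inr k A A ∘ₗ S) (inl k A A ∘ₗ S)) Coalgebra.comul
    ((Coalgebra.comul : A →ₗ[k] A ⊗[k] A) ∘ₗ S)
  rw [h1, convUnit_conv] at h3
  refine h3.trans ?_
  refine (congrArg _ h2).trans (conv_convUnit _)

end Subcoalgebra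

/-! ### Stability under the antipode; adjoint action and coadjoint coefficients -/

section AntipodeStable

variable {k : Type u} [Field k]
variable {A : Type*} [Ring A] [HopfAlgebra k A]

local notation "S" => HopfAlgebra.antipode k (A := A)

theorem lTensor_comp_comul (φ : A →ₗ[k] A) :
    φ.lTensor A ∘ₗ Coalgebra.comul = conv (inl k A A) (inr k A A ∘ₗ φ) := by
  ext a
  simp only [conv, LinearMap.comp_apply]
  generalize (Coalgebra.comul a : A ⊗[k] A) = X
  induction X with
  | zero => simp
  | add x y hx hy => simp only [map_add, hx, hy]
  | tmul x y => simp

/-- A finite dimensional sub-bialgebra of a Hopf algebra is stable under the antipode. -/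
theorem Subalgebra.IsSubcoalgebra.antipode_mem [FiniteDimensional k A] {K : Subalgebra k A}
    (hK : K.IsSubcoalgebra) {x : A} (hx : x ∈ K) : HopfAlgebra.antipode k x ∈ K := by
  let P : Subalgebra k (A ⊗[k] A) := (Algebra.TensorProduct.map K.val K.val).range
  let D : A →ₗ[k] A ⊗[k] A := LinearMap.lTensor A S ∘ₗ Coalgebra.comul
  -- E(a ⊗ b) = Δ(a)(1 ⊗ b) is the Galois map of A; E'(a ⊗ b) = a₁ ⊗ S(a₂)b inverts it.
  let E : A ⊗[k] A →ₗ[k] A ⊗[k] A :=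
    LinearMap.mul' k (A ⊗[k] A) ∘ₗ TensorProduct.map Coalgebra.comul (inr k A A)
  let E' : A ⊗[k] A →ₗ[k] A ⊗[k] A :=
    LinearMap.mul' k (A ⊗[k] A) ∘ₗ TensorProduct.map D (inr k A A)
  have hE' : ∀ (X : A ⊗[k] A) (y : A), E' (X * (1 ⊗ₜ y)) = E' X * (1 ⊗ₜ y) := by
    intro X y
    induction X with
    | zero => simp
    | add a b ha hb => simp only [add_mul, map_add, ha, hb]
    | tmul a b => simp [E', mul_assoc]
  have hEE : ∀ X, E' (E X) = X := by
    intro X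
    induction X with
    | zero => simp
    | add a b ha hb => simp only [map_add, ha, hb]
    | tmul a b =>
      have h1 : E' (Coalgebra.comul (R := k) a) = conv D (inr k A A) a := rfl
      have h2 : E (a ⊗ₜ b) = Coalgebra.comul (R := k) a * (1 ⊗ₜ b) := by simp [E]
      rw [h2, hE', h1]
      simp only [D]
      rw [lTensor_comp_comul, conv_assoc, conv_comp_antipode_algHom, conv_convUnit]
      simp
  have hEP : ∀ X ∈ Subalgebra.toSubmodule P, E X ∈ Subalgebra.toSubmodule P := by
    rintro _ ⟨z, rfl⟩
    induction z with
    | zero => simp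
    | add a b ha hb => simpa only [map_add] using Submodule.add_mem _ ha hb
    | tmul a b =>
      have : E ((a : A) ⊗ₜ (b : A)) = Coalgebra.comul (R := k) (a : A) * (1 ⊗ₜ (b : A)) := by
        simp [E]
      change E ((a : A) ⊗ₜ (b : A)) ∈ P
      rw [this]
      exact P.mul_mem (hK _ a.2) ⟨1 ⊗ₜ b, by simp⟩
  -- E maps the image of K ⊗ K injectively to itself, hence onto itself by finite dimension. So the
  -- preimage x₁ ⊗ S(x₂) of x ⊗ 1 lies there too, and applying ε to its left leg yields S(x) ∈ K.
  have hinj : Function.Injective (E.restrict hEP) := by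
    intro a b hab
    have : E' (E (a : A ⊗[k] A)) = E' (E (b : A ⊗[k] A)) :=
      congrArg E' (congrArg Subtype.val hab)
    rw [hEE, hEE] at this
    exact Subtype.ext this
  obtain ⟨p, hp⟩ := (LinearMap.injective_iff_surjective.1 hinj)
    ⟨x ⊗ₜ 1, ⟨⟨x, hx⟩ ⊗ₜ 1, by simp⟩⟩
  have hp1 : E (p : A ⊗[k] A) = x ⊗ₜ 1 := congrArg Subtype.val hp
  have hp2 : (p : A ⊗[k] A) = D x := by
    rw [← hEE p, hp1]
    simp [E', ← Algebra.TensorProduct.one_def]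
  obtain ⟨z, hz⟩ := p.2
  have hz' : TensorProduct.lid k A ((Coalgebra.counit (R := k)).rTensor A (p : A ⊗[k] A)) ∈ K := by
    rw [← hz]
    generalize z = z
    induction z with
    | zero => simp
    | add a b ha hb => simpa only [map_add] using K.add_mem ha hb
    | tmul a b => simpa using K.smul_mem b.2 _
  rw [hp2] at hz'
  have h3 : TensorProduct.lid k A ((Coalgebra.counit (R := k)).rTensor A (D x)) = S x := by
    have : ∀ X : A ⊗[k] A, TensorProduct.lid k A ((Coalgebra.counit (R := k)).rTensor A
        (LinearMap.lTensor A S X)) = S (TensorProduct.lid k A ((Coalgebra.counit (R := k)).rTensor A X)) := by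
      intro X
      induction X with
      | zero => simp
      | add a b ha hb => simp only [map_add, ha, hb]
      | tmul a b => simp
    refine (this _).trans ?_
    rw [Coalgebra.rTensor_counit_comul]
    simp
  rwa [h3] at hz'

theorem comul_antipode (a : A) : Coalgebra.comul (R := k) (HopfAlgebra.antipode k a) =
    TensorProduct.map S S (TensorProduct.comm k A A (Coalgebra.comul a)) := by
  refine (LinearMap.congr_fun comul_comp_antipode a).trans ?_
  simp only [conv, LinearMap.comp_apply]
  generalize (Coalgebra.comul a : A ⊗[k] A) = X
  induction X with
  | zero => simp
  | add x y hx hy => simp only [map_add, hx, hy]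
  | tmul x y => simp

variable (k) in
/-- The right adjoint action `h ↦ S(h₁) x h₂`. -/
def adr (x : A) : A →ₗ[k] A := conv S (LinearMap.mulLeft k x)

/-- A coefficient of the coadjoint coaction: `a ↦ S(a₁) g(a₂) a₃`. -/
def adc (g : A →ₗ[k] k) : A →ₗ[k] A := conv S (lhit g)

/-- From h₁S(h₂) = ε(h): it moves x past h at the price of the adjoint action. The companion
`conv_id_adc` plays the same role for the coproduct and yields cocommutativity of quotients. -/
theorem conv_id_adr (x : A) : conv LinearMap.id (adr k x) = LinearMap.mulLeft k x := by
  rw [adr, ← conv_assoc, conv_id_antipode, convUnit_conv]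

theorem conv_id_adc (g : A →ₗ[k] k) : conv LinearMap.id (adc g) = lhit g := by
  rw [adc, ← conv_assoc, conv_id_antipode, convUnit_conv]

theorem counit_comp_antipode_aux :
    (Bialgebra.counitAlgHom k A).toLinearMap ∘ₗ S = convUnit k A k := by
  ext a; simp [convUnit]

theorem counit_adr (x a : A) : Coalgebra.counit (R := k) (adr k x a) =
    Coalgebra.counit (R := k) x * Coalgebra.counit (R := k) a := by
  have h := LinearMap.congr_fun
    (comp_conv (Bialgebra.counitAlgHom k A) S (LinearMap.mulLeft k x)) a
  rw [counit_comp_antipode_aux, convUnit_conv] at h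
  refine h.trans ?_
  simp

theorem counit_adc (g : A →ₗ[k] k) (a : A) : Coalgebra.counit (R := k) (adc g a) = g a := by
  have h := LinearMap.congr_fun
    (comp_conv (Bialgebra.counitAlgHom k A) S (lhit g)) a
  rw [counit_comp_antipode_aux, convUnit_conv] at h
  exact h.trans (counit_lhit g a)

/-- `L` is a sub-bialgebra of `K`, stable under the right adjoint action of `K` and containing the
coefficients of the coadjoint coaction of `K`. -/
structure CocommStep (K L : Subalgebra k A) : Prop where
  le : L ≤ K
  sub : L.IsSubcoalgebra
  adr_mem : ∀ h ∈ K, ∀ x ∈ L, adr k x h ∈ L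
  adc_mem : ∀ a ∈ K, ∀ g : A →ₗ[k] k, adc g a ∈ L

end AntipodeStable

/-! ### Compatibility with bialgebra maps -/

section BialgHom

variable {k : Type u} [Field k]
variable {A : Type*} [Ring A] [HopfAlgebra k A]
variable {B : Type*} [Ring B] [HopfAlgebra k B]

/-- The linear map underlying a bialgebra map. -/
abbrev BialgHom.lin (π : B →ₐc[k] A) : B →ₗ[k] A := (π : B →ₐ[k] A).toLinearMap

theorem conv_comp_bialgHom {C : Type*} [Ring C] [Algebra k C] (π : B →ₐc[k] A)
    (φ ψ : A →ₗ[k] C) : conv φ ψ ∘ₗ π.lin = conv (φ ∘ₗ π.lin) (ψ ∘ₗ π.lin) :=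
  conv_comp (π : B →ₗc[k] A) φ ψ

theorem bialgHom_comp_conv (π : B →ₐc[k] A) {C : Type*} [AddCommGroup C] [Module k C]
    [Coalgebra k C] (φ ψ : C →ₗ[k] B) :
    π.lin ∘ₗ conv φ ψ = conv (π.lin ∘ₗ φ) (π.lin ∘ₗ ψ) :=
  comp_conv (π : B →ₐ[k] A) φ ψ

theorem counit_comp_bialgHom (π : B →ₐc[k] A) :
    (Coalgebra.counit (R := k)) ∘ₗ π.lin = Coalgebra.counit (R := k) :=
  (π : B →ₗc[k] A).counit_comp

/-- Both sides are convolution inverses of π. -/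
theorem bialgHom_comp_antipode (π : B →ₐc[k] A) :
    π.lin ∘ₗ HopfAlgebra.antipode k = HopfAlgebra.antipode k ∘ₗ π.lin := by
  have h1 := conv_comp_antipode_algHom (π : B →ₐ[k] A)
  have h2 : conv π.lin (HopfAlgebra.antipode k ∘ₗ π.lin) = convUnit k B A := by
    have := conv_comp_bialgHom π LinearMap.id (HopfAlgebra.antipode k)
    rw [conv_id_antipode, convUnit, LinearMap.comp_assoc, counit_comp_bialgHom] at this
    exact this.symm
  have h3 := conv_assoc (π.lin ∘ₗ HopfAlgebra.antipode k) π.lin (HopfAlgebra.antipode k ∘ₗ π.lin)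
  rw [h1, h2, convUnit_conv, conv_convUnit] at h3
  exact h3.symm

theorem bialgHom_antipode (π : B →ₐc[k] A) (b : B) :
    π (HopfAlgebra.antipode k b) = HopfAlgebra.antipode k (π b) :=
  LinearMap.congr_fun (bialgHom_comp_antipode π) b

theorem bialgHom_adr (π : B →ₐc[k] A) (x h : B) : π (adr k x h) = adr k (π x) (π h) := by
  have h1 : π.lin ∘ₗ adr k x = adr k (π x) ∘ₗ π.lin := by
    rw [adr, adr, bialgHom_comp_conv, conv_comp_bialgHom, bialgHom_comp_antipode]
    congr 1
    ext; simp
  exact LinearMap.congr_fun h1 h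

theorem bialgHom_lhit (π : B →ₐc[k] A) (g : A →ₗ[k] k) (b : B) :
    π (lhit (g ∘ₗ π.lin) b) = lhit g (π b) := by
  have h1 : π.lin ∘ₗ lhit (g ∘ₗ π.lin) = LinearMap.id ∘ₗ lhit g ∘ₗ π.lin := by
    rw [← LinearMap.comp_assoc, ← conv_linearMap_left, ← conv_linearMap_left, conv_comp_bialgHom]
    rfl
  exact LinearMap.congr_fun h1 b

theorem bialgHom_rhit (π : B →ₐc[k] A) (g : A →ₗ[k] k) (b : B) :
    π (rhit (g ∘ₗ π.lin) b) = rhit g (π b) := by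
  have h1 : π.lin ∘ₗ rhit (g ∘ₗ π.lin) = LinearMap.id ∘ₗ rhit g ∘ₗ π.lin := by
    rw [← LinearMap.comp_assoc, ← conv_linearMap_right, ← conv_linearMap_right, conv_comp_bialgHom]
    rfl
  exact LinearMap.congr_fun h1 b

theorem bialgHom_adc (π : B →ₐc[k] A) (g : A →ₗ[k] k) (b : B) :
    π (adc (g ∘ₗ π.lin) b) = adc g (π b) := by
  have h1 : π.lin ∘ₗ adc (g ∘ₗ π.lin) = adc g ∘ₗ π.lin := by
    rw [adc, adc, bialgHom_comp_conv, conv_comp_bialgHom, bialgHom_comp_antipode]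
    congr 1
    ext b
    exact bialgHom_lhit π g b
  exact LinearMap.congr_fun h1 b

theorem exists_extend {ι : B →ₐc[k] A} (hι : Function.Injective ι) (f : B →ₗ[k] k) :
    ∃ g : A →ₗ[k] k, f = g ∘ₗ ι.lin := by
  obtain ⟨p, hp⟩ := ι.lin.exists_leftInverse_of_injective (LinearMap.ker_eq_bot.2 hι)
  exact ⟨f ∘ₗ p, by rw [LinearMap.comp_assoc, hp, LinearMap.comp_id]⟩

/-- Since ι is split as a linear map, every functional on B extends to A, so slices and coefficients
computed in B are restrictions of those in A. A step between subalgebras of A thus becomes a step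
starting from the whole of a Hopf algebra B. -/
theorem CocommStep.comap {K L : Subalgebra k A} (h : CocommStep K L) {ι : B →ₐc[k] A}
    (hι : Function.Injective ι) (hK : ∀ b, ι b ∈ K) :
    CocommStep ⊤ (L.comap (ι : B →ₐ[k] A)) where
  le := le_top
  sub := by
    refine Subalgebra.IsSubcoalgebra.of_hit ?_ ?_ <;> intro f x hx <;>
      obtain ⟨g, rfl⟩ := exists_extend hι f
    · change ι _ ∈ L
      rw [bialgHom_lhit]
      exact h.sub.lhit_mem g hx
    · change ι _ ∈ L
      rw [bialgHom_rhit]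
      exact h.sub.rhit_mem g hx
  adr_mem a _ x hx := by
    change ι _ ∈ L
    rw [bialgHom_adr]
    exact h.adr_mem _ (hK a) _ hx
  adc_mem a _ f := by
    obtain ⟨g, rfl⟩ := exists_extend hι f
    change ι _ ∈ L
    rw [bialgHom_adc]
    exact h.adc_mem _ (hK a) g

end BialgHom

/-! ### Quotients by Hopf subalgebras, and lower series from chains -/

section Quotient

variable {k : Type u} [Field k]
variable {A : Type v} [Ring A] [HopfAlgebra k A]

local notation "S" => HopfAlgebra.antipode k (A := A)

theorem antipode_adr (x h : A) : HopfAlgebra.antipode k (adr k x h) =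
    conv (LinearMap.mulRight k (HopfAlgebra.antipode k x)) S (HopfAlgebra.antipode k h) := by
  rw [adr, conv_apply, conv_apply, comul_antipode]
  generalize (Coalgebra.comul h : A ⊗[k] A) = X
  induction X with
  | zero => simp
  | add x y hx hy => simp only [map_add, hx, hy]
  | tmul a b => simp [HopfAlgebra.antipode_mul_antidistrib]

/-- A sub-bialgebra, as a Hopf subalgebra of a finite dimensional Hopf algebra. -/
def Subalgebra.IsSubcoalgebra.hopfSubalgebra [FiniteDimensional k A] {L : Subalgebra k A}
    (h : L.IsSubcoalgebra) : HopfSubalgebra k A :=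
  { L with
    comul_mem := h
    antipode_mem := fun _ hx => h.antipode_mem hx }

/-- The inclusion of a Hopf subalgebra. -/
def HopfSubalgebra.inclusion (K : HopfSubalgebra k A) : K.toSubalgebra →ₐc[k] A :=
  BialgHom.ofAlgHom K.toSubalgebra.val (by ext; rfl) (by
    ext x
    exact K.incl₂_comulHom x)

/-- S exchanges the two adjoint actions: S(S(a₁)xa₂) = S(a₂)S(x)S(S(a₁)), which is the left action
of S(a) on S(x). By finite dimension the injective S is onto, both on A and on K, so every instance
of the left action arises. -/
theorem HopfSubalgebra.isNormal_of_adr [FiniteDimensional k A] (K : HopfSubalgebra k A)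
    (hS : Function.Injective S) (h : ∀ a : A, ∀ x ∈ K.toSubalgebra, adr k x a ∈ K.toSubalgebra) :
    K.IsNormal := by
  intro a x hx
  obtain ⟨a', rfl⟩ := LinearMap.injective_iff_surjective.1 hS a
  have hK : Function.Injective K.antipodeHom := fun x y hxy =>
    Subtype.ext (hS (congrArg Subtype.val hxy))
  obtain ⟨x', hx'⟩ := LinearMap.injective_iff_surjective.1 hK ⟨x, hx⟩
  have hx'' : HopfAlgebra.antipode k (x' : A) = x := congrArg Subtype.val hx'
  have := K.antipode_mem _ (h a' x' x'.2)
  rwa [antipode_adr, hx''] at this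

/-- For x ∈ K⁺, xb = b₁(S(b₂)xb₃), and the bracket lies again in K⁺ because ε of it contains the
factor ε(x). -/
theorem HopfSubalgebra.augIdeal_isTwoSided (K : HopfSubalgebra k A)
    (h : ∀ a : A, ∀ x ∈ K.toSubalgebra, adr k x a ∈ K.toSubalgebra) :
    K.augIdeal.IsTwoSided where
  mul_mem_of_left {a} b ha := by
    induction ha using Submodule.span_induction with
    | zero => simp
    | add x y _ _ hx hy => rw [add_mul]; exact K.augIdeal.add_mem hx hy
    | smul r x _ hx => rw [smul_mul_assoc]; exact K.augIdeal.smul_mem r hx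
    | mem x hx =>
      have h1 : x * b = conv LinearMap.id (adr k x) b := by rw [conv_id_adr]; rfl
      rw [h1, conv_apply]
      generalize (Coalgebra.comul b : A ⊗[k] A) = X
      induction X with
      | zero => simp
      | add x y hx hy => simpa only [map_add] using K.augIdeal.add_mem hx hy
      | tmul a b =>
        refine K.augIdeal.mul_mem_left a (Ideal.subset_span ⟨h b x hx.1, ?_⟩)
        rw [counit_adr, hx.2, zero_mul]

theorem counit_mul'_comul (a : A) : LinearMap.mul' k k (TensorProduct.map Coalgebra.counit
    Coalgebra.counit (Coalgebra.comul (R := k) a)) = Coalgebra.counit (R := k) a := by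
  have h3 : convUnit k A k = Coalgebra.counit := by ext; simp [convUnit]
  have := LinearMap.congr_fun (conv_convUnit (convUnit k A k)) a
  rwa [h3, conv_apply] at this

theorem HopfSubalgebra.augIdeal_isHopfIdeal (K : HopfSubalgebra k A)
    [K.augIdeal.IsTwoSided] : K.augIdeal.IsHopfIdeal k where
  counit_eq_zero := by
    have : K.augIdeal ≤ RingHom.ker (Bialgebra.counitAlgHom k A) :=
      Ideal.span_le.2 fun x hx => hx.2
    exact fun x hx => this hx
  map_mkQ_comul_eq_zero := by
    let q : A →ₐ[k] A ⧸ K.augIdeal := Ideal.Quotient.mkₐ k K.augIdeal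
    -- On K the quotient map is the counit. As Δ(K) ⊆ K ⊗ K, the map (q ⊗ q)Δ is therefore also the
    -- counit on K, and it kills the generators K⁺.
    have hq : ∀ x ∈ K.toSubalgebra, q x = algebraMap k _ (Coalgebra.counit (R := k) x) := by
      intro x hx
      rw [← AlgHom.commutes q]
      refine Ideal.Quotient.eq.2 (Ideal.subset_span ⟨K.sub_mem hx (K.algebraMap_mem _), ?_⟩)
      simp
    let Q := (Algebra.TensorProduct.map q q).comp (Bialgebra.comulAlgHom k A)
    have : K.augIdeal ≤ RingHom.ker Q := by
      refine Ideal.span_le.2 fun x hx => ?_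
      change TensorProduct.map q.toLinearMap q.toLinearMap (Coalgebra.comul (R := k) x) = 0
      have h0 := counit_mul'_comul (k := k) x
      obtain ⟨z, hz⟩ := K.comul_mem x hx.1
      rw [← hz, hx.2] at h0
      rw [← hz]
      have : ∀ w : K.toSubalgebra ⊗[k] K.toSubalgebra,
          TensorProduct.map q.toLinearMap q.toLinearMap (TensorProduct.map
            K.toSubalgebra.val.toLinearMap K.toSubalgebra.val.toLinearMap w) =
          algebraMap k _ (LinearMap.mul' k k (TensorProduct.map (Coalgebra.counit (R := k))
            (Coalgebra.counit (R := k)) (TensorProduct.map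
            K.toSubalgebra.val.toLinearMap K.toSubalgebra.val.toLinearMap w))) := by
        intro w
        induction w with
        | zero => simp
        | add x y hx hy => simp only [map_add, hx, hy]
        | tmul x y =>
          simp only [TensorProduct.map_tmul, AlgHom.toLinearMap_apply, Subalgebra.coe_val,
            hq _ x.2, hq _ y.2, LinearMap.mul'_apply]
          simp only [Algebra.algebraMap_eq_smul_one, TensorProduct.smul_tmul',
            TensorProduct.tmul_smul, smul_smul, Algebra.TensorProduct.one_def, mul_comm]
      rw [this, h0, map_zero]
    exact fun x hx => this hx
  antipode_mem := by
    intro x hx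
    induction hx using Submodule.span_induction with
    | zero => simp
    | add x y _ _ hx hy => rw [map_add]; exact K.augIdeal.add_mem hx hy
    | smul r x _ hx =>
      rw [smul_eq_mul, HopfAlgebra.antipode_mul_antidistrib]
      exact K.augIdeal.mul_mem_right _ hx
    | mem x hx =>
      exact Ideal.subset_span ⟨K.antipode_mem x hx.1, by rw [HopfAlgebra.counit_antipode, hx.2]⟩

/-- Once q sends `adc g a` to its counit g(a), the identity `conv_id_adc` gives q(g(a₁)a₂) =
q(a₁)g(a₂). Left and right slices of the coproduct of Q then coincide. -/
theorem isCocomm_of_adc {Q : Type*} [Ring Q] [HopfAlgebra k Q] (q : A →ₐc[k] Q)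
    (hq : Function.Surjective q)
    (h : ∀ (g : A →ₗ[k] k) (a : A), q (adc g a) = algebraMap k Q (Coalgebra.counit (R := k) (adc g a))) :
    Coalgebra.IsCocomm k Q where
  comm_comp_comul := by
    have key : ∀ (g : A →ₗ[k] k) (a : A), q (lhit g a) = q (rhit g a) := by
      intro g a
      have h1 : q.lin ∘ₗ lhit g = q.lin ∘ₗ rhit g := by
        rw [← conv_id_adc, bialgHom_comp_conv, ← conv_linearMap_right]
        congr 1
        ext b
        simpa [counit_adc] using h g b
      exact LinearMap.congr_fun h1 a
    ext b
    obtain ⟨a, rfl⟩ := hq b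
    apply TensorProduct.eq_of_forall_rTensor
    intro f
    have h2 : ∀ X : Q ⊗[k] Q, TensorProduct.lid k Q (f.rTensor Q (TensorProduct.comm k Q Q X)) =
        TensorProduct.rid k Q (f.lTensor Q X) := by
      intro X
      induction X with
      | zero => simp
      | add x y hx hy => simp only [map_add, hx, hy]
      | tmul x y => simp
    refine (h2 _).trans ?_
    change rhit f (q a) = lhit f (q a)
    rw [← bialgHom_rhit, ← bialgHom_lhit, key]

theorem HopfSubalgebra.exists_cocomm_quotient (K : HopfSubalgebra k A)
    (hK : CocommStep ⊤ K.toSubalgebra) :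
    ∃ (Q : Type v) (_ : Ring Q) (_ : HopfAlgebra k Q) (π : A →ₐc[k] Q),
      K.IsQuotientBy π ∧ Coalgebra.IsCocomm k Q := by
  have := K.augIdeal_isTwoSided fun a x hx => hK.adr_mem a trivial x hx
  have := K.augIdeal_isHopfIdeal
  refine ⟨A ⧸ K.augIdeal, inferInstance, inferInstance,
    Bialgebra.Quotient.mkBialgHom K.augIdeal, ⟨Ideal.Quotient.mk_surjective, ?_⟩, ?_⟩
  · ext x
    exact Ideal.Quotient.eq_zero_iff_mem
  · refine isCocomm_of_adc (Bialgebra.Quotient.mkBialgHom (R := k) K.augIdeal)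
      Ideal.Quotient.mk_surjective fun g a => ?_
    refine (Ideal.Quotient.eq (y := algebraMap k A _)).2 (Ideal.subset_span ⟨?_, by simp⟩)
    exact K.sub_mem (hK.adc_mem a trivial g) (K.algebraMap_mem _)

/-- The members of a lower series are Hopf algebras in their own right, each a subalgebra of the
previous one. Quantifying over all B embedded in the fixed A with image K avoids comparing nested
subtypes. -/
theorem hasLowerNormalSeries_of_chain {k : Type u} [Field k] {A : Type w} [Ring A]
    [HopfAlgebra k A] [FiniteDimensional k A]
    (hS : Function.Injective (HopfAlgebra.antipode k (A := A))) {K : Subalgebra k A}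
    (hK : Relation.ReflTransGen CocommStep K ⊥) :
    ∀ (B : Type v) [Ring B] [HopfAlgebra k B] (ι : B →ₐc[k] A), Function.Injective ι →
      (∀ a, a ∈ K ↔ ∃ b, ι b = a) → HasLowerNormalSeries (IsCocommHopf.{u, v} k) B := by
  induction hK using Relation.ReflTransGen.head_induction_on with
  | refl =>
    intro B _ _ ι hι hK
    refine HasLowerNormalSeries.nil B ⟨?_, fun b => ?_⟩
    · intro x y hxy
      have h1 := congrArg (Coalgebra.counit (R := k)) hxy
      simpa using h1
    · obtain ⟨c, hc⟩ := Algebra.mem_bot.1 ((hK (ι b)).2 ⟨b, rfl⟩)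
      refine ⟨c, hι ?_⟩
      rw [← hc]
      exact (ι : B →ₐ[k] A).commutes c
  | @head K L hKL hL ih =>
    intro B _ _ ι hι hK
    -- The chain may repeat a term, whereas a lower series is strictly decreasing; repetitions are
    -- skipped here.
    by_cases hne : ∀ a ∈ K, a ∈ L
    · exact ih B ι hι fun a => ⟨fun ha => (hK a).1 (hKL.le ha), fun ha => hne a ((hK a).2 ha)⟩
    have : FiniteDimensional k B := FiniteDimensional.of_injective ι.lin hι
    have hstep := hKL.comap hι fun b => (hK _).2 ⟨b, rfl⟩
    let LB : HopfSubalgebra k B := hstep.sub.hopfSubalgebra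
    have hLB : CocommStep ⊤ LB.toSubalgebra := hstep
    have hSB : Function.Injective (HopfAlgebra.antipode k (A := B)) := by
      intro x y hxy
      apply hι
      apply hS
      rw [← bialgHom_antipode, ← bialgHom_antipode, hxy]
    obtain ⟨Q, _, _, π, hπ, hQ⟩ := LB.exists_cocomm_quotient hLB
    refine HasLowerNormalSeries.step B LB
      (LB.isNormal_of_adr hSB fun a x hx => hLB.adr_mem a trivial x hx) ?_ Q π hπ hQ ?_
    · intro htop
      push Not at hne
      obtain ⟨a, haK, haL⟩ := hne
      obtain ⟨b, rfl⟩ := (hK a).1 haK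
      have : b ∈ LB.toSubalgebra := htop ▸ trivial
      exact haL this
    · let j : LB.toSubalgebra →ₐc[k] A := ι.comp (HopfSubalgebra.inclusion LB)
      refine ih LB.toSubalgebra j (fun x y hxy => Subtype.ext (hι hxy)) fun a => ?_
      constructor
      · intro ha
        obtain ⟨b, rfl⟩ := (hK a).1 (hKL.le ha)
        exact ⟨⟨b, ha⟩, rfl⟩
      · rintro ⟨b, rfl⟩
        exact b.2

end Quotient

/-! ### Bicharacters and the algebra of their left legs -/

section Bicharacter

variable {k : Type u} [Field k]
variable {A : Type*} [Ring A] [HopfAlgebra k A]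
variable {B : Type*} [Ring B] [HopfAlgebra k B]

/-- `t ∈ B ⊗ A` with inverse `s` satisfies `(Δ ⊗ id)(t) = t₁₃ t₂₃` and
`(id ⊗ Δ)(s) = s₁₂ s₁₃`, and is counital. -/
structure IsBichar (s t : B ⊗[k] A) : Prop where
  inv_mul : s * t = 1
  mul_inv : t * s = 1
  hex_left : Algebra.TensorProduct.assoc k k k B B A
      (Algebra.TensorProduct.map (Bialgebra.comulAlgHom k B) (AlgHom.id k A) t) =
    Algebra.TensorProduct.map (AlgHom.id k B) Algebra.TensorProduct.includeRight t *
      Algebra.TensorProduct.includeRight t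
  hex_right : Algebra.TensorProduct.map (AlgHom.id k B) (Bialgebra.comulAlgHom k A) s =
    Algebra.TensorProduct.map (AlgHom.id k B) Algebra.TensorProduct.includeLeft s *
      Algebra.TensorProduct.map (AlgHom.id k B) Algebra.TensorProduct.includeRight s
  counit_left :
    Algebra.TensorProduct.map (Bialgebra.counitAlgHom k B) (AlgHom.id k A) t = 1
  counit_right :
    Algebra.TensorProduct.map (AlgHom.id k B) (Bialgebra.counitAlgHom k A) s = 1

/-- The left leg `(id ⊗ f)(s)` of a tensor. -/
def leg (s : B ⊗[k] A) (f : A →ₗ[k] k) : B := TensorProduct.rid k B (f.lTensor B s)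

theorem leg_rTensor (s : B ⊗[k] A) (f : A →ₗ[k] k) (φ : B →ₗ[k] B) :
    leg (φ.rTensor A s) f = φ (leg s f) := by
  unfold leg
  induction s with
  | zero => simp
  | add x y hx hy => simp only [map_add, hx, hy]
  | tmul x y => simp

theorem leg_lTensor {A' : Type*} [Ring A'] [HopfAlgebra k A'] (s : B ⊗[k] A) (f : A' →ₗ[k] k)
    (φ : A →ₗ[k] A') : leg (φ.lTensor B s) f = leg s (f ∘ₗ φ) := by
  simp [leg, LinearMap.lTensor_comp]

theorem lTensor_linearMap_comp {C : Type*} [Ring C] [Algebra k C] (s : B ⊗[k] A)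
    (g : A →ₗ[k] k) : (Algebra.linearMap k C ∘ₗ g).lTensor B s = leg s g ⊗ₜ 1 := by
  unfold leg
  induction s with
  | zero => simp
  | add x y hx hy => simp only [map_add, hx, hy, add_tmul]
  | tmul x y => simp [Algebra.algebraMap_eq_smul_one, TensorProduct.smul_tmul]

theorem rTensor_linearMap_comp {C : Type*} [Ring C] [Algebra k C] (s : B ⊗[k] A)
    (g : B →ₗ[k] k) : (Algebra.linearMap k C ∘ₗ g).rTensor A s =
      1 ⊗ₜ TensorProduct.lid k A (g.rTensor A s) := by
  induction s with
  | zero => simp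
  | add x y hx hy => simp only [map_add, hx, hy, tmul_add]
  | tmul x y => simp [Algebra.algebraMap_eq_smul_one, TensorProduct.smul_tmul]

theorem rTensor_mulLeft (x : B) (s : B ⊗[k] A) :
    (LinearMap.mulLeft k x).rTensor A s = (x ⊗ₜ 1) * s := by
  induction s with
  | zero => simp
  | add x y hx hy => simp only [map_add, hx, hy, mul_add]
  | tmul x y => simp

theorem lTensor_mulRight (y : A) (s : B ⊗[k] A) :
    (LinearMap.mulRight k y).lTensor B s = s * (1 ⊗ₜ y) := by
  induction s with
  | zero => simp
  | add x y hx hy => simp only [map_add, hx, hy, add_mul]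
  | tmul x y => simp

theorem leg_one_tmul_mul (y : A) (s : B ⊗[k] A) (f : A →ₗ[k] k) :
    leg ((1 ⊗ₜ y) * s) f = leg s (f ∘ₗ LinearMap.mulLeft k y) := by
  unfold leg
  induction s with
  | zero => simp
  | add x y hx hy => simp only [map_add, hx, hy, mul_add]
  | tmul x y => simp

theorem leg_mul_one_tmul (y : A) (s : B ⊗[k] A) (f : A →ₗ[k] k) :
    leg (s * (1 ⊗ₜ y)) f = leg s (f ∘ₗ LinearMap.mulRight k y) := by
  unfold leg
  induction s with
  | zero => simp
  | add x y hx hy => simp only [map_add, hx, hy, add_mul]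
  | tmul x y => simp

namespace IsBichar

variable {s t : B ⊗[k] A} (h : IsBichar s t)
include h

/-- Working form of (Δ ⊗ id)(t) = t₁₃t₂₃. With the counterpart `lTensor_conv` for s, identities
between legs become convolution computations. Using t on the left and s on the right keeps both
products in the order of the convolution. -/
theorem rTensor_conv {C : Type*} [Ring C] [Algebra k C] (φ ψ : B →ₗ[k] C) :
    (conv φ ψ).rTensor A t = φ.rTensor A t * ψ.rTensor A t := by
  let U : B ⊗[k] (B ⊗[k] A) →ₗ[k] C ⊗[k] A :=
    (LinearMap.mul' k C ∘ₗ TensorProduct.map φ ψ).rTensor A ∘ₗ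
      (TensorProduct.assoc k B B A).symm.toLinearMap
  have h1 : ∀ x : B ⊗[k] A, U (Algebra.TensorProduct.assoc k k k B B A
      (Algebra.TensorProduct.map (Bialgebra.comulAlgHom k B) (AlgHom.id k A) x)) =
      (conv φ ψ).rTensor A x := by
    intro x
    induction x with
    | zero => simp
    | add x y hx hy => simp only [map_add, hx, hy]
    | tmul x y =>
      simp only [Algebra.TensorProduct.map_tmul, AlgHom.id_apply, LinearMap.rTensor_tmul]
      change (LinearMap.mul' k C ∘ₗ TensorProduct.map φ ψ).rTensor A
        ((TensorProduct.assoc k B B A).symm (TensorProduct.assoc k B B A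
          (Coalgebra.comul (R := k) x ⊗ₜ y))) = _
      rw [LinearEquiv.symm_apply_apply]
      rfl
  have h2 : ∀ x y : B ⊗[k] A, U (Algebra.TensorProduct.map (AlgHom.id k B)
      Algebra.TensorProduct.includeRight x * Algebra.TensorProduct.includeRight y) =
      φ.rTensor A x * ψ.rTensor A y := by
    intro x y
    induction x with
    | zero => simp
    | add a b ha hb => simp only [map_add, add_mul, ha, hb]
    | tmul a b =>
      induction y with
      | zero => simp
      | add a b ha hb => simp only [map_add, mul_add, ha, hb]
      | tmul c d => simp [U]
  rw [← h1, h.hex_left, h2]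

theorem lTensor_conv {C : Type*} [Ring C] [Algebra k C] (φ ψ : A →ₗ[k] C) :
    (conv φ ψ).lTensor B s = φ.lTensor B s * ψ.lTensor B s := by
  let U : B ⊗[k] (A ⊗[k] A) →ₗ[k] B ⊗[k] C :=
    (LinearMap.mul' k C ∘ₗ TensorProduct.map φ ψ).lTensor B
  have h1 : ∀ x : B ⊗[k] A, U
      (Algebra.TensorProduct.map (AlgHom.id k B) (Bialgebra.comulAlgHom k A) x) =
      (conv φ ψ).lTensor B x := by
    intro x
    induction x with
    | zero => simp
    | add x y hx hy => simp only [map_add, hx, hy]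
    | tmul x y => rfl
  have h2 : ∀ x y : B ⊗[k] A, U (Algebra.TensorProduct.map (AlgHom.id k B)
      Algebra.TensorProduct.includeLeft x * Algebra.TensorProduct.map (AlgHom.id k B)
      Algebra.TensorProduct.includeRight y) =
      φ.lTensor B x * ψ.lTensor B y := by
    intro x y
    induction x with
    | zero => simp
    | add a b ha hb => simp only [map_add, add_mul, ha, hb]
    | tmul a b =>
      induction y with
      | zero => simp
      | add a b ha hb => simp only [map_add, mul_add, ha, hb]
      | tmul c d => simp [U]
  rw [← h1, h.hex_right, h2]

theorem lid_counit : TensorProduct.lid k A ((Coalgebra.counit (R := k)).rTensor A t) = 1 := by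
  have := congrArg (Algebra.TensorProduct.lid k A) h.counit_left
  rwa [map_one] at this

theorem leg_counit : leg s (Coalgebra.counit (R := k)) = 1 := by
  have := congrArg (Algebra.TensorProduct.rid k k B) h.counit_right
  rwa [map_one] at this

/-- Since S * id is the convolution unit, `rTensor_conv` makes (S ⊗ id)(t) a left inverse of t. -/
theorem rTensor_antipode : (HopfAlgebra.antipode k).rTensor A t = s := by
  have h1 := h.rTensor_conv (HopfAlgebra.antipode k) LinearMap.id
  rw [conv_antipode_id, convUnit, rTensor_linearMap_comp, h.lid_counit, LinearMap.rTensor_id,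
    LinearMap.id_apply, ← Algebra.TensorProduct.one_def] at h1
  exact left_inv_eq_right_inv h1.symm h.mul_inv

theorem lTensor_antipode : (HopfAlgebra.antipode k).lTensor B s = t := by
  have h1 := h.lTensor_conv LinearMap.id (HopfAlgebra.antipode k)
  rw [conv_id_antipode, convUnit, lTensor_linearMap_comp, h.leg_counit, LinearMap.lTensor_id,
    LinearMap.id_apply, ← Algebra.TensorProduct.one_def] at h1
  exact (left_inv_eq_right_inv h.mul_inv h1.symm).symm

/-- The span of the left legs of `s`, a subalgebra. -/
def legs : Subalgebra k B where
  carrier := {b | ∃ f, leg s f = b}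
  mul_mem' := by
    rintro _ _ ⟨f, rfl⟩ ⟨g, rfl⟩
    refine ⟨conv f g, ?_⟩
    rw [leg, h.lTensor_conv]
    exact map_mul (Algebra.TensorProduct.rid k k B) _ _
  add_mem' := by
    rintro _ _ ⟨f, rfl⟩ ⟨g, rfl⟩
    exact ⟨f + g, by simp [leg, LinearMap.lTensor_add]⟩
  algebraMap_mem' c := ⟨c • Coalgebra.counit (R := k), by
    have := h.leg_counit
    rw [leg] at this
    rw [leg, LinearMap.lTensor_smul, LinearMap.smul_apply, map_smul, this,
      Algebra.algebraMap_eq_smul_one]⟩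

theorem leg_t_mem (f : A →ₗ[k] k) : leg t f ∈ h.legs := by
  refine ⟨f ∘ₗ HopfAlgebra.antipode k, ?_⟩
  rw [← leg_lTensor, h.lTensor_antipode]

/-- From t = (id ⊗ S)(s), the legs of t are among those of s. From s = (S ⊗ id)(t), the legs of s
are the S-image of those of t, hence of no larger dimension. So the two finite dimensional spaces
agree. -/
theorem mem_legs_iff [FiniteDimensional k A] {b : B} : b ∈ h.legs ↔ ∃ f, leg t f = b := by
  let ℓ : (A →ₗ[k] k) →ₗ[k] B :=
    { toFun := leg t
      map_add' := fun f g => by simp [leg, LinearMap.lTensor_add]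
      map_smul' := fun c f => by simp [leg, LinearMap.lTensor_smul] }
  have h1 : LinearMap.range ℓ ≤ Subalgebra.toSubmodule h.legs := by
    rintro _ ⟨f, rfl⟩
    exact h.leg_t_mem f
  have h2 : Subalgebra.toSubmodule h.legs = (LinearMap.range ℓ).map (HopfAlgebra.antipode k) := by
    ext x
    constructor
    · rintro ⟨f, rfl⟩
      exact ⟨leg t f, ⟨f, rfl⟩, by rw [← leg_rTensor, h.rTensor_antipode]⟩
    · rintro ⟨_, ⟨f, rfl⟩, rfl⟩
      exact ⟨f, by rw [← h.rTensor_antipode, leg_rTensor]; rfl⟩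
  have : FiniteDimensional k (Subalgebra.toSubmodule h.legs) := by rw [h2]; infer_instance
  have h3 : LinearMap.range ℓ = Subalgebra.toSubmodule h.legs := by
    refine Submodule.eq_of_le_of_finrank_le h1 ?_
    rw [h2]
    exact Submodule.finrank_map_le _ _
  rw [← Subalgebra.mem_toSubmodule, ← h3]
  rfl

/-- The identity for s makes its legs a subalgebra, and the identity for t makes its legs a
subcoalgebra; `mem_legs_iff` says that these are the same space. A slice of Δ(leg t f) is the leg of
t against f precomposed with a multiplication. -/
theorem legs_isSubcoalgebra [FiniteDimensional k A] : h.legs.IsSubcoalgebra := by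
  refine Subalgebra.IsSubcoalgebra.of_hit ?_ ?_ <;> intro g x hx <;>
    obtain ⟨f, rfl⟩ := h.mem_legs_iff.1 hx <;> rw [h.mem_legs_iff]
  · have h1 := h.rTensor_conv (Algebra.linearMap k B ∘ₗ g) LinearMap.id
    rw [conv_linearMap_left, LinearMap.id_comp, rTensor_linearMap_comp, LinearMap.rTensor_id,
      LinearMap.id_apply] at h1
    exact ⟨_, by rw [← leg_rTensor, h1, leg_one_tmul_mul]⟩
  · have h1 := h.rTensor_conv LinearMap.id (Algebra.linearMap k B ∘ₗ g)
    rw [conv_linearMap_right, LinearMap.id_comp, rTensor_linearMap_comp, LinearMap.rTensor_id,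
      LinearMap.id_apply] at h1
    exact ⟨_, by rw [← leg_rTensor, h1, leg_mul_one_tmul]⟩

/-- The action is a leg of s(x ⊗ 1)t with x = leg s g. Writing t = (id ⊗ S)(s) and x ⊗ 1 as a slice
of s, `lTensor_conv` merges the three factors into s sliced along a ↦ a₁g(a₂)S(a₃). -/
theorem adr_leg (f g : A →ₗ[k] k) : adr k (leg s g) (leg t f) =
    leg s (f ∘ₗ conv (rhit g) (HopfAlgebra.antipode k)) := by
  rw [← leg_rTensor, adr, h.rTensor_conv, h.rTensor_antipode, rTensor_mulLeft,
    ← lTensor_linearMap_comp, ← leg_lTensor]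
  congr 1
  conv_lhs => rw [← h.lTensor_antipode, ← h.lTensor_conv]
  have h1 := h.lTensor_conv LinearMap.id
    (conv (Algebra.linearMap k A ∘ₗ g) (HopfAlgebra.antipode k))
  rw [LinearMap.lTensor_id, LinearMap.id_apply] at h1
  rw [← h1, ← conv_assoc, conv_linearMap_right, LinearMap.id_comp]

/-- As for `adr_leg`, with middle factor 1 ⊗ y where y = (g ⊗ id)(t): the right leg is sliced along
a ↦ a₁yS(a₂). -/
theorem adc_leg (g : B →ₗ[k] k) (f : A →ₗ[k] k) : adc g (leg t f) =
    leg s (f ∘ₗ conv (LinearMap.mulRight k (TensorProduct.lid k A (g.rTensor A t)))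
      (HopfAlgebra.antipode k)) := by
  have h1 := h.rTensor_conv (Algebra.linearMap k B ∘ₗ g) LinearMap.id
  rw [conv_linearMap_left, LinearMap.id_comp, rTensor_linearMap_comp, LinearMap.rTensor_id,
    LinearMap.id_apply] at h1
  rw [← leg_rTensor, adc, h.rTensor_conv, h.rTensor_antipode, h1, ← leg_lTensor,
    h.lTensor_conv, h.lTensor_antipode, lTensor_mulRight, mul_assoc]

theorem map_right {A' : Type*} [Ring A'] [HopfAlgebra k A'] (π : A →ₐc[k] A') :
    IsBichar (π.lin.lTensor B s) (π.lin.lTensor B t) := by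
  let P : B ⊗[k] A →ₐ[k] B ⊗[k] A' := Algebra.TensorProduct.map (AlgHom.id k B) (π : A →ₐ[k] A')
  let P1 : B ⊗[k] (B ⊗[k] A) →ₐ[k] B ⊗[k] (B ⊗[k] A') := Algebra.TensorProduct.map (AlgHom.id k B) P
  let P2 : B ⊗[k] (A ⊗[k] A) →ₐ[k] B ⊗[k] (A' ⊗[k] A') := Algebra.TensorProduct.map (AlgHom.id k B)
    (Algebra.TensorProduct.map (π : A →ₐ[k] A') (π : A →ₐ[k] A'))
  -- The facts `e1` to `e7` are naturality in the right leg of each map occurring in the definition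
  -- of a bicharacter.
  have e1 : ∀ x, Algebra.TensorProduct.assoc k k k B B A'
      (Algebra.TensorProduct.map (Bialgebra.comulAlgHom k B) (AlgHom.id k A') (P x)) =
      P1 (Algebra.TensorProduct.assoc k k k B B A
      (Algebra.TensorProduct.map (Bialgebra.comulAlgHom k B) (AlgHom.id k A) x)) := by
    intro x
    induction x with
    | zero => simp
    | add x y hx hy => simp only [map_add, hx, hy]
    | tmul x y =>
      simp only [P, Algebra.TensorProduct.map_tmul, AlgHom.id_apply]
      generalize Bialgebra.comulAlgHom k B x = X
      induction X with
      | zero => simp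
      | add x y hx hy => simp only [map_add, hx, hy, add_tmul]
      | tmul x y => simp [P1, P]
  have e2 : ∀ x, Algebra.TensorProduct.map (AlgHom.id k B) (Bialgebra.comulAlgHom k A') (P x) =
      P2 (Algebra.TensorProduct.map (AlgHom.id k B) (Bialgebra.comulAlgHom k A) x) := by
    intro x
    induction x with
    | zero => simp
    | add x y hx hy => simp only [map_add, hx, hy]
    | tmul x y =>
      simp only [P, P2, Algebra.TensorProduct.map_tmul, AlgHom.id_apply]
      congr 1
      exact (LinearMap.congr_fun (π : A →ₗc[k] A').map_comp_comul y).symm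
  have e3 : ∀ x, Algebra.TensorProduct.map (AlgHom.id k B)
      (Algebra.TensorProduct.includeRight : A' →ₐ[k] B ⊗[k] A') (P x) =
      P1 (Algebra.TensorProduct.map (AlgHom.id k B) Algebra.TensorProduct.includeRight x) := by
    intro x
    induction x with
    | zero => simp
    | add x y hx hy => simp only [map_add, hx, hy]
    | tmul x y => simp [P, P1]
  have e4 : ∀ x, Algebra.TensorProduct.map (AlgHom.id k B)
      (Algebra.TensorProduct.includeRight : A' →ₐ[k] A' ⊗[k] A') (P x) =
      P2 (Algebra.TensorProduct.map (AlgHom.id k B) Algebra.TensorProduct.includeRight x) := by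
    intro x
    induction x with
    | zero => simp
    | add x y hx hy => simp only [map_add, hx, hy]
    | tmul x y => simp [P, P2]
  have e5 : ∀ x, Algebra.TensorProduct.map (AlgHom.id k B)
      (Algebra.TensorProduct.includeLeft : A' →ₐ[k] A' ⊗[k] A') (P x) =
      P2 (Algebra.TensorProduct.map (AlgHom.id k B) Algebra.TensorProduct.includeLeft x) := by
    intro x
    induction x with
    | zero => simp
    | add x y hx hy => simp only [map_add, hx, hy]
    | tmul x y => simp [P, P2]
  have e6 : ∀ x : B ⊗[k] A, Algebra.TensorProduct.map (Bialgebra.counitAlgHom k B)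
      (AlgHom.id k A') (P x) = Algebra.TensorProduct.map (AlgHom.id k k) (π : A →ₐ[k] A')
      (Algebra.TensorProduct.map (Bialgebra.counitAlgHom k B) (AlgHom.id k A) x) := by
    intro x
    induction x with
    | zero => simp
    | add x y hx hy => simp only [map_add, hx, hy]
    | tmul x y => simp [P]
  have e7 : ∀ x : B ⊗[k] A, Algebra.TensorProduct.map (AlgHom.id k B)
      (Bialgebra.counitAlgHom k A') (P x) =
      (Algebra.TensorProduct.map (AlgHom.id k B) (Bialgebra.counitAlgHom k A) x) := by
    intro x
    induction x with
    | zero => simp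
    | add x y hx hy => simp only [map_add, hx, hy]
    | tmul x y => simp [P]
  exact
    { inv_mul := by
        change P s * P t = 1
        rw [← map_mul, h.inv_mul, map_one]
      mul_inv := by
        change P t * P s = 1
        rw [← map_mul, h.mul_inv, map_one]
      hex_left := (e1 t).trans (by
        rw [h.hex_left, map_mul, ← e3]
        congr 1)
      hex_right := (e2 s).trans (by
        rw [h.hex_right, map_mul, ← e4, ← e5]
        rfl)
      counit_left := (e6 t).trans (by rw [h.counit_left, map_one])
      counit_right := (e7 s).trans h.counit_right }

end IsBichar

end Bicharacter

/-! ### Quotients by central group-likes, and the step for leg algebras -/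

section CentralExtension

variable {k : Type u} [Field k]
variable {A : Type*} [Ring A] [HopfAlgebra k A]
variable {A' : Type*} [Ring A'] [HopfAlgebra k A']

local notation "S" => HopfAlgebra.antipode k (A := A)

/-- `π : A → A'` is the quotient of `A` by the central group-like elements `ζ z`, which form a
finite linearly independent group. -/
structure IsCentralExt {Z : Type*} [Fintype Z] (π : A →ₐc[k] A') (ζ : Z → A) : Prop where
  surjective : Function.Surjective π
  groupLike : ∀ z, IsGroupLikeElem k (ζ z)
  central : ∀ z a, ζ z * a = a * ζ z
  ker_le : ∀ a, π a = 0 → a ∈ Submodule.span k {x | ∃ b z, b * ζ z - b = x}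
  mul_sum : ∀ z, ζ z * ∑ w, ζ w = ∑ w, ζ w
  exists_dual : ∃ δ : A →ₗ[k] k, ∑ w, δ (ζ w) • ζ w = 1

/-- φ(a₁z)S(a₂z) = φ(a₁)zS(z)S(a₂): the two factors meet in the middle, so z need not be central. -/
theorem conv_antipode_mul_groupLike {z : A} (hz : IsGroupLikeElem k z)
    {φ : A →ₗ[k] A} (hφ : ∀ a, φ (a * z) = φ a * z) (a : A) :
    conv φ S (a * z) = conv φ S a := by
  rw [conv_apply, conv_apply, Bialgebra.comul_mul, hz.comul_eq_tmul_self]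
  generalize (Coalgebra.comul a : A ⊗[k] A) = X
  induction X with
  | zero => simp
  | add x y hx hy => simp only [map_add, add_mul, hx, hy]
  | tmul x y =>
    simp only [Algebra.TensorProduct.tmul_mul_tmul, TensorProduct.map_tmul,
      LinearMap.mul'_apply, hφ, HopfAlgebra.antipode_mul_antidistrib]
    rw [mul_assoc, ← mul_assoc z, hz.mul_antipode_cancel, one_mul]

/-- In S(z)S(a₁)xa₂z the factors S(z) and z are at the two ends, and centrality of z brings them
together. -/
theorem adr_mul_groupLike {z : A} (hz : IsGroupLikeElem k z) (hc : ∀ a, z * a = a * z)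
    (x a : A) : adr k x (a * z) = adr k x a := by
  rw [adr, conv_apply, conv_apply, Bialgebra.comul_mul, hz.comul_eq_tmul_self]
  generalize (Coalgebra.comul a : A ⊗[k] A) = X
  induction X with
  | zero => simp
  | add x y hx hy => simp only [map_add, add_mul, hx, hy]
  | tmul b c =>
    simp only [Algebra.TensorProduct.tmul_mul_tmul, TensorProduct.map_tmul,
      LinearMap.mul'_apply, HopfAlgebra.antipode_mul_antidistrib, LinearMap.mulLeft_apply]
    rw [← hc c, ← mul_assoc x, ← hc x, mul_assoc z, mul_assoc, ← mul_assoc (HopfAlgebra.antipode k b),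
      ← hc, ← mul_assoc, ← mul_assoc, ← mul_assoc (HopfAlgebra.antipode k z),
      hz.antipode_mul_cancel, one_mul, mul_assoc]

theorem rhit_mul_groupLike {z : A} (hz : IsGroupLikeElem k z) {g : A →ₗ[k] k}
    (hg : ∀ a, g (a * z) = g a) (a : A) : rhit g (a * z) = rhit g a * z := by
  unfold rhit
  simp only [LinearMap.comp_apply]
  rw [Bialgebra.comul_mul, hz.comul_eq_tmul_self]
  generalize (Coalgebra.comul a : A ⊗[k] A) = X
  induction X with
  | zero => simp
  | add x y hx hy => simp only [map_add, add_mul, hx, hy]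
  | tmul b c => simp [hg]

namespace IsCentralExt

variable {Z : Type*} [Fintype Z] {π : A →ₐc[k] A'} {ζ : Z → A} (hπ : IsCentralExt π ζ)
include hπ

theorem exists_factor {M : Type*} [AddCommGroup M] [Module k M] {F : A →ₗ[k] M}
    (hF : ∀ z a, F (a * ζ z) = F a) : ∃ f : A' →ₗ[k] M, F = f ∘ₗ π.lin := by
  obtain ⟨σ, hσ⟩ := π.lin.exists_rightInverse_of_surjective
    (LinearMap.range_eq_top.2 hπ.surjective)
  refine ⟨F ∘ₗ σ, ?_⟩
  ext a
  have h1 : π (a - σ (π a)) = 0 := by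
    rw [map_sub, sub_eq_zero]
    exact (LinearMap.congr_fun hσ (π a)).symm
  have h2 : Submodule.span k {x | ∃ b z, b * ζ z - b = x} ≤ LinearMap.ker F := by
    rw [Submodule.span_le]
    rintro _ ⟨b, z, rfl⟩
    simp [hF]
  have h3 := h2 (hπ.ker_le _ h1)
  rw [LinearMap.mem_ker, map_sub, sub_eq_zero] at h3
  exact h3

end IsCentralExt

/-- Passing to the quotient by central group-likes in the right leg of a bicharacter gives a
normal sub-bialgebra with cocommutative quotient. -/
theorem IsBichar.cocommStep {B : Type*} [Ring B] [HopfAlgebra k B] {s t : B ⊗[k] A}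
    (h : IsBichar s t) [FiniteDimensional k A] {Z : Type*} [Fintype Z] {π : A →ₐc[k] A'}
    {ζ : Z → A} (hπ : IsCentralExt π ζ) (hone : ∀ z, π (ζ z) = 1) :
    CocommStep h.legs (h.map_right π).legs := by
  have : FiniteDimensional k A' := Module.Finite.of_surjective π.lin hπ.surjective
  -- The functional f ∘ (φ * S) is invariant under a ↦ aζ(z), hence factors through π, and the leg
  -- is one of the smaller algebra. `adr_leg` and `adc_leg` have this shape, with φ a slice by a
  -- functional pulled back from A', respectively right multiplication by a fixed element.
  have key : ∀ (f : A →ₗ[k] k) (φ : A →ₗ[k] A), (∀ z a, φ (a * ζ z) = φ a * ζ z) →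
      leg s (f ∘ₗ conv φ S) ∈ (h.map_right π).legs := by
    intro f φ hφ
    obtain ⟨f', hf'⟩ := hπ.exists_factor (F := f ∘ₗ conv φ S) fun z a => by
      rw [LinearMap.comp_apply, conv_antipode_mul_groupLike (hπ.groupLike z) (hφ z),
        LinearMap.comp_apply]
    exact ⟨f', by rw [leg_lTensor, ← hf']⟩
  refine ⟨?_, (h.map_right π).legs_isSubcoalgebra, ?_, ?_⟩
  · rintro _ ⟨f, rfl⟩
    exact ⟨f ∘ₗ π.lin, by rw [leg_lTensor]⟩
  · rintro a ha _ ⟨g, rfl⟩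
    obtain ⟨f, rfl⟩ := h.mem_legs_iff.1 ha
    rw [leg_lTensor, h.adr_leg]
    exact key _ _ fun z a => rhit_mul_groupLike (hπ.groupLike z) (fun b => by simp [hone]) a
  · intro a ha g
    obtain ⟨f, rfl⟩ := h.mem_legs_iff.1 ha
    rw [h.adc_leg]
    exact key _ _ fun z a => by simp only [LinearMap.mulRight_apply, mul_assoc, hπ.central]

end CentralExtension

/-! ### Pulling a chain back along a central quotient by means of the braiding -/

section Pullback

variable {k : Type u} [Field k]
variable {A : Type*} [Ring A] [HopfAlgebra k A]
variable {A' : Type*} [Ring A'] [HopfAlgebra k A']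

local notation "S" => HopfAlgebra.antipode k (A := A)

variable (k A) in
/-- `L ⊗ A` as a subalgebra of `A' ⊗ A`. -/
def tensorRight (L : Subalgebra k A') : Subalgebra k (A' ⊗[k] A) :=
  (Algebra.TensorProduct.map L.val (AlgHom.id k A)).range

theorem conv_add_right {C : Type*} [Ring C] [Algebra k C] (φ ψ ψ' : A →ₗ[k] C) :
    conv φ (ψ + ψ') = conv φ ψ + conv φ ψ' := by
  simp only [conv, TensorProduct.map_add_right, LinearMap.add_comp, LinearMap.comp_add]

theorem conv_smul_right {C : Type*} [Ring C] [Algebra k C] (c : k) (φ ψ : A →ₗ[k] C) :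
    conv φ (c • ψ) = c • conv φ ψ := by
  simp only [conv, TensorProduct.map_smul_right, LinearMap.smul_comp, LinearMap.comp_smul]

theorem mulLeft_add {C : Type*} [Ring C] [Algebra k C] (x y : C) :
    LinearMap.mulLeft k (x + y) = LinearMap.mulLeft k x + LinearMap.mulLeft k y :=
  map_add (LinearMap.mul k C) x y

theorem mulLeft_smul {C : Type*} [Ring C] [Algebra k C] (c : k) (x : C) :
    LinearMap.mulLeft k (c • x) = c • LinearMap.mulLeft k x :=
  map_smul (LinearMap.mul k C) c x

theorem mulRight_add {C : Type*} [Ring C] [Algebra k C] (x y : C) :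
    LinearMap.mulRight k (x + y) = LinearMap.mulRight k x + LinearMap.mulRight k y :=
  map_add (LinearMap.mul k C).flip x y

theorem mulRight_smul {C : Type*} [Ring C] [Algebra k C] (c : k) (x : C) :
    LinearMap.mulRight k (c • x) = c • LinearMap.mulRight k x :=
  map_smul (LinearMap.mul k C).flip c x

theorem tmul_mem_tensorRight {L : Subalgebra k A'} {x : A'} (hx : x ∈ L) (y : A) :
    x ⊗ₜ y ∈ tensorRight k A L := ⟨⟨x, hx⟩ ⊗ₜ y, by simp⟩

theorem tensorRight_induction {L : Subalgebra k A'} {M : Type*} [AddCommGroup M] [Module k M]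
    {F : A' ⊗[k] A →ₗ[k] M} {W : Submodule k M} (hF : ∀ x ∈ L, ∀ y, F (x ⊗ₜ y) ∈ W)
    {X : A' ⊗[k] A} (hX : X ∈ tensorRight k A L) : F X ∈ W := by
  obtain ⟨z, rfl⟩ := hX
  induction z with
  | zero => simp
  | add a b ha hb => simpa only [map_add] using W.add_mem ha hb
  | tmul a b => exact hF _ a.2 b

theorem tensorRight_mono {L L' : Subalgebra k A'} (h : L ≤ L') :
    tensorRight k A L ≤ tensorRight k A L' := fun _ hX =>
  tensorRight_induction (F := LinearMap.id) (W := Subalgebra.toSubmodule (tensorRight k A L'))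
    (fun _ hx y => tmul_mem_tensorRight (h hx) y) hX

theorem lTensor_mem_tensorRight {L : Subalgebra k A'} (φ : A →ₗ[k] A) {X : A' ⊗[k] A}
    (hX : X ∈ tensorRight k A L) : φ.lTensor A' X ∈ tensorRight k A L :=
  tensorRight_induction (F := φ.lTensor A') (W := Subalgebra.toSubmodule (tensorRight k A L))
    (fun _ hx y => tmul_mem_tensorRight hx (φ y)) hX

/-- The algebra map `a ↦ π(a₁) ⊗ a₂`. -/
def coact (π : A →ₐc[k] A') : A →ₐ[k] A' ⊗[k] A :=
  (Algebra.TensorProduct.map (π : A →ₐ[k] A') (AlgHom.id k A)).comp (Bialgebra.comulAlgHom k A)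

/-- The preimage of `L ⊗ A` under `a ↦ π(a₁) ⊗ a₂`. -/
def comapSub (π : A →ₐc[k] A') (L : Subalgebra k A') : Subalgebra k A :=
  (tensorRight k A L).comap (coact π)

theorem rTensor_comp_comul (φ : A →ₗ[k] A) :
    φ.rTensor A ∘ₗ Coalgebra.comul = conv (inl k A A ∘ₗ φ) (inr k A A) := by
  ext a
  simp only [conv, LinearMap.comp_apply]
  generalize (Coalgebra.comul a : A ⊗[k] A) = X
  induction X with
  | zero => simp
  | add x y hx hy => simp only [map_add, hx, hy]
  | tmul x y => simp

theorem comul_rhit (g : A →ₗ[k] k) (a : A) : Coalgebra.comul (R := k) (rhit g a) =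
    (rhit g).lTensor A (Coalgebra.comul (R := k) a) := by
  have h : (Coalgebra.comul : A →ₗ[k] A ⊗[k] A) ∘ₗ rhit g =
      (rhit g).lTensor A ∘ₗ Coalgebra.comul := by
    rw [lTensor_comp_comul, ← conv_linearMap_right, ← conv_linearMap_right, ← conv_assoc,
      ← comul_eq_conv]
  exact LinearMap.congr_fun h a

theorem comul_lhit (g : A →ₗ[k] k) (a : A) : Coalgebra.comul (R := k) (lhit g a) =
    (lhit g).rTensor A (Coalgebra.comul (R := k) a) := by
  have h : (Coalgebra.comul : A →ₗ[k] A ⊗[k] A) ∘ₗ lhit g =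
      (lhit g).rTensor A ∘ₗ Coalgebra.comul := by
    rw [rTensor_comp_comul, ← conv_linearMap_left, ← conv_linearMap_left, conv_assoc,
      ← comul_eq_conv]
  exact LinearMap.congr_fun h a

theorem apply_mem_of_mem_comapSub {π : A →ₐc[k] A'} {L : Subalgebra k A'} {a : A}
    (ha : a ∈ comapSub π L) : π a ∈ L := by
  have h1 : TensorProduct.rid k A' ((Coalgebra.counit (R := k)).lTensor A' (coact π a)) ∈ L :=
    tensorRight_induction (F := (TensorProduct.rid k A').toLinearMap ∘ₗ
      (Coalgebra.counit (R := k)).lTensor A') (W := Subalgebra.toSubmodule L)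
      (fun x hx y => by simpa using L.smul_mem hx _) ha
  have h2 : ∀ X : A ⊗[k] A, TensorProduct.rid k A' ((Coalgebra.counit (R := k)).lTensor A'
      (Algebra.TensorProduct.map (π : A →ₐ[k] A') (AlgHom.id k A) X)) =
      π (TensorProduct.rid k A ((Coalgebra.counit (R := k)).lTensor A X)) := by
    intro X
    induction X with
    | zero => simp
    | add x y hx hy => simp only [map_add, hx, hy]
    | tmul x y => simp
  have h3 := h2 (Coalgebra.comul (R := k) a)
  rw [Coalgebra.lTensor_counit_comul] at h3
  rw [show coact π a = Algebra.TensorProduct.map (π : A →ₐ[k] A') (AlgHom.id k A)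
    (Coalgebra.comul (R := k) a) from rfl, h3] at h1
  simpa using h1

theorem comapSub_mono {π : A →ₐc[k] A'} {L L' : Subalgebra k A'} (h : L ≤ L') :
    comapSub π L ≤ comapSub π L' := fun _ ha => tensorRight_mono h ha

theorem comapSub_top (π : A →ₐc[k] A') : comapSub π ⊤ = ⊤ := by
  refine eq_top_iff.2 fun a _ => ?_
  change coact π a ∈ tensorRight k A ⊤
  generalize coact π a = X
  induction X with
  | zero => exact Subalgebra.zero_mem _
  | add x y hx hy => exact Subalgebra.add_mem _ hx hy
  | tmul x y => exact tmul_mem_tensorRight Algebra.mem_top y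

theorem le_comapSub_map (π : A →ₐc[k] A') {T : Subalgebra k A} (hT : T.IsSubcoalgebra) :
    T ≤ comapSub π (T.map (π : A →ₐ[k] A')) := by
  intro a ha
  obtain ⟨z, hz⟩ := hT a ha
  change Algebra.TensorProduct.map (π : A →ₐ[k] A') (AlgHom.id k A)
    (Coalgebra.comul (R := k) a) ∈ tensorRight k A _
  rw [← hz]
  generalize z = z
  induction z with
  | zero => simp
  | add x y hx hy => simpa only [map_add] using Subalgebra.add_mem _ hx hy
  | tmul x y =>
    have h1 : (π : A →ₐ[k] A') (x : A) ∈ T.map (π : A →ₐ[k] A') :=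
      Subalgebra.mem_map.2 ⟨x, x.2, rfl⟩
    rw [TensorProduct.map_tmul, Algebra.TensorProduct.map_tmul]
    exact tmul_mem_tensorRight h1 (y : A)

theorem Subalgebra.IsSubcoalgebra.map {T : Subalgebra k A} (hT : T.IsSubcoalgebra)
    (π : A →ₐc[k] A') : (T.map (π : A →ₐ[k] A')).IsSubcoalgebra := by
  refine Subalgebra.IsSubcoalgebra.of_hit ?_ ?_ <;> rintro g _ ⟨x, hx, rfl⟩
  · exact ⟨_, hT.lhit_mem (g ∘ₗ π.lin) hx, bialgHom_lhit π g x⟩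
  · exact ⟨_, hT.rhit_mem (g ∘ₗ π.lin) hx, bialgHom_rhit π g x⟩

theorem map_mem_tensorRight {T : Subalgebra k A} {π : A →ₐc[k] A'} {L : Subalgebra k A'}
    (hL : T.map (π : A →ₐ[k] A') ≤ L) {X : A ⊗[k] A} (hX : X ∈ tensorRight k A T) :
    Algebra.TensorProduct.map (π : A →ₐ[k] A') (AlgHom.id k A) X ∈ tensorRight k A L :=
  tensorRight_induction (F := (Algebra.TensorProduct.map (π : A →ₐ[k] A')
    (AlgHom.id k A)).toLinearMap) (W := Subalgebra.toSubmodule (tensorRight k A L))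
    (fun x hx y => tmul_mem_tensorRight (hL (Subalgebra.mem_map.2 ⟨x, hx, rfl⟩)) y) hX

/-- `t` is invertible with inverse `s`, intertwines `Δ` and `Δᵒᵖ`, and `s, t ∈ T ⊗ A` for the
sub-bialgebra `T`. -/
structure BraidedBy (s t : A ⊗[k] A) (T : Subalgebra k A) : Prop where
  sub : T.IsSubcoalgebra
  inv_mul : s * t = 1
  mul_inv : t * s = 1
  braid : ∀ a : A, t * Coalgebra.comul (R := k) a =
    Algebra.TensorProduct.comm k A A (Coalgebra.comul (R := k) a) * t
  left_mem : s ∈ tensorRight k A T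
  right_mem : t ∈ tensorRight k A T

namespace BraidedBy

variable {s t : A ⊗[k] A} {T : Subalgebra k A} (h : BraidedBy s t T)
include h

theorem comm_comul (a : A) : Algebra.TensorProduct.comm k A A (Coalgebra.comul (R := k) a) =
    t * Coalgebra.comul (R := k) a * s := by
  rw [h.braid, mul_assoc, h.mul_inv, mul_one]

/-- The images of s and t lie in the subalgebra L ⊗ A, so conjugating by them does not affect
membership, and t conjugates Δ into Δᵒᵖ. This removes the left-right asymmetry in the definition of
`comapSub`. -/
theorem mem_comapSub_iff {π : A →ₐc[k] A'} {L : Subalgebra k A'}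
    (hL : T.map (π : A →ₐ[k] A') ≤ L) {a : A} : a ∈ comapSub π L ↔
    Algebra.TensorProduct.map (π : A →ₐ[k] A') (AlgHom.id k A)
      (Algebra.TensorProduct.comm k A A (Coalgebra.comul (R := k) a)) ∈ tensorRight k A L := by
  have hs := map_mem_tensorRight hL h.left_mem
  have ht := map_mem_tensorRight hL h.right_mem
  constructor
  · intro ha
    rw [h.comm_comul, map_mul, map_mul]
    exact mul_mem (mul_mem ht ha) hs
  · intro ha
    have e : Coalgebra.comul (R := k) a =
        s * Algebra.TensorProduct.comm k A A (Coalgebra.comul (R := k) a) * t := by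
      rw [mul_assoc, ← h.braid, ← mul_assoc, h.inv_mul, one_mul]
    change Algebra.TensorProduct.map (π : A →ₐ[k] A') (AlgHom.id k A)
      (Coalgebra.comul (R := k) a) ∈ tensorRight k A L
    rw [e, map_mul, map_mul]
    exact mul_mem (mul_mem hs ha) ht

/-- A right slice of a changes only the second leg of π(a₁) ⊗ a₂. A left slice changes only the
second leg of π(a₂) ⊗ a₁, and `mem_comapSub_iff` allows membership to be tested there. -/
theorem comapSub_isSubcoalgebra {π : A →ₐc[k] A'} {L : Subalgebra k A'}
    (hL : T.map (π : A →ₐ[k] A') ≤ L) : (comapSub π L).IsSubcoalgebra := by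
  have e : ∀ (φ : A →ₗ[k] A) (X : A ⊗[k] A),
      Algebra.TensorProduct.map (π : A →ₐ[k] A') (AlgHom.id k A) (φ.lTensor A X) =
      φ.lTensor A' (Algebra.TensorProduct.map (π : A →ₐ[k] A') (AlgHom.id k A) X) := by
    intro φ X
    induction X with
    | zero => simp
    | add x y hx hy => simp only [map_add, hx, hy]
    | tmul x y => simp
  have e' : ∀ (φ : A →ₗ[k] A) (X : A ⊗[k] A), Algebra.TensorProduct.comm k A A
      (φ.rTensor A X) = φ.lTensor A (Algebra.TensorProduct.comm k A A X) := by
    intro φ X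
    induction X with
    | zero => simp
    | add x y hx hy => simp only [map_add, hx, hy]
    | tmul x y => simp
  refine Subalgebra.IsSubcoalgebra.of_hit ?_ ?_ <;> intro g a ha
  · rw [h.mem_comapSub_iff hL] at ha ⊢
    rw [comul_lhit, e', e]
    exact lTensor_mem_tensorRight _ ha
  · change Algebra.TensorProduct.map (π : A →ₐ[k] A') (AlgHom.id k A)
      (Coalgebra.comul (R := k) (rhit g a)) ∈ tensorRight k A L
    rw [comul_rhit, e]
    exact lTensor_mem_tensorRight _ ha

/-- Replacing π(x₁) ⊗ x₂ by a tensor l ⊗ y with l ∈ L, the coaction of S(a₁)xa₂ becomes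
S(π(a₂))lπ(a₃) ⊗ S(a₁)ya₄. The first leg is `adr` of l by the image of a middle component of a. That
component stays in the preimage of K, which is a subcoalgebra. -/
theorem adr_mem_comapSub {π : A →ₐc[k] A'} {K L : Subalgebra k A'}
    (hL : T.map (π : A →ₐ[k] A') ≤ L) (hKL : CocommStep K L) {a x : A}
    (ha : a ∈ comapSub π K) (hx : x ∈ comapSub π L) : adr k x a ∈ comapSub π L := by
  have hK := h.comapSub_isSubcoalgebra (hL.trans hKL.le)
  let ρ := (coact π).toLinearMap
  let i₁ : A' →ₐ[k] A' ⊗[k] A := Algebra.TensorProduct.includeLeft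
  -- F is the adjoint action of a with the coaction of x replaced by a free tensor X, so that
  -- linearity reduces the claim to X = l ⊗ y.
  let F : A' ⊗[k] A →ₗ[k] A' ⊗[k] A :=
    { toFun := fun X => conv (ρ ∘ₗ S) (LinearMap.mulLeft k X ∘ₗ ρ) a
      map_add' := fun X Y => by
        rw [mulLeft_add, LinearMap.add_comp, conv_add_right, LinearMap.add_apply]
      map_smul' := fun c X => by
        rw [mulLeft_smul, LinearMap.smul_comp, conv_smul_right, LinearMap.smul_apply]; rfl }
  have hρ : ρ = conv (i₁.toLinearMap ∘ₗ π.lin) (inr k A A') := by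
    have := comp_conv (Algebra.TensorProduct.map (π : A →ₐ[k] A') (AlgHom.id k A))
      (inl k A A) (inr k A A)
    rw [← comul_eq_conv] at this
    refine this.trans ?_
    congr 1
    ext; simp
  have hρS : ρ ∘ₗ S = conv (inr k A A' ∘ₗ S) (i₁.toLinearMap ∘ₗ π.lin ∘ₗ S) := by
    have := comp_conv (Algebra.TensorProduct.map (π : A →ₐ[k] A') (AlgHom.id k A))
      (inr k A A ∘ₗ S) (inl k A A ∘ₗ S)
    rw [← comul_comp_antipode] at this
    refine this.trans ?_
    congr 1
    ext; simp
  have hF : F (coact π x) = coact π (adr k x a) := by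
    have := LinearMap.congr_fun (comp_conv (coact π) S (LinearMap.mulLeft k x)) a
    refine Eq.trans ?_ this.symm
    change conv (ρ ∘ₗ S) (LinearMap.mulLeft k (coact π x) ∘ₗ ρ) a = conv _ _ a
    congr 2
    ext b
    simp [ρ]
  change coact π (adr k x a) ∈ tensorRight k A L
  rw [← hF]
  refine tensorRight_induction (W := Subalgebra.toSubmodule (tensorRight k A L)) ?_ hx
  intro l hl y
  change conv (ρ ∘ₗ S) (LinearMap.mulLeft k (l ⊗ₜ y) ∘ₗ ρ) a ∈ tensorRight k A L
  -- The two inner factors of the four-fold convolution collapse to the adjoint action on l.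
  have hχ : conv (i₁.toLinearMap ∘ₗ π.lin ∘ₗ S)
      (LinearMap.mulLeft k (l ⊗ₜ y) ∘ₗ i₁.toLinearMap ∘ₗ π.lin) =
      LinearMap.mulRight k (1 ⊗ₜ y) ∘ₗ i₁.toLinearMap ∘ₗ adr k l ∘ₗ π.lin := by
    rw [adr, conv_comp_bialgHom, comp_conv, mulRight_comp_conv, bialgHom_comp_antipode]
    congr 1
    ext b
    simp [i₁]
  rw [hρS, hρ, mulLeft_comp_conv, conv_assoc, ← conv_assoc (i₁.toLinearMap ∘ₗ π.lin ∘ₗ S), hχ]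
  refine hK.conv_mem (fun b _ => tmul_mem_tensorRight (one_mem L) _) (fun b hb =>
    hK.conv_mem (fun c hc => ?_) (fun c _ => tmul_mem_tensorRight (one_mem L) _) hb) ha
  have := tmul_mem_tensorRight
    (hKL.adr_mem _ (apply_mem_of_mem_comapSub hc) _ hl) y
  simpa [i₁] using this

/-- Stability under the adjoint action implies stability of the coadjoint coefficients. -/
theorem adc_mem {K L : Subalgebra k A} (hTL : T ≤ L) (hK : K.IsSubcoalgebra)
    (hadr : ∀ a ∈ K, ∀ x ∈ L, adr k x a ∈ L) (g : A →ₗ[k] k) {a : A} (ha : a ∈ K) :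
    adc g a ∈ L := by
  have h1 : ∀ X : A ⊗[k] A, TensorProduct.lid k A (g.rTensor A X) =
      leg (Algebra.TensorProduct.comm k A A X) g := by
    intro X
    unfold leg
    induction X with
    | zero => simp
    | add x y hx hy => simp only [map_add, hx, hy]
    | tmul x y => simp
  let N (u v : A ⊗[k] A) : A →ₗ[k] A := (TensorProduct.rid k A).toLinearMap ∘ₗ g.lTensor A ∘ₗ
    LinearMap.mulLeft k u ∘ₗ LinearMap.mulRight k v ∘ₗ Coalgebra.comul
  -- g(a₁)a₂ is a right slice of Δᵒᵖ(a) = tΔ(a)s.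
  have h2 : lhit g = N t s := by
    ext a
    refine (h1 _).trans ?_
    rw [h.comm_comul, mul_assoc]
    rfl
  -- For t = τ ⊗ y and s = σ ⊗ z the coefficient is S(a₁)τa₂ · g(ya₃z) · σ: the adjoint action of a
  -- right slice of a on τ ∈ T, times σ ∈ T. The bilinear map `F` below extends this to general t
  -- and s.
  have h3 : ∀ (τ σ y z : A), conv S (N (τ ⊗ₜ y) (σ ⊗ₜ z)) = LinearMap.mulRight k σ ∘ₗ adr k τ ∘ₗ
      rhit (g ∘ₗ LinearMap.mulLeft k y ∘ₗ LinearMap.mulRight k z) := by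
    intro τ σ y z
    rw [adr, ← conv_linearMap_right, conv_assoc, conv_linearMap_right, mulRight_comp_conv]
    congr 1
    ext b
    simp only [N, rhit, LinearMap.comp_apply]
    generalize (Coalgebra.comul b : A ⊗[k] A) = X
    induction X with
    | zero => simp
    | add x y hx hy => simp only [map_add, hx, hy]
    | tmul x y => simp [mul_assoc]
  let F : A ⊗[k] A →ₗ[k] A ⊗[k] A →ₗ[k] A := LinearMap.mk₂ k (fun u v => conv S (N u v) a)
    (fun u u' v => by
      simp only [N, mulLeft_add, LinearMap.add_comp, LinearMap.comp_add, conv_add_right,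
        LinearMap.add_apply])
    (fun c u v => by
      simp only [N, mulLeft_smul, LinearMap.smul_comp, LinearMap.comp_smul, conv_smul_right,
        LinearMap.smul_apply])
    (fun u v v' => by
      simp only [N, mulRight_add, LinearMap.add_comp, LinearMap.comp_add, conv_add_right,
        LinearMap.add_apply])
    (fun c u v => by
      simp only [N, mulRight_smul, LinearMap.smul_comp, LinearMap.comp_smul, conv_smul_right,
        LinearMap.smul_apply])
  rw [adc, h2]
  change F t s ∈ Subalgebra.toSubmodule L
  refine tensorRight_induction (F := F.flip s) (fun τ hτ y => ?_) h.right_mem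
  change F (τ ⊗ₜ y) s ∈ Subalgebra.toSubmodule L
  refine tensorRight_induction (F := F (τ ⊗ₜ y)) (fun σ hσ z => ?_) h.left_mem
  change conv S (N (τ ⊗ₜ y) (σ ⊗ₜ z)) a ∈ L
  rw [h3]
  exact L.mul_mem (hadr _ (hK.rhit_mem _ ha) _ (hTL hτ)) (hTL hσ)

theorem cocommStep_comapSub {π : A →ₐc[k] A'} {K L : Subalgebra k A'}
    (hL : T.map (π : A →ₐ[k] A') ≤ L) (hKL : CocommStep K L) :
    CocommStep (comapSub π K) (comapSub π L) where
  le := comapSub_mono hKL.le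
  sub := h.comapSub_isSubcoalgebra hL
  adr_mem _ ha _ hx := h.adr_mem_comapSub hL hKL ha hx
  adc_mem _ ha g := h.adc_mem ((le_comapSub_map π h.sub).trans (comapSub_mono hL))
    (h.comapSub_isSubcoalgebra (hL.trans hKL.le))
    (fun _ ha _ hx => h.adr_mem_comapSub hL hKL ha hx) g ha

end BraidedBy

/-- Put e = ∑ ζ(w). Right multiplication by e factors through π, so the hypothesis places a₁e ⊗ a₂
in Te ⊗ A. The map F(b ⊗ c) = b₁δ(b₂S(c)) recovers a from a₁e ⊗ a₂, because the result is a ∑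
δ(ζ(w))ζ(w) = a. It also sends Te ⊗ A into ∑ Tζ(w). -/
theorem IsCentralExt.comapSub_map_le {Z : Type*} [Fintype Z] {π : A →ₐc[k] A'} {ζ : Z → A}
    (hπ : IsCentralExt π ζ) {T : Subalgebra k A} (hT : T.IsSubcoalgebra) {a : A}
    (ha : a ∈ comapSub π (T.map (π : A →ₐ[k] A'))) :
    a ∈ Submodule.span k {x | ∃ τ ∈ T, ∃ z, τ * ζ z = x} := by
  obtain ⟨δ, hδ⟩ := hπ.exists_dual
  set e := ∑ w, ζ w with he
  obtain ⟨φ, hφ⟩ := hπ.exists_factor (F := LinearMap.mulRight k e) fun z b => by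
    simp only [LinearMap.mulRight_apply, mul_assoc, he, hπ.mul_sum]
  let E : A ⊗[k] A →ₗ[k] A ⊗[k] A := LinearMap.mul' k (A ⊗[k] A) ∘ₗ
    TensorProduct.map Coalgebra.comul (inr k A A ∘ₗ S)
  let F : A ⊗[k] A →ₗ[k] A := (TensorProduct.rid k A).toLinearMap ∘ₗ δ.lTensor A ∘ₗ E
  -- E(b ⊗ c) = b₁ ⊗ b₂S(c), so on Δ(b) the last two components cancel.
  have hE : ∀ b, E (Coalgebra.comul (R := k) b) = b ⊗ₜ 1 := by
    intro b
    have : conv (Coalgebra.comul (R := k)) (inr k A A ∘ₗ S) = inl k A A := by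
      rw [comul_eq_conv, conv_assoc, conv_algHom_comp_antipode, conv_convUnit]
    exact LinearMap.congr_fun this b
  have hF1 : ∀ b c, F ((b * e) ⊗ₜ c) =
      ∑ w, leg (E (b ⊗ₜ c)) (δ ∘ₗ LinearMap.mulRight k (ζ w)) * ζ w := by
    intro b c
    simp only [F, E, LinearMap.comp_apply, TensorProduct.map_tmul, LinearMap.mul'_apply,
      Bialgebra.comul_mul, he, map_sum, (hπ.groupLike _).comul_eq_tmul_self, Finset.mul_sum,
      Finset.sum_mul]
    refine Finset.sum_congr rfl fun w _ => ?_
    generalize (Coalgebra.comul b : A ⊗[k] A) = X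
    unfold leg
    induction X with
    | zero => simp
    | add x y hx hy => simp only [map_add, add_mul, hx, hy]
    | tmul x y => simp [mul_assoc, hπ.central]
  have hF2 : ∀ X : A ⊗[k] A, F (X * (e ⊗ₜ 1)) =
      ∑ w, leg (E X) (δ ∘ₗ LinearMap.mulRight k (ζ w)) * ζ w := by
    intro X
    induction X with
    | zero => simp [leg]
    | add x y hx hy =>
      simp only [add_mul, map_add, hx, hy, leg, Finset.sum_add_distrib]
    | tmul x y => simpa using hF1 x y
  have hF3 : F (Coalgebra.comul (R := k) a * (e ⊗ₜ 1)) = a := by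
    rw [hF2, hE]
    calc _ = a * ∑ w, δ (ζ w) • ζ w := by
          rw [Finset.mul_sum]
          refine Finset.sum_congr rfl fun w _ => ?_
          simp [leg]
      _ = a := by rw [hδ, mul_one]
  have h4 : ∀ X : A ⊗[k] A, φ.rTensor A
      (Algebra.TensorProduct.map (π : A →ₐ[k] A') (AlgHom.id k A) X) = X * (e ⊗ₜ 1) := by
    intro X
    induction X with
    | zero => simp
    | add x y hx hy => simp only [map_add, add_mul, hx, hy]
    | tmul x y =>
      have : φ (π x) = x * e := (LinearMap.congr_fun hφ x).symm
      simp [this]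
  rw [← hF3, ← h4]
  refine tensorRight_induction (F := F ∘ₗ φ.rTensor A) ?_ ha
  rintro _ ⟨τ, hτ, rfl⟩ y
  have : φ (π τ) = τ * e := (LinearMap.congr_fun hφ τ).symm
  change F (φ (π τ) ⊗ₜ y) ∈ _
  rw [this, hF1]
  refine Submodule.sum_mem _ fun w _ => Submodule.subset_span ⟨_, ?_, w, rfl⟩
  obtain ⟨X, hX⟩ := hT τ hτ
  simp only [E, LinearMap.comp_apply, TensorProduct.map_tmul, LinearMap.mul'_apply, ← hX]
  unfold leg
  generalize X = X
  induction X with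
  | zero => simp
  | add x y hx hy => simpa only [map_add, add_mul] using T.add_mem hx hy
  | tmul x y => simpa using T.smul_mem x.2 _

variable (k) in
/-- A chain of steps between sub-bialgebras containing `T`. -/
def ChainOver (T : Subalgebra k A) : Subalgebra k A → Subalgebra k A → Prop :=
  Relation.ReflTransGen fun K L => CocommStep K L ∧ T ≤ L

/-- The pulled-back chain ends at the preimage of π(T), which is spanned by elements τζ(z) with τ ∈
T. The central ζ(z) does not affect the adjoint action, so T is stable under that preimage simply
because T is a Hopf subalgebra. The coadjoint coefficients then come from the braiding. -/
theorem BraidedBy.chainOver {s t : A ⊗[k] A} {T : Subalgebra k A} (h : BraidedBy s t T)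
    [FiniteDimensional k A] {Z : Type*} [Fintype Z] {π : A →ₐc[k] A'} {ζ : Z → A}
    (hπ : IsCentralExt π ζ)
    (hc : ChainOver k (T.map (π : A →ₐ[k] A')) ⊤ (T.map (π : A →ₐ[k] A'))) :
    ChainOver k T ⊤ T := by
  have h1 : ChainOver k T (comapSub π ⊤) (comapSub π (T.map (π : A →ₐ[k] A'))) :=
    Relation.ReflTransGen.lift (r := fun K L => CocommStep K L ∧ T.map (π : A →ₐ[k] A') ≤ L)
      (p := fun K L => CocommStep K L ∧ T ≤ L) (comapSub π) (fun K L hKL =>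
        ⟨h.cocommStep_comapSub hKL.2 hKL.1,
          (le_comapSub_map π h.sub).trans (comapSub_mono hKL.2)⟩) _ _ hc
  rw [comapSub_top] at h1
  refine h1.tail ⟨?_, le_rfl⟩
  have hadr : ∀ a ∈ comapSub π (T.map (π : A →ₐ[k] A')), ∀ x ∈ T, adr k x a ∈ T := by
    intro a ha x hx
    have h2 : Submodule.span k {x | ∃ τ ∈ T, ∃ z, τ * ζ z = x} ≤
        (Subalgebra.toSubmodule T).comap (adr k x) := by
      rw [Submodule.span_le]
      rintro _ ⟨τ, hτ, z, rfl⟩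
      change adr k x (τ * ζ z) ∈ T
      rw [adr_mul_groupLike (hπ.groupLike z) (hπ.central z)]
      exact h.sub.conv_mem (fun y hy => h.sub.antipode_mem hy) (fun y hy => T.mul_mem hx hy) hτ
    exact h2 (hπ.comapSub_map_le h.sub ha)
  exact ⟨le_comapSub_map π h.sub, h.sub, hadr, fun a ha g =>
    h.adc_mem le_rfl (h.comapSub_isSubcoalgebra le_rfl) hadr g ha⟩

end Pullback

/-! ### The braiding J₂₁⁻¹J and its hexagon identities -/

section TwistBraiding

variable {k : Type u} {H : Type v} [Field k] [Ring H] [HopfAlgebra k H]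

namespace HopfTwist

local notation "c" => Algebra.TensorProduct.comm k H H

variable (k H) in
/-- `a ⊗ b ↦ a ⊗ 1 ⊗ b`. -/
def i13 : H ⊗[k] H →ₐ[k] H ⊗[k] (H ⊗[k] H) :=
  Algebra.TensorProduct.map (AlgHom.id k H) Algebra.TensorProduct.includeRight

variable (k H) in
/-- The permutation `x ⊗ y ⊗ z ↦ x ⊗ z ⊗ y`. -/
def swapRight : H ⊗[k] (H ⊗[k] H) →ₐ[k] H ⊗[k] (H ⊗[k] H) :=
  Algebra.TensorProduct.map (AlgHom.id k H) (c).toAlgHom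

variable (k H) in
/-- The permutation `x ⊗ y ⊗ z ↦ y ⊗ z ⊗ x`. -/
def rotate : H ⊗[k] (H ⊗[k] H) →ₐ[k] H ⊗[k] (H ⊗[k] H) :=
  (Algebra.TensorProduct.assoc k k k H H H).toAlgHom.comp
    (Algebra.TensorProduct.comm k H (H ⊗[k] H)).toAlgHom

variable (k H) in
/-- The permutation `x ⊗ y ⊗ z ↦ y ⊗ x ⊗ z`. -/
def swapLeft : H ⊗[k] (H ⊗[k] H) →ₐ[k] H ⊗[k] (H ⊗[k] H) :=
  (rotate k H).comp ((swapRight k H).comp ((rotate k H).comp (rotate k H)))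

@[simp] theorem swapRight_tmul (x y z : H) :
    swapRight k H (x ⊗ₜ (y ⊗ₜ z)) = x ⊗ₜ (z ⊗ₜ y) := by simp [swapRight]

@[simp] theorem rotate_tmul (x y z : H) : rotate k H (x ⊗ₜ (y ⊗ₜ z)) = y ⊗ₜ (z ⊗ₜ x) := by
  simp [rotate]

@[simp] theorem swapLeft_tmul (x y z : H) : swapLeft k H (x ⊗ₜ (y ⊗ₜ z)) = y ⊗ₜ (x ⊗ₜ z) := by
  simp [swapLeft]

@[simp] theorem i12_tmul (x y : H) : i12 k H (x ⊗ₜ y) = x ⊗ₜ (y ⊗ₜ 1) := by simp [i12]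

@[simp] theorem i23_tmul (x y : H) : i23 k H (x ⊗ₜ y) = 1 ⊗ₜ (x ⊗ₜ y) := by simp [i23]

@[simp] theorem i13_tmul (x y : H) : i13 k H (x ⊗ₜ y) = x ⊗ₜ (1 ⊗ₜ y) := by simp [i13]

theorem rotate_i12 : (rotate k H).comp (i12 k H) = (i13 k H).comp (c).toAlgHom := by ext <;> simp

theorem rotate_i23 : (rotate k H).comp (i23 k H) = i12 k H := by ext <;> simp

theorem rotate_i13 : (rotate k H).comp (i13 k H) = (i23 k H).comp (c).toAlgHom := by ext <;> simp

theorem swapRight_i12 : (swapRight k H).comp (i12 k H) = i13 k H := by ext <;> simp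

theorem swapRight_i23 : (swapRight k H).comp (i23 k H) = (i23 k H).comp (c).toAlgHom := by
  ext <;> simp

theorem swapLeft_i12 : (swapLeft k H).comp (i12 k H) = (i12 k H).comp (c).toAlgHom := by
  ext <;> simp

theorem swapLeft_i23 : (swapLeft k H).comp (i23 k H) = i13 k H := by ext <;> simp

theorem rotate_dRight : (rotate k H).comp (dRight k H) = (dLeft k H).comp (c).toAlgHom := by
  ext x
  · simp only [dRight, dLeft, rotate]
    simp [Algebra.TensorProduct.one_def]
  · simp only [dRight, dLeft, rotate]
    simp

theorem rotate_rotate_dLeft :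
    (rotate k H).comp ((rotate k H).comp (dLeft k H)) = (dRight k H).comp (c).toAlgHom := by
  have h : (rotate k H).comp ((rotate k H).comp (rotate k H)) = AlgHom.id k _ := by
    ext <;> simp [Algebra.TensorProduct.one_def]
  have h1 : (dLeft k H) = ((rotate k H).comp (dRight k H)).comp (c).toAlgHom := by
    rw [rotate_dRight]; ext <;> simp
  rw [h1, ← AlgHom.comp_assoc, ← AlgHom.comp_assoc, ← AlgHom.comp_assoc, AlgHom.comp_assoc _ _ (rotate k H), h]
  rfl

section Cocomm

variable [Coalgebra.IsCocomm k H]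

/-- The two legs produced by Δ may be exchanged. This is how cocommutativity enters the hexagons:
different permutations of the cocycle identity come to share a common factor. -/
theorem swapRight_dRight : (swapRight k H).comp (dRight k H) = dRight k H := by
  have : (c).toAlgHom.comp (Bialgebra.comulAlgHom k H) = Bialgebra.comulAlgHom k H :=
    AlgHom.ext fun x => Coalgebra.comm_comul k x
  rw [swapRight, dRight, ← Algebra.TensorProduct.map_comp, this, AlgHom.id_comp]

theorem swapLeft_dLeft : (swapLeft k H).comp (dLeft k H) = dLeft k H := by
  rw [swapLeft, AlgHom.comp_assoc, AlgHom.comp_assoc, AlgHom.comp_assoc, rotate_rotate_dLeft,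
    ← AlgHom.comp_assoc (swapRight k H), swapRight_dRight, ← AlgHom.comp_assoc, rotate_dRight]
  ext <;> simp

theorem rotate_dLeft : (rotate k H).comp (dLeft k H) = (swapRight k H).comp (dLeft k H) := by
  conv_lhs => rw [← swapLeft_dLeft, ← AlgHom.comp_assoc]
  congr 1
  ext <;> simp [Algebra.TensorProduct.one_def]

theorem rotate_rotate_dRight :
    (rotate k H).comp ((rotate k H).comp (dRight k H)) = (swapLeft k H).comp (dRight k H) := by
  conv_lhs => rw [← swapRight_dRight, ← AlgHom.comp_assoc, ← AlgHom.comp_assoc]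
  congr 1
  ext <;> simp [Algebra.TensorProduct.one_def]

end Cocomm

variable (J : HopfTwist k H)

/-- Used with f a permutation of the three legs; each hexagon combines the cocycle identity with two
permuted copies. -/
theorem cocycle_map (f : H ⊗[k] (H ⊗[k] H) →ₐ[k] H ⊗[k] (H ⊗[k] H)) :
    Units.map (f.comp (dLeft k H) : H ⊗[k] H →* H ⊗[k] (H ⊗[k] H)) J.elt *
      Units.map (f.comp (i12 k H) : H ⊗[k] H →* H ⊗[k] (H ⊗[k] H)) J.elt =
    Units.map (f.comp (dRight k H) : H ⊗[k] H →* H ⊗[k] (H ⊗[k] H)) J.elt *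
      Units.map (f.comp (i23 k H) : H ⊗[k] H →* H ⊗[k] (H ⊗[k] H)) J.elt := by
  have := congrArg (Units.map (f : H ⊗[k] (H ⊗[k] H) →* H ⊗[k] (H ⊗[k] H))) J.cocycle_units
  rw [map_mul, map_mul] at this
  exact this

/-- The braiding `J₂₁⁻¹ J`. -/
def braiding : H ⊗[k] H := c ↑J.elt⁻¹ * ↑J.elt

/-- The inverse `J⁻¹ J₂₁` of the braiding. -/
def braidingInv : H ⊗[k] H := ↑J.elt⁻¹ * c ↑J.elt

theorem braidingInv_mul : J.braidingInv * J.braiding = 1 := by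
  rw [braidingInv, braiding, mul_assoc, ← mul_assoc (c _), ← map_mul, Units.mul_inv, map_one,
    one_mul, Units.inv_mul]

theorem braiding_mul_inv : J.braiding * J.braidingInv = 1 := by
  rw [braidingInv, braiding, mul_assoc, ← mul_assoc (J.elt : H ⊗[k] H), Units.mul_inv, one_mul,
    ← map_mul, Units.inv_mul, map_one]

theorem braiding_comul [Coalgebra.IsCocomm k H] (a : H) :
    J.braiding * J.comulHom a = c (J.comulHom a) * J.braiding := by
  rw [braiding, comulHom_apply, map_mul, map_mul]
  rw [show c (Coalgebra.comul (R := k) a) = Coalgebra.comul (R := k) a from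
    Coalgebra.comm_comul k a]
  calc _ = c ↑J.elt⁻¹ * (↑J.elt * ↑J.elt⁻¹) * Coalgebra.comul (R := k) a * ↑J.elt := by
        simp only [mul_assoc]
    _ = c ↑J.elt⁻¹ * Coalgebra.comul (R := k) a * (c (↑J.elt * ↑J.elt⁻¹)) * ↑J.elt := by
        rw [Units.mul_inv, map_one, mul_one, mul_one]
    _ = _ := by rw [map_mul]; simp only [mul_assoc]

theorem epsL_comm (X : H ⊗[k] H) : epsL k H (c X) = epsR k H X := by
  induction X with
  | zero => simp
  | add x y hx hy => simp only [map_add, hx, hy]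
  | tmul x y => simp [epsL, epsR]

theorem epsR_comm (X : H ⊗[k] H) : epsR k H (c X) = epsL k H X := by
  induction X with
  | zero => simp
  | add x y hx hy => simp only [map_add, hx, hy]
  | tmul x y => simp [epsL, epsR]

variable [Coalgebra.IsCocomm k H]

theorem braiding_hex_left :
    i12 k H ↑J.elt⁻¹ * dLeft k H J.braiding * i12 k H ↑J.elt =
      i13 k H J.braiding * i23 k H J.braiding := by
  -- The hexagon as an identity in an abstract group: the hypotheses are the cocycle identity, its
  -- rotation and its image under swapping the last two legs. The element P, common to the last two
  -- by cocommutativity, is eliminated.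
  have gr : ∀ {M : Type v} [Group M] {P x a b R y w d z : M}, d * b = R * z → P * x = a * b →
      P * y = R * w → b⁻¹ * (a⁻¹ * d) * b = x⁻¹ * y * (w⁻¹ * z) := by
    intro M _ P x a b R y w d z h0 h1 h2
    have h3 : P⁻¹ * R = y * w⁻¹ := by
      rw [inv_mul_eq_iff_eq_mul, ← mul_assoc, eq_mul_inv_iff_mul_eq, h2]
    calc _ = (a * b)⁻¹ * (d * b) := by group
      _ = x⁻¹ * (P⁻¹ * R) * z := by rw [← h1, h0]; group
      _ = _ := by rw [h3]; group
  have h0 := J.cocycle_units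
  have h1 := J.cocycle_map (rotate k H)
  have h2 := J.cocycle_map (swapRight k H)
  rw [rotate_dLeft, rotate_i12, rotate_dRight, rotate_i23] at h1
  rw [swapRight_dRight, swapRight_i12, swapRight_i23] at h2
  have e := congrArg Units.val (gr h0 h1 h2)
  simp only [Units.val_mul, ← map_inv, Units.coe_map, MonoidHom.coe_coe] at e
  simp only [braiding, map_mul]
  exact e

theorem braiding_hex_right :
    i23 k H ↑J.elt⁻¹ * dRight k H J.braidingInv * i23 k H ↑J.elt =
      i12 k H J.braidingInv * i13 k H J.braidingInv := by
  -- The same elimination, with the double rotation and the swap of the first two legs.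
  have gr : ∀ {M : Type v} [Group M] {D x R z a P y w q : M}, D * x = R * z → a * z = P * w →
      D * y = P * q → z⁻¹ * (R⁻¹ * a) * z = x⁻¹ * y * (q⁻¹ * w) := by
    intro M _ D x R z a P y w q h0 h1 h2
    have h3 : D⁻¹ * P = y * q⁻¹ := by
      rw [inv_mul_eq_iff_eq_mul, ← mul_assoc, eq_mul_inv_iff_mul_eq, h2]
    calc _ = (R * z)⁻¹ * (a * z) := by group
      _ = x⁻¹ * (D⁻¹ * P) * w := by rw [← h0, h1]; group
      _ = _ := by rw [h3]; group
  have h0 := J.cocycle_units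
  have h1 := J.cocycle_map ((rotate k H).comp (rotate k H))
  have h2 := J.cocycle_map (swapLeft k H)
  rw [AlgHom.comp_assoc, AlgHom.comp_assoc, AlgHom.comp_assoc, AlgHom.comp_assoc,
    rotate_rotate_dLeft, rotate_i12, rotate_rotate_dRight, rotate_i23, rotate_i12,
    ← AlgHom.comp_assoc, rotate_i13] at h1
  rw [swapLeft_dLeft, swapLeft_i12, swapLeft_i23] at h2
  have hc : ((i23 k H).comp (c).toAlgHom).comp (c).toAlgHom = i23 k H := by ext <;> simp
  rw [hc] at h1
  have e := congrArg Units.val (gr h0 h1 h2)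
  simp only [Units.val_mul, ← map_inv, Units.coe_map, MonoidHom.coe_coe] at e
  simp only [braidingInv, map_mul]
  exact e

end HopfTwist

end TwistBraiding

/-! ### The twisted Hopf algebra as a braided object, and images of twists -/

section TwistedBichar

variable {k : Type u} {H : Type v} [Field k] [Ring H] [HopfAlgebra k H]

namespace HopfTwist

variable (J : HopfTwist k H)

/-- The braiding of `H^J`, as an element of `H^J ⊗ H^J`. -/
def twBraiding : J.Twisted ⊗[k] J.Twisted := J.braiding

/-- The inverse of the braiding of `H^J`. -/
def twBraidingInv : J.Twisted ⊗[k] J.Twisted := J.braidingInv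

theorem twBraiding_comul [Coalgebra.IsCocomm k H] (a : J.Twisted) :
    J.twBraiding * Coalgebra.comul (R := k) a =
      Algebra.TensorProduct.comm k J.Twisted J.Twisted (Coalgebra.comul (R := k) a) *
        J.twBraiding :=
  J.braiding_comul a

/-- The twisted coproduct applied to one leg is the original one conjugated by J₁₂ or J₂₃, which is
exactly the conjugation on the left of the two hexagons. -/
theorem isBichar [Coalgebra.IsCocomm k H] : IsBichar (k := k) J.twBraidingInv J.twBraiding where
  inv_mul := J.braidingInv_mul
  mul_inv := J.braiding_mul_inv
  hex_left := by
    have h1 := congrArg (Algebra.TensorProduct.assoc k k k H H H) (J.map_comulHom_id J.braiding)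
    rw [map_mul, map_mul] at h1
    exact h1.trans J.braiding_hex_left
  hex_right := by
    have h2 : Algebra.TensorProduct.map (AlgHom.id k H)
        (Algebra.TensorProduct.includeLeft : H →ₐ[k] H ⊗[k] H) = i12 k H := by ext <;> simp [Algebra.TensorProduct.one_def]
    have h1 := (J.map_id_comulHom J.braidingInv).trans J.braiding_hex_right
    rw [← h2] at h1
    exact h1
  counit_left := by
    apply (Algebra.TensorProduct.lid k J.Twisted).injective
    rw [map_one]
    change epsL k H J.braiding = 1
    rw [braiding, map_mul, epsL_comm, epsR_inv, epsL_elt, one_mul]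
  counit_right := by
    apply (Algebra.TensorProduct.rid k k J.Twisted).injective
    rw [map_one]
    change epsR k H J.braidingInv = 1
    rw [braidingInv, map_mul, epsR_comm, epsR_inv, epsL_elt, one_mul]

theorem antipodeHom_injective (hS : Function.Injective (HopfAlgebra.antipode k (A := H))) :
    Function.Injective J.antipodeHom := by
  intro a b h
  rw [antipodeHom_apply, antipodeHom_apply] at h
  apply hS
  have h1 := congrArg (fun x => J.v * x * J.vInv) h
  simp only [mul_assoc, J.v_mul_vInv, mul_one] at h1
  simpa only [← mul_assoc, J.v_mul_vInv, one_mul] using h1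

theorem antipode_injective (hS : Function.Injective (HopfAlgebra.antipode k (A := H))) :
    Function.Injective (HopfAlgebra.antipode k (A := J.Twisted)) :=
  J.antipodeHom_injective hS

variable {H' : Type w} [Ring H'] [HopfAlgebra k H']

/-- The square of a bialgebra map. -/
def mapSq (φ : H →ₐc[k] H') : H ⊗[k] H →ₐ[k] H' ⊗[k] H' :=
  Algebra.TensorProduct.map (φ : H →ₐ[k] H') (φ : H →ₐ[k] H')

theorem mapSq_comul (φ : H →ₐc[k] H') (x : H) :
    mapSq φ (Coalgebra.comul (R := k) x) = Coalgebra.comul (R := k) (φ x) :=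
  LinearMap.congr_fun (φ : H →ₗc[k] H').map_comp_comul x

theorem counit_map (φ : H →ₐc[k] H') (x : H) :
    Coalgebra.counit (R := k) (φ x) = Coalgebra.counit (R := k) x :=
  LinearMap.congr_fun (φ : H →ₗc[k] H').counit_comp x

/-- The image of a twist under a bialgebra map. -/
def map (φ : H →ₐc[k] H') : HopfTwist k H' where
  elt := Units.map (mapSq φ : H ⊗[k] H →* H' ⊗[k] H') J.elt
  isTwist := by
    let φ3 : H ⊗[k] (H ⊗[k] H) →ₐ[k] H' ⊗[k] (H' ⊗[k] H') :=
      Algebra.TensorProduct.map (φ : H →ₐ[k] H') (mapSq φ)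
    have hL : ∀ X, dLeft k H' (mapSq φ X) = φ3 (dLeft k H X) := by
      intro X
      induction X with
      | zero => simp
      | add x y hx hy => simp only [map_add, hx, hy]
      | tmul x y =>
        have : ∀ Y : H ⊗[k] H, Algebra.TensorProduct.assoc k k k H' H' H' (mapSq φ Y ⊗ₜ φ y) =
            φ3 (Algebra.TensorProduct.assoc k k k H H H (Y ⊗ₜ y)) := by
          intro Y
          induction Y with
          | zero => simp
          | add a b ha hb => simp only [map_add, add_tmul, ha, hb]
          | tmul a b => simp [φ3, mapSq]
        have h2 := this (Coalgebra.comul (R := k) x)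
        rw [mapSq_comul] at h2
        simpa [dLeft, mapSq] using h2
    have hR : ∀ X, dRight k H' (mapSq φ X) = φ3 (dRight k H X) := by
      intro X
      induction X with
      | zero => simp
      | add x y hx hy => simp only [map_add, hx, hy]
      | tmul x y =>
        have h2 := mapSq_comul φ y
        simp [dRight, φ3, h2]
        simp [mapSq]
    have h12 : (i12 k H').comp (mapSq φ) = φ3.comp (i12 k H) := by
      ext <;> simp [mapSq, φ3, i12]
    have h23 : (i23 k H').comp (mapSq φ) = φ3.comp (i23 k H) := by
      ext <;> simp [mapSq, φ3, i23]
    have hεL : (epsL k H').comp (mapSq φ) = (φ : H →ₐ[k] H').comp (epsL k H) := by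
      ext <;> simp [mapSq, epsL]
    have hεR : (epsR k H').comp (mapSq φ) = (φ : H →ₐ[k] H').comp (epsR k H) := by
      ext <;> simp [mapSq, epsR]
    refine ⟨?_, ?_, ?_⟩
    · have h1 := congrArg Units.val J.cocycle_units
      have h2 := congrArg φ3 h1
      simp only [Units.val_mul, Units.coe_map, MonoidHom.coe_coe, map_mul] at h2
      have e1 := AlgHom.congr_fun h12 ↑J.elt
      have e2 := AlgHom.congr_fun h23 ↑J.elt
      simp only [AlgHom.comp_apply] at e1 e2
      rw [← hL, ← hR, ← e1, ← e2] at h2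
      rw [map_mul]
      exact h2
    · exact (AlgHom.congr_fun hεL ↑J.elt).trans ((congrArg φ J.epsL_elt).trans (map_one φ))
    · exact (AlgHom.congr_fun hεR ↑J.elt).trans ((congrArg φ J.epsR_elt).trans (map_one φ))

theorem mapSq_comulHom (φ : H →ₐc[k] H') (x : H) :
    mapSq φ (J.comulHom x) = (J.map φ).comulHom (φ x) := by
  rw [comulHom_apply, comulHom_apply, map_mul, map_mul, mapSq_comul]
  rfl

/-- A bialgebra map, as a map between the twisted bialgebras. -/
def mapHom (φ : H →ₐc[k] H') : J.Twisted →ₐc[k] (J.map φ).Twisted :=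
  BialgHom.ofAlgHom (A := J.Twisted) (B := (J.map φ).Twisted) (φ : H →ₐ[k] H')
    (AlgHom.ext fun x => counit_map φ x)
    (AlgHom.ext fun x => J.mapSq_comulHom φ x)

theorem mapSq_comm (φ : H →ₐc[k] H') (X : H ⊗[k] H) :
    mapSq φ (Algebra.TensorProduct.comm k H H X) =
      Algebra.TensorProduct.comm k H' H' (mapSq φ X) := by
  induction X with
  | zero => simp
  | add x y hx hy => simp only [map_add, hx, hy]
  | tmul x y => simp [mapSq]

theorem mapSq_braiding (φ : H →ₐc[k] H') : mapSq φ J.braiding = (J.map φ).braiding := by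
  rw [braiding, map_mul, mapSq_comm]
  rfl

theorem mapSq_braidingInv (φ : H →ₐc[k] H') :
    mapSq φ J.braidingInv = (J.map φ).braidingInv := by
  rw [braidingInv, map_mul, mapSq_comm]
  rfl

end HopfTwist

end TwistedBichar

/-! ### Twisted group algebras and central subgroups -/

section GroupAlgebra

/-- For z central, z ⊗ z commutes with J, so twisting leaves Δ(z) unchanged. -/
theorem HopfTwist.isGroupLikeElem {k : Type u} {H : Type v} [Field k] [Ring H] [HopfAlgebra k H]
    (J : HopfTwist k H) {z : H} (hz : IsGroupLikeElem k z) (hc : ∀ a, z * a = a * z) :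
    IsGroupLikeElem k (A := J.Twisted) z where
  counit_eq_one := hz.counit_eq_one
  comul_eq_tmul_self := by
    have h1 : ∀ X : H ⊗[k] H, (z ⊗ₜ z) * X = X * (z ⊗ₜ z) := by
      intro X
      induction X with
      | zero => simp
      | add x y hx hy => simp only [mul_add, add_mul, hx, hy]
      | tmul x y => simp [hc]
    have h2 : J.comulHom z = z ⊗ₜ z := by
      rw [J.comulHom_apply, hz.comul_eq_tmul_self, mul_assoc, h1, ← mul_assoc, Units.inv_mul,
        one_mul]
    exact h2

variable {k : Type u} [Field k] {G : Type w} [Group G]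

theorem MonoidAlgebra.antipode_injective :
    Function.Injective (HopfAlgebra.antipode k (A := MonoidAlgebra k G)) := by
  refine Function.LeftInverse.injective (g := HopfAlgebra.antipode k) fun x => ?_
  induction x using MonoidAlgebra.induction_linear with
  | zero => simp
  | add x y hx hy => simp only [map_add, hx, hy]
  | single g r => simp

theorem MonoidAlgebra.single_comm_of_mem_center {z : G} (hz : z ∈ Subgroup.center G)
    (a : MonoidAlgebra k G) : single z 1 * a = a * single z 1 := by
  induction a using MonoidAlgebra.induction_linear with
  | zero => simp
  | add x y hx hy => simp only [mul_add, add_mul, hx, hy]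
  | single g r => simp [Subgroup.mem_center_iff.1 hz g]

/-- The quotient map of group algebras. -/
abbrev quotientHom (k : Type u) [Field k] (Z : Subgroup G) [Z.Normal] :
    MonoidAlgebra k G →ₐc[k] MonoidAlgebra k (G ⧸ Z) :=
  MonoidAlgebra.mapDomainBialgHom k (QuotientGroup.mk' Z)

theorem quotientHom_single (Z : Subgroup G) [Z.Normal] (g : G) (r : k) :
    quotientHom k Z (MonoidAlgebra.single g r) = MonoidAlgebra.single (g : G ⧸ Z) r :=
  MonoidAlgebra.mapDomain_single

theorem quotientHom_surjective (Z : Subgroup G) [Z.Normal] :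
    Function.Surjective (quotientHom k Z) := by
  intro x
  induction x using MonoidAlgebra.induction_linear with
  | zero => exact ⟨0, map_zero _⟩
  | add x y hx hy =>
    obtain ⟨a, rfl⟩ := hx
    obtain ⟨b, rfl⟩ := hy
    exact ⟨a + b, map_add _ _ _⟩
  | single g r =>
    obtain ⟨g, rfl⟩ := QuotientGroup.mk_surjective g
    exact ⟨_, quotientHom_single Z g r⟩

theorem mem_span_of_quotientHom_eq_zero (Z : Subgroup G) [Z.Normal] {a : MonoidAlgebra k G}
    (ha : quotientHom k Z a = 0) : a ∈ Submodule.span k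
      {x | ∃ (b : MonoidAlgebra k G) (z : Z), b * MonoidAlgebra.single (z : G) 1 - b = x} := by
  -- σ picks coset representatives. If r represents gZ, then g − r = rz − r with z = r⁻¹g ∈ Z.
  let σ : MonoidAlgebra k (G ⧸ Z) → MonoidAlgebra k G := MonoidAlgebra.mapDomain Quotient.out
  have key : ∀ a, a - σ (quotientHom k Z a) ∈ Submodule.span k
      {x | ∃ (b : MonoidAlgebra k G) (z : Z), b * MonoidAlgebra.single (z : G) 1 - b = x} := by
    intro a
    induction a using MonoidAlgebra.induction_linear with
    | zero => simp [σ]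
    | add x y hx hy =>
      have : σ (quotientHom k Z (x + y)) =
          σ (quotientHom k Z x) + σ (quotientHom k Z y) := by
        rw [map_add]
        exact MonoidAlgebra.mapDomain_add _ _ _
      rw [this, add_sub_add_comm]
      exact Submodule.add_mem _ hx hy
    | single g r =>
      rw [quotientHom_single]
      have h1 : σ (MonoidAlgebra.single (g : G ⧸ Z) r) =
          MonoidAlgebra.single (Quotient.out (g : G ⧸ Z)) r := MonoidAlgebra.mapDomain_single
      rw [h1]
      have h2 : (Quotient.out (g : G ⧸ Z))⁻¹ * g ∈ Z :=
        QuotientGroup.eq.1 (Quotient.out_eq (g : G ⧸ Z))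
      refine Submodule.subset_span ⟨MonoidAlgebra.single (Quotient.out (g : G ⧸ Z)) r,
        ⟨_, h2⟩, ?_⟩
      simp [MonoidAlgebra.single_mul_single]
  have := key a
  rw [ha] at this
  simpa [σ] using this

variable (J : HopfTwist k (MonoidAlgebra k G))

/-- A group element, as an element of the twisted group algebra. -/
def HopfTwist.single (g : G) : J.Twisted := (MonoidAlgebra.single g 1 : MonoidAlgebra k G)

theorem isCentralExt_quotient [Finite G] {Z : Subgroup G} [Z.Normal] [Fintype Z]
    (hZ : Z ≤ Subgroup.center G) :
    IsCentralExt (J.mapHom (quotientHom k Z))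
      (fun z : Z => J.single (z : G)) where
  surjective := quotientHom_surjective Z
  groupLike z := J.isGroupLikeElem (MonoidAlgebra.isGroupLikeElem_single_one _)
    (MonoidAlgebra.single_comm_of_mem_center (hZ z.2))
  central z := MonoidAlgebra.single_comm_of_mem_center (k := k) (hZ z.2)
  ker_le a ha := mem_span_of_quotientHom_eq_zero Z ha
  mul_sum z := by
    have : (MonoidAlgebra.single (z : G) 1 : MonoidAlgebra k G) *
        ∑ w : Z, MonoidAlgebra.single (w : G) 1 = ∑ w : Z, MonoidAlgebra.single (w : G) 1 := by
      rw [Finset.mul_sum]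
      exact Fintype.sum_equiv (Equiv.mulLeft z) _ _ fun w => by
        simp [MonoidAlgebra.single_mul_single]
    exact this
  exists_dual := by
    classical
    have : ∃ δ : MonoidAlgebra k G →ₗ[k] k, ∑ w : Z, δ (MonoidAlgebra.single (w : G) 1) •
        (MonoidAlgebra.single (w : G) 1 : MonoidAlgebra k G) = 1 := by
      -- δ is the coefficient at the identity of G, so only w = 1 contributes.
      refine ⟨Finsupp.lapply 1 ∘ₗ (MonoidAlgebra.coeffLinearEquiv k).toLinearMap, ?_⟩
      rw [Finset.sum_eq_single (1 : Z)]
      · simp [MonoidAlgebra.one_def]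
      · intro w _ hw
        have : (w : G) ≠ 1 := fun h => hw (Subtype.ext h)
        simp [this]
      · simp
    exact this

theorem quotientHom_eq_one {Z : Subgroup G} [Z.Normal] (z : Z) :
    J.mapHom (quotientHom k Z) (J.single (z : G)) = 1 := by
  have : quotientHom k Z (MonoidAlgebra.single (z : G) 1) = 1 := by
    rw [quotientHom_single, (QuotientGroup.eq_one_iff _).2 z.2]
    rfl
  exact this

instance HopfTwist.finiteDimensional [Finite G] : FiniteDimensional k J.Twisted :=
  inferInstanceAs (Module.Finite k (MonoidAlgebra k G))

theorem HopfTwist.finrank_twisted [Finite G] : Module.finrank k J.Twisted = Nat.card G := by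
  have : Module.finrank k (MonoidAlgebra k G) = Nat.card G :=
    Module.finrank_eq_nat_card_basis (Module.Basis.ofRepr (MonoidAlgebra.coeffLinearEquiv k))
  exact this

theorem MonoidAlgebra.algebraMap_bijective_of_subsingleton [Subsingleton G] :
    Function.Bijective (algebraMap k (MonoidAlgebra k G)) :=
  (MonoidAlgebra.bialgEquivOfSubsingleton (R := k) G).symm.bijective

/-- The centre of a nontrivial nilpotent group is nontrivial, and Cauchy's theorem gives it an
element of prime order. -/
theorem exists_le_center_card_prime [Finite G] [Group.IsNilpotent G] [Nontrivial G] :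
    ∃ Z : Subgroup G, Z ≤ Subgroup.center G ∧ (Nat.card Z).Prime := by
  have h1 : Nat.card (Subgroup.center G) ≠ 1 := fun h =>
    Group.IsNilpotent.center_ne_bot G ((Subgroup.eq_bot_iff_card _).2 h)
  obtain ⟨p, hp, hd⟩ := Nat.exists_prime_and_dvd h1
  have := Fact.mk hp
  obtain ⟨z, hz⟩ := exists_prime_orderOf_dvd_card' p hd
  refine ⟨Subgroup.zpowers (z : G), ?_, ?_⟩
  · rw [Subgroup.zpowers_le]
    exact z.2
  · rwa [Nat.card_zpowers, Subgroup.orderOf_coe, hz]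

/-- Induction on the order of a finite nilpotent group along central subgroups of prime order. -/
theorem nilpotent_prime_induction {P : ∀ (G : Type w) [Group G] [Finite G], Prop}
    (base : ∀ (G : Type w) [Group G] [Finite G] [Subsingleton G], P G)
    (step : ∀ (G : Type w) [Group G] [Finite G] (Z : Subgroup G) [Z.Normal],
      Z ≤ Subgroup.center G → (Nat.card Z).Prime → P (G ⧸ Z) → P G)
    (G : Type w) [Group G] [Finite G] [Group.IsNilpotent G] : P G := by
  suffices H : ∀ n : ℕ, ∀ (G : Type w) [Group G] [Finite G] [Group.IsNilpotent G],
      Nat.card G = n → P G from H _ G rfl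
  intro n
  induction n using Nat.strong_induction_on with
  | _ n ih =>
    intro G _ _ _ hn
    rcases subsingleton_or_nontrivial G with h | h
    · exact base G
    · obtain ⟨Z, hZ, hp⟩ := exists_le_center_card_prime (G := G)
      have hN : Z.Normal := ⟨fun n hn g => by
        rwa [Subgroup.mem_center_iff.1 (hZ hn) g, mul_assoc, mul_inv_cancel, mul_one]⟩
      refine step G Z hZ hp (ih _ ?_ (G ⧸ Z) rfl)
      have h2 := Subgroup.card_eq_card_quotient_mul_card_subgroup Z
      rw [← hn, h2]
      exact lt_mul_of_one_lt_right Nat.card_pos hp.one_lt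

end GroupAlgebra

/-! ### The lower normal series -/

section LowerSeries

variable {k : Type u} [Field k]

theorem mem_tensorRight_of_leg {A : Type*} [Ring A] [HopfAlgebra k A] {B : Type*} [Ring B]
    [HopfAlgebra k B] {L : Subalgebra k B} {X : B ⊗[k] A} (h : ∀ f, leg X f ∈ L) :
    X ∈ tensorRight k A L := by
  obtain ⟨z, rfl⟩ := TensorProduct.mem_range_map_of_forall (P := Subalgebra.toSubmodule L)
    (Q := ⊤) (x := X) h (fun _ => trivial)
  clear h
  induction z with
  | zero => rw [map_zero]; exact Subalgebra.zero_mem _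
  | add x y hx hy => rw [map_add]; exact Subalgebra.add_mem _ hx hy
  | tmul x y =>
    rw [TensorProduct.map_tmul]
    exact tmul_mem_tensorRight (x := (x : B)) x.2 (y : A)

theorem map_map_mem_tensorRight {A : Type*} [Ring A] [HopfAlgebra k A] {A' : Type*} [Ring A']
    [HopfAlgebra k A'] (π : A →ₐc[k] A') {T : Subalgebra k A} {X : A ⊗[k] A}
    (hX : X ∈ tensorRight k A T) :
    Algebra.TensorProduct.map (π : A →ₐ[k] A') (π : A →ₐ[k] A') X ∈
      tensorRight k A' (T.map (π : A →ₐ[k] A')) :=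
  tensorRight_induction (F := (Algebra.TensorProduct.map (π : A →ₐ[k] A')
    (π : A →ₐ[k] A')).toLinearMap)
    (W := Subalgebra.toSubmodule (tensorRight k A' (T.map (π : A →ₐ[k] A'))))
    (fun x hx y => tmul_mem_tensorRight (Subalgebra.mem_map.2 ⟨x, hx, rfl⟩) (π y)) hX

theorem HopfTwist.exists_algebraMap_eq {G : Type w} [Group G] [Subsingleton G]
    (J : HopfTwist k (MonoidAlgebra k G)) (x : J.Twisted) : ∃ r, algebraMap k J.Twisted r = x :=
  (MonoidAlgebra.algebraMap_bijective_of_subsingleton (k := k) (G := G)).2 x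

theorem HopfTwist.braidedBy {G : Type w} [Group G] (J : HopfTwist k (MonoidAlgebra k G))
    {T : Subalgebra k J.Twisted} (hT : T.IsSubcoalgebra)
    (hs : J.twBraidingInv ∈ tensorRight k J.Twisted T)
    (ht : J.twBraiding ∈ tensorRight k J.Twisted T) :
    BraidedBy J.twBraidingInv J.twBraiding T where
  sub := hT
  inv_mul := J.isBichar.inv_mul
  mul_inv := J.isBichar.mul_inv
  braid := J.twBraiding_comul
  left_mem := hs
  right_mem := ht

/-- T is arbitrary because the induction replaces it by its image in the twist of k[G/Z]. That image
contains the left legs of the braiding there, but may be larger than their span. -/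
theorem HopfTwist.chainOver {G : Type w} [Group G] [Finite G] [Group.IsNilpotent G]
    (J : HopfTwist k (MonoidAlgebra k G)) (T : Subalgebra k J.Twisted)
    (h : BraidedBy J.twBraidingInv J.twBraiding T) : ChainOver k T ⊤ T := by
  revert J
  refine nilpotent_prime_induction (P := fun G _ _ => ∀ (J : HopfTwist k (MonoidAlgebra k G))
    (T : Subalgebra k J.Twisted), BraidedBy J.twBraidingInv J.twBraiding T →
    ChainOver k T ⊤ T) ?_ ?_ G
  · intro G _ _ _ J T _
    have : T = ⊤ := eq_top_iff.2 fun x _ => by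
      obtain ⟨r, rfl⟩ := J.exists_algebraMap_eq x
      exact T.algebraMap_mem r
    rw [this]
    exact Relation.ReflTransGen.refl
  · intro G _ _ Z _ hZ _ ih J T h
    have := Fintype.ofFinite Z
    refine h.chainOver (isCentralExt_quotient J hZ) (ih (J.map (quotientHom k Z)) _ ?_)
    refine HopfTwist.braidedBy _ (h.sub.map _) ?_ ?_
    · have e : Algebra.TensorProduct.map (J.mapHom (quotientHom k Z) : J.Twisted →ₐ[k] _)
          (J.mapHom (quotientHom k Z) : J.Twisted →ₐ[k] _) J.twBraidingInv =
          (J.map (quotientHom k Z)).twBraidingInv := J.mapSq_braidingInv (quotientHom k Z)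
      exact e ▸ map_map_mem_tensorRight (J.mapHom (quotientHom k Z)) h.left_mem
    · have e : Algebra.TensorProduct.map (J.mapHom (quotientHom k Z) : J.Twisted →ₐ[k] _)
          (J.mapHom (quotientHom k Z) : J.Twisted →ₐ[k] _) J.twBraiding =
          (J.map (quotientHom k Z)).twBraiding := J.mapSq_braiding (quotientHom k Z)
      exact e ▸ map_map_mem_tensorRight (J.mapHom (quotientHom k Z)) h.right_mem

/-- Only the right leg passes to quotients of G, so B is kept separate from the twisted group
algebra and fixed throughout. For the trivial group every functional is a multiple of ε, whose leg
is 1. -/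
theorem IsBichar.chain {G : Type w} [Group G] [Finite G] [Group.IsNilpotent G]
    {B : Type*} [Ring B] [HopfAlgebra k B]
    (J : HopfTwist k (MonoidAlgebra k G)) {s t : B ⊗[k] J.Twisted} (h : IsBichar s t) :
    Relation.ReflTransGen CocommStep h.legs ⊥ := by
  revert J
  refine nilpotent_prime_induction (P := fun G _ _ => ∀ (J : HopfTwist k (MonoidAlgebra k G))
    {s t : B ⊗[k] J.Twisted} (h : IsBichar s t),
    Relation.ReflTransGen CocommStep h.legs ⊥) ?_ ?_ G
  · intro G _ _ _ J s t h
    have : h.legs = ⊥ := eq_bot_iff.2 fun b hb => by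
      obtain ⟨f, rfl⟩ := hb
      have hf : f = f 1 • Coalgebra.counit (R := k) := by
        ext x
        obtain ⟨r, rfl⟩ := J.exists_algebraMap_eq x
        simp [Algebra.algebraMap_eq_smul_one, mul_comm]
      have h1 := h.leg_counit
      rw [hf]
      unfold leg at h1 ⊢
      rw [LinearMap.lTensor_smul, LinearMap.smul_apply, map_smul, h1]
      exact Subalgebra.smul_mem _ (one_mem _) _
    rw [this]
  · intro G _ _ Z _ hZ _ ih J s t h
    have := Fintype.ofFinite Z
    exact Relation.ReflTransGen.head
      (h.cocommStep (isCentralExt_quotient J hZ) (quotientHom_eq_one J))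
      (ih (J.map (quotientHom k Z)) (h.map_right _))

theorem HopfTwist.hasLowerNormalSeries {G : Type w} [Group G] [Finite G] [Group.IsNilpotent G]
    (J : HopfTwist k (MonoidAlgebra k G)) :
    HasLowerNormalSeries (IsCocommHopf k) J.Twisted := by
  have h := J.isBichar
  have hb : BraidedBy J.twBraidingInv J.twBraiding h.legs :=
    J.braidedBy h.legs_isSubcoalgebra (mem_tensorRight_of_leg fun f => ⟨f, rfl⟩)
      (mem_tensorRight_of_leg h.leg_t_mem)
  have h1 : Relation.ReflTransGen CocommStep (⊤ : Subalgebra k J.Twisted) h.legs :=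
    Relation.ReflTransGen.mono (fun _ _ h => h.1) _ _ (J.chainOver _ hb)
  exact hasLowerNormalSeries_of_chain (J.antipode_injective MonoidAlgebra.antipode_injective)
    (h1.trans (h.chain J)) J.Twisted (BialgHom.id k J.Twisted) (fun _ _ h => h)
    (fun a => ⟨fun _ => ⟨a, rfl⟩, fun _ => trivial⟩)

end LowerSeries

/-! ### The upper normal series -/

section UpperSeries

variable {k : Type u} [Field k]

section Range

variable {A : Type v} [Ring A] [HopfAlgebra k A] {B : Type w} [Ring B] [HopfAlgebra k B]

/-- The range of a map of Hopf algebras. -/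
def BialgHom.hopfRange (i : B →ₐc[k] A) : HopfSubalgebra k A where
  toSubalgebra := (i : B →ₐ[k] A).range
  comul_mem := by
    have hT : (⊤ : Subalgebra k B).IsSubcoalgebra :=
      Subalgebra.IsSubcoalgebra.of_hit (fun _ _ _ => trivial) (fun _ _ _ => trivial)
    have := hT.map i
    rwa [Algebra.map_top] at this
  antipode_mem := by
    rintro _ ⟨b, rfl⟩
    exact ⟨HopfAlgebra.antipode k b, bialgHom_antipode i b⟩

theorem BialgHom.nonempty_equiv_hopfRange {i : B →ₐc[k] A} (hi : Function.Injective i) :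
    Nonempty (i.hopfRange.toSubalgebra ≃ₐc[k] B) := by
  let j : B →ₐ[k] i.hopfRange.toSubalgebra := (i : B →ₐ[k] A).rangeRestrict
  have hj : ∀ b, ((j b : i.hopfRange.toSubalgebra) : A) = i b := fun _ => rfl
  let J : B →ₐc[k] i.hopfRange.toSubalgebra := BialgHom.ofAlgHom j
    (AlgHom.ext fun b => HopfTwist.counit_map i b)
    (AlgHom.ext fun b => by
      apply i.hopfRange.incl₂_injective
      refine Eq.trans ?_ (i.hopfRange.incl₂_comulHom (j b)).symm
      rw [hj, ← HopfTwist.mapSq_comul]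
      change i.hopfRange.incl₂ (Algebra.TensorProduct.map j j (Coalgebra.comul (R := k) b)) = _
      generalize (Coalgebra.comul (R := k) b) = X
      induction X with
      | zero => simp
      | add x y hx hy => simp only [map_add, hx, hy]
      | tmul x y => simp [HopfSubalgebra.incl₂, HopfTwist.mapSq, hj])
  refine ⟨(BialgEquiv.ofBijective J ⟨fun a b hab => hi ?_, ?_⟩).symm⟩
  · exact congrArg Subtype.val hab
  · rintro ⟨_, b, rfl⟩
    exact ⟨b, rfl⟩

/-- For x central in A, h₁xS(h₂) = xε(h). -/
theorem HopfSubalgebra.isNormal_of_central (K : HopfSubalgebra k A)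
    (hK : ∀ x ∈ K.toSubalgebra, ∀ a, x * a = a * x) : K.IsNormal := by
  intro h x hx
  have h1 : LinearMap.mulRight k x = LinearMap.mulLeft k x ∘ₗ LinearMap.id := by
    ext a
    simp [hK x hx]
  have h2 : LinearMap.mul' k A (TensorProduct.map (LinearMap.mulRight k x)
      (HopfAlgebra.antipode k) (Coalgebra.comul (R := k) h)) =
      x * algebraMap k A (Coalgebra.counit h) := by
    rw [← conv_apply, h1, ← mulLeft_comp_conv, conv_id_antipode]
    rfl
  rw [h2]
  exact K.mul_mem hx (K.algebraMap_mem _)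

end Range

variable {G : Type w} [Group G] (J : HopfTwist k (MonoidAlgebra k G))

/-- The inclusion of the group algebra of a central subgroup into a twisted group algebra. -/
def centralHom {Z : Subgroup G} (hZ : Z ≤ Subgroup.center G) :
    MonoidAlgebra k Z →ₐc[k] J.Twisted :=
  BialgHom.ofAlgHom (A := MonoidAlgebra k Z) (B := J.Twisted)
    (MonoidAlgebra.mapDomainAlgHom k k Z.subtype)
    (MonoidAlgebra.algHom_ext (fun z => by
      have h := (J.isGroupLikeElem (MonoidAlgebra.isGroupLikeElem_single_one (R := k) (A := k)
        (z : G)) (MonoidAlgebra.single_comm_of_mem_center (hZ z.2))).counit_eq_one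
      refine Eq.trans ?_ (MonoidAlgebra.isGroupLikeElem_single_one z).counit_eq_one.symm
      refine Eq.trans ?_ h
      exact congrArg (Coalgebra.counit (R := k) (A := MonoidAlgebra k G))
        MonoidAlgebra.mapDomain_single) (by ext))
    (MonoidAlgebra.algHom_ext (fun z => by
      have h := (J.isGroupLikeElem (MonoidAlgebra.isGroupLikeElem_single_one (R := k) (A := k)
        (z : G)) (MonoidAlgebra.single_comm_of_mem_center (hZ z.2))).comul_eq_tmul_self
      have h1 : MonoidAlgebra.mapDomainAlgHom k k Z.subtype (MonoidAlgebra.single z 1) =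
        MonoidAlgebra.single (z : G) 1 := MonoidAlgebra.mapDomain_single
      refine Eq.trans ?_ (h.symm.trans (congrArg J.comulHom h1.symm))
      refine (congrArg _ (MonoidAlgebra.isGroupLikeElem_single_one z).comul_eq_tmul_self).trans ?_
      exact congrArg₂ (fun a b => a ⊗ₜ[k] b) h1 h1) (by ext))

theorem centralHom_single {Z : Subgroup G} (hZ : Z ≤ Subgroup.center G) (z : Z) :
    centralHom J hZ (MonoidAlgebra.single z 1) = J.single (z : G) :=
  MonoidAlgebra.mapDomain_single

theorem HopfTwist.single_comm {z : G} (hz : z ∈ Subgroup.center G) (a : J.Twisted) :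
    J.single z * a = a * J.single z :=
  MonoidAlgebra.single_comm_of_mem_center (k := k) hz a

theorem MonoidAlgebra.single_eq_smul (g : G) (r : k) :
    (single g r : MonoidAlgebra k G) = r • single g 1 := by simp

theorem centralHom_injective {Z : Subgroup G} (hZ : Z ≤ Subgroup.center G) :
    Function.Injective (centralHom J hZ) :=
  MonoidAlgebra.mapDomain_injective Subtype.val_injective

theorem centralHom_comm {Z : Subgroup G} (hZ : Z ≤ Subgroup.center G) (x : MonoidAlgebra k Z)
    (a : J.Twisted) : centralHom J hZ x * a = a * centralHom J hZ x := by
  induction x using MonoidAlgebra.induction_linear with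
  | zero => simp
  | add x y hx hy => simp only [map_add, add_mul, mul_add, hx, hy]
  | single z r =>
    rw [MonoidAlgebra.single_eq_smul, map_smul, centralHom_single, smul_mul_assoc, mul_smul_comm]
    rw [J.single_comm (hZ z.2)]

theorem mapHom_centralHom {Z : Subgroup G} [Z.Normal] (hZ : Z ≤ Subgroup.center G)
    (x : MonoidAlgebra k Z) : J.mapHom (quotientHom k Z) (centralHom J hZ x) =
      algebraMap k _ (Coalgebra.counit (R := k) x) := by
  induction x using MonoidAlgebra.induction_linear with
  | zero => simp
  | add x y hx hy => simp only [map_add, hx, hy]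
  | single z r =>
    rw [MonoidAlgebra.single_eq_smul, map_smul, map_smul, centralHom_single, quotientHom_eq_one, map_smul,
      MonoidAlgebra.counit_single, Algebra.algebraMap_eq_smul_one]
    simp

theorem isQuotientBy_centralHom [Finite G] {Z : Subgroup G} [Z.Normal]
    (hZ : Z ≤ Subgroup.center G) :
    (centralHom J hZ).hopfRange.IsQuotientBy (J.mapHom (quotientHom k Z)) where
  surjective := quotientHom_surjective Z
  ker_eq := by
    have := Fintype.ofFinite Z
    apply le_antisymm
    · intro a ha
      have h1 := (isCentralExt_quotient J hZ).ker_le a ha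
      have h2 : Submodule.span k {x | ∃ (b : J.Twisted) (z : Z),
          b * J.single (z : G) - b = x} ≤
          (centralHom J hZ).hopfRange.augIdeal.restrictScalars k := by
        rw [Submodule.span_le]
        rintro _ ⟨b, z, rfl⟩
        have h3 : b * J.single (z : G) - b =
            b * centralHom J hZ (MonoidAlgebra.single z 1 - 1) := by
          rw [map_sub, map_one, mul_sub, mul_one, centralHom_single]
        rw [h3]
        refine Ideal.mul_mem_left _ _ (Ideal.subset_span ⟨⟨_, rfl⟩, ?_⟩)
        rw [HopfTwist.counit_map]
        simp
      exact h2 h1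
    · rw [HopfSubalgebra.augIdeal, Ideal.span_le]
      rintro _ ⟨⟨x, rfl⟩, hx⟩
      have hx' : Coalgebra.counit (R := k) x = 0 := by
        rw [← HopfTwist.counit_map (centralHom J hZ)]
        exact hx
      refine (mapHom_centralHom J hZ x).trans ?_
      rw [hx', map_zero]

/-- If k[G/Z] is trivial then G = Z. This supplies the requirement that the last factor of an upper
series be the whole remaining algebra. -/
theorem hopfRange_centralHom_eq_top {Z : Subgroup G} [Z.Normal] (hZ : Z ≤ Subgroup.center G)
    (h : IsTrivialHopf k (J.map (quotientHom k Z)).Twisted) :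
    (centralHom J hZ).hopfRange.toSubalgebra = ⊤ := by
  have h1 : ∀ g : G, g ∈ Z := by
    intro g
    obtain ⟨r, hr⟩ := h.2 (MonoidAlgebra.single (g : G ⧸ Z) 1 : MonoidAlgebra k (G ⧸ Z))
    have hr' : (MonoidAlgebra.single 1 r : MonoidAlgebra k (G ⧸ Z)) =
      MonoidAlgebra.single (g : G ⧸ Z) 1 := hr
    by_contra hg
    have hg' : (g : G ⧸ Z) ≠ 1 := fun h => hg ((QuotientGroup.eq_one_iff g).1 h)
    have := congrArg (fun x => x.coeff (g : G ⧸ Z)) hr'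
    simp [hg'.symm] at this
  refine eq_top_iff.2 fun a _ => ?_
  have h2 : ∀ a : MonoidAlgebra k G, ∃ x, centralHom J hZ x = a := by
    intro a
    induction a using MonoidAlgebra.induction_linear with
    | zero => exact ⟨0, map_zero _⟩
    | add x y hx hy =>
      obtain ⟨x, rfl⟩ := hx
      obtain ⟨y, rfl⟩ := hy
      exact ⟨x + y, map_add _ _ _⟩
    | single g r => exact ⟨MonoidAlgebra.single ⟨g, h1 g⟩ r, MonoidAlgebra.mapDomain_single⟩
  exact h2 a

/-- The number d is fixed during the induction while |G| shrinks to a divisor, so that primes found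
in later quotients still divide the original dimension. -/
theorem HopfTwist.hasUpperNormalSeries [Finite G] [Group.IsNilpotent G] {d : ℕ}
    (hd : Nat.card G ∣ d) : HasUpperNormalSeries (IsPrimeCyclicGroupAlgebra k d) J.Twisted := by
  revert J hd
  refine nilpotent_prime_induction (P := fun G _ _ => ∀ (J : HopfTwist k (MonoidAlgebra k G)),
    Nat.card G ∣ d → HasUpperNormalSeries (IsPrimeCyclicGroupAlgebra k d) J.Twisted) ?_ ?_ G
  · intro G _ _ _ J _
    exact HasUpperNormalSeries.nil _ MonoidAlgebra.algebraMap_bijective_of_subsingleton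
  · intro G _ _ Z _ hZ hp ih J hd
    rw [Subgroup.card_eq_card_quotient_mul_card_subgroup Z] at hd
    refine HasUpperNormalSeries.step _ (centralHom J hZ).hopfRange
      (HopfSubalgebra.isNormal_of_central _ ?_) ⟨Nat.card Z, hp, dvd_of_mul_left_dvd hd, ?_⟩ _
      (J.mapHom (quotientHom k Z)) (isQuotientBy_centralHom J hZ)
      (hopfRange_centralHom_eq_top J hZ) (ih _ (dvd_of_mul_right_dvd hd))
    · rintro _ ⟨x, rfl⟩ a
      exact centralHom_comm J hZ x a
    · obtain ⟨e⟩ := BialgHom.nonempty_equiv_hopfRange (centralHom_injective J hZ)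
      have := Fact.mk hp
      exact ⟨e.trans (MonoidAlgebra.domCongrBialgEquiv k k
        (mulEquivOfPrimeCardEq (p := Nat.card Z) rfl (by simp)))⟩

end UpperSeries

/-! ### Semisolvability and the final statement -/

section Semisolvable

theorem HasLowerNormalSeries.mono {k : Type u} [Field k] {P Q : HopfProperty.{u, v} k}
    (hPQ : ∀ (B : Type v) [Ring B] [HopfAlgebra k B], P B → Q B) {A : Type v} [Ring A]
    [HopfAlgebra k A] (h : HasLowerNormalSeries P A) : HasLowerNormalSeries Q A := by
  induction h with
  | nil A hA => exact .nil A hA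
  | step A K hK hne B π hπ hP _ ih => exact .step A K hK hne B π hπ (hPQ B hP) ih

end Semisolvable

end

theorem mainTheorem6 {k : Type*} [Field k] [IsAlgClosed k] [CharZero k]
    {G : Type*} [Group G] [Finite G] [Group.IsNilpotent G]
    (J : HopfTwist k (MonoidAlgebra k G)) :
    HasUpperNormalSeries
      (IsPrimeCyclicGroupAlgebra k (Module.finrank k J.Twisted)) J.Twisted ∧
    HasLowerNormalSeries (IsCocommHopf k) J.Twisted ∧
    IsSemisolvableHopf k J.Twisted :=
  ⟨J.hasUpperNormalSeries (by rw [J.finrank_twisted]), J.hasLowerNormalSeries,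
    Or.inl (J.hasLowerNormalSeries.mono fun _ _ _ h => Or.inr h)⟩
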